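/- Let $N\ge 1$ be an integer and let $\alpha_\tau>0$ be real and $M_\tau\ge 1$ integers for $\tau=1,2,\ldots$. Put $\mathcal U^N=\{x\in\mathbb R^N: 1\ge x_1\ge\cdots\ge x_N\ge 0\}$. For $\alpha>0$ and $M\ge 1$, the Jacobi ensemble ($\beta=2$) with parameters $\alpha,M,N$ is the law of the random vector $x=(1,\ldots,1,x_1,\ldots,x_{\min(M,N)})\in\mathcal U^N$, with $N-\min(M,N)$ leading ones, where $(x_1\ge\cdots\ge x_{\min(M,N)})\in[0,1]^{\min(M,N)}$ has density proportional to $$\prod_{1\le i<j\le \min(M,N)}|x_i-x_j|^{2}\prod_{i=1}^{\min(M,N)}x_i^{\alpha-1}(1-x_i)^{|M-N|}.$$ Let $\hat s_\kappa(x)=s_\kappa(x_1,\ldots,x_N)/s_\kappa(1,\ldots,1)$ be the normalized Schur polynomials. For $v\in\mathcal U^N$ and $w$ distributed as the Jacobi ensemble with parameters $\alpha,M,N$, let $v\boxtimes w$ be a random vector in $\mathcal U^N$ whose law is the unique one with $\mathbb E\,\hat s_\kappa(v\boxtimes w)=\hat s_\kappa(v)\,\mathbb E\,\hat s_\kappa(w)$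 for all partitions $\kappa$ of length at most $N$. The Jacobi product process ($\beta=2$) with parameters $(\alpha_\tau,M_\tau)_{\tau\ge1}$ is the Markov chain $(\mathbf y^{(T)})_{T\ge 1}$ in $\mathcal U^N$ such that $\mathbf y^{(1)}$ is distributed as the Jacobi ensemble with parameters $\alpha_1,M_1,N$ and such that, given $\mathbf y^{(T)}=v$, $\mathbf y^{(T+1)}$ has the law of $v\boxtimes w$ with $w$ distributed as the Jacobi ensemble with parameters $\alpha_{T+1},M_{T+1},N$. **Theorem.** Let $(\mathbf y^{(T)})_{T\ge1}$ be this process, let $T_1\ge\cdots\ge T_m>0$ be integers and $c_1,\ldots,c_m>0$ real. Then $$\mathbb E\Big[\prod_{i=1}^m\sum_{k=1}^N\big(y^{(T_i)}_k\big)^{c_i}\Big]=\frac{\prod_{i=1}^m(-c_i)^{-1}}{(2\pi\mathbf i)^m}\oint_{\mathfrak U_1}\cdots\oint_{\mathfrak U_m}\prod_{1\le i<j\le m}\frac{(u_j-u_i)(u_j+c_j-u_i-c_i)}{(u_j-u_i-c_i)(u_j+c_j-u_i)}\prod_{i=1}^m\Big(\prod_{\ell=1}^N\frac{u_i+\ell-1}{u_i+c_i+\ell-1}\prod_{\tau=1}^{T_i}\prod_{\ell=1}^{M_\tau}\frac{u_i+c_i-\alpha_\tau-\ell+1}{u_i-\alpha_\tau-\ell+1}\Big)du_i$$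 for all closed piecewise $C^1$ contours $\mathfrak U_1,\ldots,\mathfrak U_m$ such that $\mathfrak U_i$ is positively oriented around the points $-c_i-\ell+1$, $1\le\ell\le N$ (winding number $1$), does not pass through or enclose the points $\alpha_\tau+\ell-1$, $1\le\ell\le M_\tau$, $1\le\tau\le T_i$ (winding number $0$), and is enclosed by $\mathfrak U_j-c_i$ and by $\mathfrak U_j+c_j$ for all $j>i$ (these have winding number $1$ around each point of $\mathfrak U_i$). -/

import Mathlib

open scoped MeasureTheory ProbabilityTheory

namespace JacobiProduct

/-! ### Schur polynomials -/

section Schur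

open MvPolynomial

/-- The alternant `det (x_i ^ (κ_j + N - j))`, with `1 ≤ i, j ≤ N`
(the index `j : Fin N` below counts from `0`). -/
noncomputable def alternant {N : ℕ} (κ : Fin N → ℕ) : MvPolynomial (Fin N) ℝ :=
  (Matrix.of fun i j : Fin N => (X i : MvPolynomial (Fin N) ℝ) ^ (κ j + (N - 1 - (j : ℕ)))).det

/-- The Vandermonde product `∏_{i < j} (x_i - x_j)`. -/
noncomputable def vandermondeProd (N : ℕ) : MvPolynomial (Fin N) ℝ :=
  ∏ i : Fin N, ∏ j ∈ Finset.Ioi i, (X i - X j)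

theorem irreducible_X_sub_X {N : ℕ} {i j : Fin N} (h : i ≠ j) : Irreducible (X i - X j : MvPolynomial (Fin N) ℝ) := by
  have hc : (X i - X j : MvPolynomial (Fin N) ℝ).coeff (Finsupp.single i 1) = 1 := by
    rw [coeff_sub, coeff_X, coeff_X, if_pos rfl, if_neg, sub_zero]
    · intro hh
      exact h.symm ((Finsupp.single_left_inj one_ne_zero).1 hh)
  apply MvPolynomial.irreducible_of_totalDegree_eq_one
  · apply le_antisymm
    · refine (totalDegree_sub _ _).trans ?_
      simp [totalDegree_X]
    · have := le_totalDegree (p := (X i - X j : MvPolynomial (Fin N) ℝ)) (s := Finsupp.single i 1)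
        (by rw [mem_support_iff, hc]; exact one_ne_zero)
      simpa using this
  · intro x hx
    have := hx (Finsupp.single i 1)
    rw [hc] at this
    exact isUnit_of_dvd_one this
theorem X_sub_X_dvd_alternant {N : ℕ} (κ : Fin N → ℕ) {i j : Fin N} (h : i ≠ j) :
    (X i - X j : MvPolynomial (Fin N) ℝ) ∣ alternant κ := by
  rw [← Ideal.mem_span_singleton, ← Ideal.Quotient.eq_zero_iff_mem, alternant, RingHom.map_det]
  refine Matrix.det_zero_of_row_eq h ?_
  have hX : Ideal.Quotient.mk (Ideal.span {(X i - X j : MvPolynomial (Fin N) ℝ)}) (X i)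
      = Ideal.Quotient.mk _ (X j) :=
    Ideal.Quotient.eq.2 (Ideal.mem_span_singleton_self _)
  funext k
  simp [hX]

theorem isRelPrime_X_sub_X {N : ℕ} {i j k l : Fin N} (hij : i < j) (hkl : k < l) (h : (i, j) ≠ (k, l)) :
    IsRelPrime (X i - X j : MvPolynomial (Fin N) ℝ) (X k - X l) := by
  classical
  refine (irreducible_X_sub_X hij.ne).isRelPrime_iff_not_dvd.2 ?_
  rintro ⟨q, hq⟩
  have key : ∀ x : Fin N → ℝ, x i = x j → x k = x l := by
    intro x hx
    have := congrArg (eval x) hq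
    simp only [map_sub, map_mul, eval_X, hx, sub_self, zero_mul] at this
    linarith
  by_cases hk : k = i ∨ k = j
  · by_cases hl : l = i ∨ l = j
    · apply h
      rcases hk with rfl | rfl <;> rcases hl with rfl | rfl
      · exact absurd hkl (lt_irrefl _)
      · rfl
      · exact absurd hkl hij.asymm
      · exact absurd hkl (lt_irrefl _)
    · push Not at hl
      have := key (Pi.single l 1) (by rw [Pi.single_eq_of_ne hl.1.symm, Pi.single_eq_of_ne hl.2.symm])
      rw [Pi.single_eq_same, Pi.single_eq_of_ne hkl.ne] at this
      exact zero_ne_one this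
  · push Not at hk
    have := key (Pi.single k 1) (by rw [Pi.single_eq_of_ne hk.1.symm, Pi.single_eq_of_ne hk.2.symm])
    rw [Pi.single_eq_same, Pi.single_eq_of_ne hkl.ne'] at this
    exact one_ne_zero this

theorem vandermondeProd_dvd_alternant {N : ℕ} (κ : Fin N → ℕ) : vandermondeProd N ∣ alternant κ := by
  rw [vandermondeProd, Finset.prod_sigma']
  refine Finset.prod_dvd_of_isRelPrime ?_ ?_
  · rintro ⟨i, j⟩ hij ⟨k, l⟩ hkl hne
    simp only [Finset.coe_sigma, Set.mem_sigma_iff, Finset.mem_coe, Finset.mem_Ioi] at hij hkl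
    refine isRelPrime_X_sub_X hij.2 hkl.2 ?_
    intro h
    apply hne
    cases h
    rfl
  · rintro ⟨i, j⟩ hij
    exact X_sub_X_dvd_alternant κ (Finset.mem_Ioi.1 (Finset.mem_sigma.1 hij).2).ne

/-- The Schur polynomial `s_κ(x_1, …, x_N)`: the unique polynomial whose product with
`∏_{i < j} (x_i - x_j)` is `det (x_i ^ (κ_j + N - j))`. -/
noncomputable def schur {N : ℕ} (κ : Fin N → ℕ) : MvPolynomial (Fin N) ℝ :=
  (vandermondeProd_dvd_alternant κ).choose

theorem vandermondeProd_mul_schur {N : ℕ} (κ : Fin N → ℕ) :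
    vandermondeProd N * schur κ = alternant κ :=
  (vandermondeProd_dvd_alternant κ).choose_spec.symm

/-- The normalized Schur polynomial `s_κ(x) / s_κ(1, …, 1)`, as a function on `ℝ^N`. -/
noncomputable def normSchur {N : ℕ} (κ : Fin N → ℕ) (x : Fin N → ℝ) : ℝ :=
  eval x (schur κ) / eval 1 (schur κ)

end Schur

/-! ### The Jacobi ensemble and the Jacobi product process for `β = 2` -/

section Chain

open MeasureTheory

/-- The ordered cube `{x ∈ ℝ^n : 1 ≥ x_1 ≥ ⋯ ≥ x_n ≥ 0}`. -/
def orderedCube (n : ℕ) : Set (Fin n → ℝ) :=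
  {x | Antitone x ∧ ∀ i, 0 ≤ x i ∧ x i ≤ 1}

/-- The unnormalized density of the (non-trivial particles of the) Jacobi ensemble, `β = 2`. -/
noncomputable def jacobiWeight (α : ℝ) (M N : ℕ) (x : Fin (min M N) → ℝ) : ℝ :=
  (∏ i, ∏ j ∈ Finset.Ioi i, |x i - x j| ^ 2) *
    ∏ i, (x i ^ (α - 1) * (1 - x i) ^ ((M : ℤ) - (N : ℤ)).natAbs)

/-- `(x_1, …, x_{min(M, N)}) ↦ (1, …, 1, x_1, …, x_{min(M, N)}) ∈ ℝ^N`. -/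
def padOnes (M N : ℕ) (x : Fin (min M N) → ℝ) : Fin N → ℝ := fun i =>
  if h : N - min M N ≤ (i : ℕ) then x ⟨(i : ℕ) - (N - min M N), by omega⟩ else 1

/-- The measure with density `jacobiWeight` on the ordered cube. -/
noncomputable def jacobiMass (α : ℝ) (M N : ℕ) : Measure (Fin (min M N) → ℝ) :=
  (volume.restrict (orderedCube (min M N))).withDensity
    fun x => ENNReal.ofReal (jacobiWeight α M N x)

/-- The Jacobi ensemble with `β = 2` and parameters `α, M, N`. -/
noncomputable def jacobiEnsemble (α : ℝ) (M N : ℕ) : Measure (Fin N → ℝ) :=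
  ((jacobiMass α M N Set.univ)⁻¹ • jacobiMass α M N).map (padOnes M N)

/-- `ν` is the law of `v ⊠ w`, for a fixed `v` and for `w` distributed as the Jacobi ensemble:
a probability measure on the ordered cube such that
`E[ŝ_κ(v ⊠ w)] = ŝ_κ(v) E[ŝ_κ(w)]` for all partitions `κ` of length at most `N`, where
`ŝ_κ` is the normalized Schur polynomial. For `v` in the ordered cube there is exactly one
such measure. -/
structure IsBoxLaw (α : ℝ) (M : ℕ) {N : ℕ} (v : Fin N → ℝ) (ν : Measure (Fin N → ℝ)) :
    Prop where
  isProb : IsProbabilityMeasure ν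
  support : ν (orderedCube N)ᶜ = 0
  moments : ∀ κ : Fin N → ℕ, Antitone κ →
    ∫ u, normSchur κ u ∂ν = normSchur κ v * ∫ w, normSchur κ w ∂(jacobiEnsemble α M N)

open Classical in
/-- The transition kernel `v ↦ law of v ⊠ w`, `w` being distributed as the Jacobi ensemble. -/
noncomputable def jacobiKernel (α : ℝ) (M : ℕ) {N : ℕ} (v : Fin N → ℝ) :
    Measure (Fin N → ℝ) :=
  if h : ∃ ν, IsBoxLaw α M v ν then h.choose else 0

/-- The σ-algebra generated by `y^(1), …, y^(T)`. -/
abbrev history {Ω : Type*} {N : ℕ} (y : ℕ → Ω → Fin N → ℝ) (T : ℕ) : MeasurableSpace Ω :=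
  ⨆ s ∈ Finset.Icc 1 T, MeasurableSpace.comap (y s) inferInstance

/-- `(y^(T))_{T ≥ 1}` is a Jacobi product process with `β = 2` and parameters
`(α_T, M_T)_{T ≥ 1}`: a Markov chain in the ordered cube, started from the Jacobi ensemble with
parameters `α_1, M_1`, whose transition from `y^(T)` to `y^(T+1)` is the kernel with parameters
`α_{T+1}, M_{T+1}`. The values of `y`, `α`, `M` at the index `0` play no role. -/
structure IsJacobiProductProcess {Ω : Type*} [MeasurableSpace Ω] (P : Measure Ω) {N : ℕ}
    (α : ℕ → ℝ) (M : ℕ → ℕ) (y : ℕ → Ω → Fin N → ℝ) : Prop where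
  measurable : ∀ T, 1 ≤ T → Measurable (y T)
  mem_cube : ∀ T, 1 ≤ T → ∀ᵐ ω ∂P, y T ω ∈ orderedCube N
  initial : P.map (y 1) = jacobiEnsemble (α 1) (M 1) N
  transition : ∀ T, 1 ≤ T → ∀ B : Set (Fin N → ℝ), MeasurableSet B →
    P⟦y (T + 1) ⁻¹' B | history y T⟧
      =ᵐ[P] fun ω => (jacobiKernel (α (T + 1)) (M (T + 1)) (y T ω)).real B

end Chain

/-! ### Contours -/

section Contours

open MeasureTheory

/-- A closed, piecewise continuously differentiable curve in `ℂ`, parametrized by `[0, 1]`.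
It need not be simple; for a simple positively oriented curve, the points with winding number `1`
(resp. `0`) are the points inside (resp. outside). -/
structure Contour where
  toFun : ℝ → ℂ
  continuousOn : ContinuousOn toFun (Set.Icc 0 1)
  closed : toFun 0 = toFun 1
  piecewise : ∃ (n : ℕ) (p : Fin (n + 1) → ℝ), StrictMono p ∧ p 0 = 0 ∧ p (Fin.last n) = 1 ∧
    ∀ k : Fin n, ContDiffOn ℝ 1 toFun (Set.Icc (p k.castSucc) (p k.succ))

namespace Contour

/-- The set of points on the contour. -/
def trace (γ : Contour) : Set ℂ := γ.toFun '' Set.Icc 0 1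

/-- The translated contour `γ + a`. -/
def translate (γ : Contour) (a : ℂ) : Contour where
  toFun t := γ.toFun t + a
  continuousOn := γ.continuousOn.add continuousOn_const
  closed := by rw [γ.closed]
  piecewise := by
    obtain ⟨n, p, h, h0, h1, hp⟩ := γ.piecewise
    exact ⟨n, p, h, h0, h1, fun k => (hp k).add contDiffOn_const⟩

/-- The winding number `(2πi)⁻¹ ∮_γ dz / (z - w)`, meaningful for `w` off the contour. -/
noncomputable def winding (γ : Contour) (w : ℂ) : ℂ :=
  (2 * Real.pi * Complex.I)⁻¹ * ∫ t in (0 : ℝ)..1, deriv γ.toFun t / (γ.toFun t - w)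

/-- `γ` goes around `w` once, in the positive direction. -/
def Encloses (γ : Contour) (w : ℂ) : Prop := w ∉ γ.trace ∧ γ.winding w = 1

/-- `w` lies outside of `γ`. -/
def Excludes (γ : Contour) (w : ℂ) : Prop := w ∉ γ.trace ∧ γ.winding w = 0

/-- The contour `γ` is enclosed by the contour `δ`. -/
def EnclosedBy (γ δ : Contour) : Prop := ∀ z ∈ γ.trace, δ.Encloses z

end Contour

/-- The contour integral `∮_{U_1} ⋯ ∮_{U_m} F(u_1, …, u_m) du_1 ⋯ du_m`. -/
noncomputable def multiContourIntegral {m : ℕ} (U : Fin m → Contour)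
    (F : (Fin m → ℂ) → ℂ) : ℂ :=
  ∫ t in Set.Icc (0 : Fin m → ℝ) 1,
    F (fun i => (U i).toFun (t i)) * ∏ i, deriv (U i).toFun (t i)

end Contours

end JacobiProduct

/-! Write λ_l = κ_l + N - l for the exponents of the alternant of κ, and Δ for the Vandermonde
product. Two facts about Schur polynomials drive the proof. A power sum acts by p_c s_κ = ∑_j s_{κ +
c e_j} (`psum_mul_schur`); the indices on the right need not be partitions, so `schur` is used for
every κ. The Jacobi average of s_κ is s_κ(1, …, 1) times an explicit quotient of products of the
factors α + λ_l + k, 0 ≤ k < M (`integral_eval_schur_jacobiEnsemble`): the Schur polynomial at a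
point with several coordinates 1 is a confluent determinant, its integral is a determinant of beta
integrals, and after clearing denominators the entries are polynomials in λ_l of degree less than N,
so that only a multiple of Δ(λ) is left.

Hence one step of the chain multiplies the expectation of s_κ by an explicit factor, even against a
bounded function of the past (`integral_eval_schur_succ`). For integer c_i the power sums are
absorbed one by one, from the latest time backwards. Each moves λ to λ + c_i e_j, and the result is
the iterated sum `residueSum` (`risingRatio_mul_integral_powerSums`).

The contour integral is the same sum (`Nested.vander_mul_multiContourIntegral`). Inside the
innermost contour the only poles in u_1 are the simple poles -c_1 - λ_j. The residue there produces
Δ(λ + c_1 e_j) / Δ(λ), and the cross factors replace λ by λ + c_1 e_j in the remaining integrand, so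
induction applies. Only rational functions occur, and partial fractions give the residue theorem for
them.

Finally the exponents are made real one at a time. As functions of one complex exponent both sides
are holomorphic of polynomial growth on the right half-plane and agree at the positive integers, so
they agree on (0, ∞) by a case of Carlson's theorem (`PolyGrowth.eq_zero`). -/

namespace JacobiProduct

/-! ### Contour integrals, winding numbers and nested contours. -/

namespace Contour

open MeasureTheory Set

/-- The contour integral of a function of one complex variable. -/
noncomputable def integral (γ : Contour) (f : ℂ → ℂ) : ℂ :=
  ∫ t in (0 : ℝ)..1, f (γ.toFun t) * deriv γ.toFun t

/-- On each closed piece the one-sided derivative is continuous, hence bounded, and it equals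
`deriv` at interior points. The exceptional set consists of the breakpoints, where `deriv` may be a
default value. -/
theorem exists_deriv_bound (γ : Contour) : ∃ (S : Set ℝ) (C : ℝ), S.Finite ∧
    ∀ t ∈ Icc (0 : ℝ) 1 \ S, DifferentiableAt ℝ γ.toFun t ∧ ‖deriv γ.toFun t‖ ≤ C := by
  obtain ⟨n, p, hp, h0, h1, hd⟩ := γ.piecewise
  have hb : ∀ k : Fin n, ∃ C : ℝ, ∀ t ∈ Icc (p k.castSucc) (p k.succ),
      ‖derivWithin γ.toFun (Icc (p k.castSucc) (p k.succ)) t‖ ≤ C := fun k =>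
    isCompact_Icc.exists_bound_of_continuousOn
      ((hd k).continuousOn_derivWithin (uniqueDiffOn_Icc (hp k.castSucc_lt_succ)) le_rfl)
  choose C hC using hb
  refine ⟨range p, ∑ k, |C k|, finite_range p, ?_⟩
  rintro t ⟨ht, htp⟩
  have key : ∃ k : Fin n, t ∈ Ioo (p k.castSucc) (p k.succ) := by
    by_contra! hcon
    have : ∀ k : Fin (n + 1), p k < t := by
      intro k
      induction k using Fin.induction with
      | zero => exact lt_of_le_of_ne (h0 ▸ ht.1) fun h => htp ⟨_, h⟩
      | succ k ih =>
        by_contra hlt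
        refine hcon k ⟨ih, lt_of_le_of_ne (not_lt.1 hlt) fun h => htp ⟨_, h.symm⟩⟩
    have := this (Fin.last n)
    rw [h1] at this
    exact absurd ht.2 (not_le.2 this)
  obtain ⟨k, hk⟩ := key
  have hnhds : Icc (p k.castSucc) (p k.succ) ∈ nhds t := Icc_mem_nhds hk.1 hk.2
  have hdiff : DifferentiableAt ℝ γ.toFun t :=
    (((hd k).differentiableOn one_ne_zero) t (Ioo_subset_Icc_self hk)).differentiableAt hnhds
  refine ⟨hdiff, ?_⟩
  rw [← derivWithin_of_mem_nhds hnhds]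
  exact (hC k t (Ioo_subset_Icc_self hk)).trans ((le_abs_self _).trans
    (Finset.single_le_sum (f := fun k => |C k|) (fun _ _ => abs_nonneg _) (Finset.mem_univ k)))

theorem integrableOn_deriv (γ : Contour) : IntegrableOn (deriv γ.toFun) (Icc 0 1) := by
  obtain ⟨S, C, hS, h⟩ := γ.exists_deriv_bound
  refine Measure.integrableOn_of_bounded (M := C) (by simp)
    (measurable_deriv _).aestronglyMeasurable ?_
  rw [ae_restrict_iff' measurableSet_Icc]
  filter_upwards [hS.countable.ae_notMem volume] with t ht hI
  exact (h t ⟨hI, ht⟩).2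

theorem isCompact_trace (γ : Contour) : IsCompact γ.trace :=
  isCompact_Icc.image_of_continuousOn γ.continuousOn

theorem mem_trace (γ : Contour) {t : ℝ} (ht : t ∈ Icc (0 : ℝ) 1) : γ.toFun t ∈ γ.trace :=
  mem_image_of_mem _ ht

theorem intervalIntegrable (γ : Contour) {f : ℂ → ℂ} (hf : ContinuousOn f γ.trace) :
    IntervalIntegrable (fun t => f (γ.toFun t) * deriv γ.toFun t) volume 0 1 := by
  rw [intervalIntegrable_iff_integrableOn_Icc_of_le zero_le_one]
  exact IntegrableOn.continuousOn_mul (hf.comp γ.continuousOn fun t ht => γ.mem_trace ht)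
    γ.integrableOn_deriv isCompact_Icc

/-- The fundamental theorem of calculus holds across the finitely many breakpoints, and the contour
is closed. The vanishing of contour integrals below comes from exhibiting a primitive near the
trace. -/
theorem integral_eq_zero_of_hasDerivAt (γ : Contour) {F f : ℂ → ℂ} (hf : ContinuousOn f γ.trace)
    (hF : ∀ z ∈ γ.trace, HasDerivAt F (f z) z) : γ.integral f = 0 := by
  obtain ⟨S, C, hS, h⟩ := γ.exists_deriv_bound
  have := integral_eq_of_hasDerivAt_off_countable_of_le (fun t => F (γ.toFun t))
    (fun t => f (γ.toFun t) * deriv γ.toFun t) zero_le_one hS.countable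
    (ContinuousOn.comp (g := F) (t := γ.trace)
      (fun z hz => (hF z hz).continuousAt.continuousWithinAt)
      γ.continuousOn fun t ht => γ.mem_trace ht)
    (fun t ht => (hF _ (γ.mem_trace (Ioo_subset_Icc_self ht.1))).comp t
      (h t ⟨Ioo_subset_Icc_self ht.1, ht.2⟩).1.hasDerivAt)
    (γ.intervalIntegrable hf)
  rw [integral, this, γ.closed, sub_self]

theorem winding_eq_integral (γ : Contour) (w : ℂ) :
    γ.winding w = (2 * Real.pi * Complex.I)⁻¹ * γ.integral fun z => (z - w)⁻¹ := by
  simp only [winding, integral, div_eq_mul_inv, mul_comm]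

theorem continuousOn_inv_sub (γ : Contour) {w : ℂ} (hw : w ∉ γ.trace) :
    ContinuousOn (fun z => (z - w)⁻¹) γ.trace :=
  ContinuousOn.inv₀ (by fun_prop) fun z hz h => hw (sub_eq_zero.1 h ▸ hz)

theorem integral_add (γ : Contour) {f g : ℂ → ℂ} (hf : ContinuousOn f γ.trace)
    (hg : ContinuousOn g γ.trace) :
    γ.integral (fun z => f z + g z) = γ.integral f + γ.integral g := by
  simp only [integral, add_mul]
  exact intervalIntegral.integral_add (γ.intervalIntegrable hf) (γ.intervalIntegrable hg)

theorem integral_const_mul (γ : Contour) (a : ℂ) (f : ℂ → ℂ) :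
    γ.integral (fun z => a * f z) = a * γ.integral f := by
  simp only [integral, mul_assoc]
  exact intervalIntegral.integral_const_mul _ _

theorem integral_sum (γ : Contour) {ι : Type*} (s : Finset ι) {f : ι → ℂ → ℂ}
    (hf : ∀ i ∈ s, ContinuousOn (f i) γ.trace) :
    γ.integral (fun z => ∑ i ∈ s, f i z) = ∑ i ∈ s, γ.integral (f i) := by
  simp only [integral, Finset.sum_mul]
  exact intervalIntegral.integral_finsetSum fun i hi => γ.intervalIntegrable (hf i hi)

theorem integral_congr (γ : Contour) {f g : ℂ → ℂ} (h : ∀ z ∈ γ.trace, f z = g z) :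
    γ.integral f = γ.integral g := by
  refine intervalIntegral.integral_congr fun t ht => ?_
  rw [uIcc_of_le zero_le_one] at ht
  simp only [h _ (γ.mem_trace ht)]

/-- The winding number does not change along a segment which avoids the contour. -/
theorem winding_eq_of_segment (γ : Contour) {w w' : ℂ} (h : Disjoint (segment ℝ w w') γ.trace) :
    γ.winding w = γ.winding w' := by
  have hw : w ∉ γ.trace := disjoint_left.1 h (left_mem_segment ℝ w w')
  have hw' : w' ∉ γ.trace := disjoint_left.1 h (right_mem_segment ℝ w w')
  have hc := γ.continuousOn_inv_sub hw
  have hc' := γ.continuousOn_inv_sub hw'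
  -- The principal logarithm of (z - w) / (z - w') is a primitive of the difference of the two
  -- integrands: the quotient lies on the cut only if z lies on the segment from w to w'.
  have key := γ.integral_eq_zero_of_hasDerivAt (F := fun z => Complex.log ((z - w) / (z - w')))
    (f := fun z => (z - w)⁻¹ + (-1) * (z - w')⁻¹) (hc.add (continuousOn_const.mul hc')) ?_
  · rw [γ.integral_add (g := fun z => (-1) * (z - w')⁻¹) hc (continuousOn_const.mul hc'),
      integral_const_mul] at key
    rw [winding_eq_integral, winding_eq_integral]
    congr 1
    linear_combination key
  · intro z hz
    have h1 : z - w ≠ 0 := fun h => hw (sub_eq_zero.1 h ▸ hz)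
    have h2 : z - w' ≠ 0 := fun h => hw' (sub_eq_zero.1 h ▸ hz)
    have hd : HasDerivAt (fun z => (z - w) / (z - w'))
        ((1 * (z - w') - (z - w) * 1) / (z - w') ^ 2) z :=
      ((hasDerivAt_id z).sub_const w).div ((hasDerivAt_id z).sub_const w') h2
    have hs : (z - w) / (z - w') ∈ Complex.slitPlane := by
      by_contra hns
      rw [Complex.mem_slitPlane_iff] at hns
      push Not at hns
      obtain ⟨hre, him⟩ := hns
      set s : ℝ := -((z - w) / (z - w')).re with hs
      have hs0 : 0 ≤ s := by rw [hs]; linarith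
      have heq : (z - w) / (z - w') = -(s : ℂ) := by
        apply Complex.ext <;> simp [hs, him]
      rw [div_eq_iff h2] at heq
      refine disjoint_left.1 h ?_ hz
      -- Solving z - w = -s (z - w') gives z = (w + s w') / (1 + s), a point of the segment.
      refine ⟨1 / (1 + s), s / (1 + s), by positivity, by positivity, by field_simp, ?_⟩
      have h3 : (1 + s : ℂ) ≠ 0 := by
        have : (1 + s : ℝ) ≠ 0 := by positivity
        exact_mod_cast this
      simp only [Complex.real_smul]
      push_cast
      field_simp
      linear_combination -heq
    convert hd.clog hs using 1
    field_simp
    ring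

theorem winding_eq_of_isPreconnected (γ : Contour) {s : Set ℂ} (hs : IsPreconnected s)
    (hd : Disjoint s γ.trace) {w w' : ℂ} (hw : w ∈ s) (hw' : w' ∈ s) :
    γ.winding w = γ.winding w' := by
  refine hs.induction₂ (fun a b => γ.winding a = γ.winding b) (fun x hx => ?_)
    (fun _ _ _ _ _ _ => Eq.trans) (fun _ _ _ _ => Eq.symm) hw hw'
  have hopen : IsOpen γ.traceᶜ := γ.isCompact_trace.isClosed.isOpen_compl
  obtain ⟨r, hr, hball⟩ := Metric.isOpen_iff.1 hopen x (disjoint_left.1 hd hx)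
  filter_upwards [mem_nhdsWithin_of_mem_nhds (Metric.ball_mem_nhds x hr)] with y hy
  refine γ.winding_eq_of_segment (disjoint_left.2 fun z hz => hball ?_)
  exact (convex_ball x r).segment_subset (Metric.mem_ball_self hr) hy hz

/-- Here w - z is nonzero with nonnegative real part, so log (w - z) is a primitive. This takes the
place of an argument with the unbounded component of the complement. -/
theorem winding_eq_zero_of_re_le (γ : Contour) {w : ℂ} (hw : w ∉ γ.trace)
    (h : ∀ z ∈ γ.trace, z.re ≤ w.re) : γ.winding w = 0 := by
  rw [winding_eq_integral, γ.integral_eq_zero_of_hasDerivAt (F := fun z => Complex.log (w - z))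
    (γ.continuousOn_inv_sub hw), mul_zero]
  intro z hz
  have hne : w - z ≠ 0 := fun h => hw (sub_eq_zero.1 h ▸ hz)
  have hs : w - z ∈ Complex.slitPlane := by
    rw [Complex.mem_slitPlane_iff]
    by_contra! hcon
    refine hne (Complex.ext ?_ hcon.2)
    have := h z hz
    have := hcon.1
    simp only [Complex.sub_re, Complex.zero_re] at *
    linarith
  have hd : HasDerivAt (fun z => w - z) (-1) z := (hasDerivAt_id z).const_sub w
  convert hd.clog hs using 1
  rw [← neg_sub z w, inv_eq_one_div, div_neg, neg_div, neg_neg]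

theorem trace_nonempty (γ : Contour) : γ.trace.Nonempty := ⟨_, γ.mem_trace ⟨le_rfl, zero_le_one⟩⟩

/-- A contour does not wind around the points of a contour by which it is enclosed. -/
theorem EnclosedBy.excludes {γ δ : Contour} (h : γ.EnclosedBy δ) {z : ℂ} (hz : z ∈ δ.trace) :
    γ.Excludes z := by
  have hdisj : Disjoint δ.trace γ.trace := disjoint_left.2 fun x hx hx' => (h x hx').1 hx
  refine ⟨disjoint_left.1 hdisj hz, ?_⟩
  -- Take the rightmost point of both traces. It cannot lie on γ, since δ would not wind around it;
  -- so it lies on δ, γ does not wind around it, and the winding number of γ is constant along the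
  -- connected trace of δ.
  obtain ⟨z₀, hz₀, hmax⟩ := (γ.isCompact_trace.union δ.isCompact_trace).exists_isMaxOn
    (γ.trace_nonempty.inl) Complex.continuous_re.continuousOn
  rcases hz₀ with hz₀ | hz₀
  · have h1 := (h z₀ hz₀).2
    rw [δ.winding_eq_zero_of_re_le (h z₀ hz₀).1 fun x hx => hmax (Or.inr hx)] at h1
    exact absurd h1 zero_ne_one
  · rw [γ.winding_eq_of_isPreconnected (isPreconnected_Icc.image _ δ.continuousOn) hdisj hz hz₀]
    exact γ.winding_eq_zero_of_re_le (disjoint_left.1 hdisj hz₀) fun x hx => hmax (Or.inl hx)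

/-- A contour encloses the points which are enclosed by a contour that it encloses. -/
theorem EnclosedBy.encloses {γ δ : Contour} (h : γ.EnclosedBy δ) {p : ℂ} (hp : γ.Encloses p) :
    δ.Encloses p := by
  have hout : ∀ q, γ.winding q = 1 → q ∉ δ.trace := fun q hq hq' =>
    zero_ne_one ((h.excludes hq').2.symm.trans hq)
  refine ⟨hout p hp.2, ?_⟩
  -- The ray from p to the right must hit γ, for otherwise the winding number 1 could be carried to
  -- a point to the right of γ, where it is 0. Let `sInf S` be the first hit.
  set S : Set ℝ := {t | 0 ≤ t ∧ p + t ∈ γ.trace} with hS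
  have hseg : ∀ t : ℝ, 0 ≤ t → ∀ q ∈ segment ℝ p (p + t), ∃ s : ℝ, 0 ≤ s ∧ s ≤ t ∧ q = p + s := by
    rintro t ht q ⟨a, b, ha, hb, hab, rfl⟩
    refine ⟨b * t, by positivity, by nlinarith, ?_⟩
    have : (a : ℂ) = 1 - b := by rw [eq_sub_iff_add_eq]; exact_mod_cast hab
    simp only [Complex.real_smul, this]
    push_cast
    ring
  have hclosed : IsClosed S := by
    have : Continuous fun t : ℝ => p + (t : ℂ) := by fun_prop
    exact isClosed_Ici.inter (γ.isCompact_trace.isClosed.preimage this)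
  have hne : S.Nonempty := by
    by_contra hemp
    rw [not_nonempty_iff_eq_empty, eq_empty_iff_forall_notMem] at hemp
    obtain ⟨z₀, hz₀, hmax⟩ := γ.isCompact_trace.exists_isMaxOn γ.trace_nonempty
      Complex.continuous_re.continuousOn
    set t : ℝ := max 0 (z₀.re - p.re) with ht
    have ht0 : 0 ≤ t := le_max_left _ _
    have h1 : γ.winding p = γ.winding (p + t) := by
      refine γ.winding_eq_of_segment (disjoint_left.2 fun q hq hq' => ?_)
      obtain ⟨s, hs, -, rfl⟩ := hseg t ht0 q hq
      exact hemp s ⟨hs, hq'⟩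
    rw [hp.2, γ.winding_eq_zero_of_re_le (fun hq => hemp t ⟨ht0, hq⟩)] at h1
    · exact one_ne_zero h1
    · intro z hz
      have h2 : z.re ≤ z₀.re := hmax hz
      have h3 : z₀.re - p.re ≤ t := le_max_right _ _
      simp only [Complex.add_re, Complex.ofReal_re]
      linarith
  have hbdd : BddBelow S := ⟨0, fun t ht => ht.1⟩
  have hmem : sInf S ∈ S := hclosed.csInf_mem hne hbdd
  rw [δ.winding_eq_of_segment (w' := p + (sInf S : ℝ))]
  · exact (h _ hmem.2).2
  · refine disjoint_left.2 fun q hq => ?_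
    obtain ⟨s, hs, hs', rfl⟩ := hseg _ hmem.1 q hq
    -- Before the first hit the winding number of γ is still 1, so the ray avoids δ by `hout`. The
    -- hit itself lies on γ, hence is enclosed by δ, and the winding number of δ can be carried back
    -- to p.
    rcases hs'.eq_or_lt with rfl | hlt
    · exact (h _ hmem.2).1
    · refine hout _ ?_
      rw [← hp.2]
      refine (γ.winding_eq_of_segment (disjoint_left.2 fun q hq hq' => ?_)).symm
      obtain ⟨r, hr, hr', rfl⟩ := hseg s hs q hq
      exact absurd (csInf_le hbdd ⟨hr, hq'⟩) (not_le.2 (hr'.trans_lt hlt))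

theorem mem_trace_translate (γ : Contour) {a z : ℂ} :
    z ∈ (γ.translate a).trace ↔ z - a ∈ γ.trace := by
  simp only [trace, translate, mem_image, eq_sub_iff_add_eq]

theorem winding_translate (γ : Contour) (a w : ℂ) :
    (γ.translate a).winding w = γ.winding (w - a) := by
  simp only [winding, translate, deriv_add_const, sub_sub_eq_add_sub]

theorem encloses_translate (γ : Contour) {a z : ℂ} :
    (γ.translate a).Encloses z ↔ γ.Encloses (z - a) := by
  rw [Encloses, Encloses, mem_trace_translate, winding_translate]

end Contour

end JacobiProduct


/-! ### The residue theorem for rational functions. -/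

namespace JacobiProduct

namespace Contour

open MeasureTheory Set

/-- Rational functions all of whose poles lie outside of the contour. -/
def Regular (γ : Contour) (g : ℂ → ℂ) : Prop :=
  ∃ (p : Polynomial ℂ) (s : Multiset ℂ), (∀ q ∈ s, γ.Excludes q) ∧
    ∀ u, g u = p.eval u * (s.map fun q => (u - q)⁻¹).prod

namespace Regular

theorem eval (γ : Contour) (p : Polynomial ℂ) : γ.Regular fun u => p.eval u :=
  ⟨p, 0, by simp, by simp⟩

theorem const (γ : Contour) (a : ℂ) : γ.Regular fun _ => a := by
  simpa using eval γ (Polynomial.C a)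

theorem add_const (γ : Contour) (a : ℂ) : γ.Regular fun u => u + a :=
  ⟨Polynomial.X + Polynomial.C a, 0, by simp, fun u => by simp⟩

theorem inv_sub {γ : Contour} {q : ℂ} (hq : γ.Excludes q) : γ.Regular fun u => (u - q)⁻¹ :=
  ⟨1, {q}, by simpa using hq, by simp⟩

theorem mul {γ : Contour} {g h : ℂ → ℂ} (hg : γ.Regular g) (hh : γ.Regular h) :
    γ.Regular fun u => g u * h u := by
  obtain ⟨p, s, hs, hp⟩ := hg
  obtain ⟨p', s', hs', hp'⟩ := hh
  refine ⟨p * p', s + s', fun q hq => ?_, fun u => ?_⟩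
  · rcases Multiset.mem_add.1 hq with h | h
    exacts [hs q h, hs' q h]
  · simp only [hp, hp', Polynomial.eval_mul, Multiset.map_add, Multiset.prod_add]
    ring

theorem prod {γ : Contour} {ι : Type*} (s : Finset ι) {g : ι → ℂ → ℂ}
    (h : ∀ i ∈ s, γ.Regular (g i)) : γ.Regular fun u => ∏ i ∈ s, g i u := by
  classical
  induction s using Finset.induction_on with
  | empty => simpa using const γ 1
  | insert a s ha ih =>
    simp only [Finset.prod_insert ha]
    exact (h a (Finset.mem_insert_self _ _)).mul
      (ih fun i hi => h i (Finset.mem_insert_of_mem hi))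

end Regular

theorem continuousOn_prod_inv_sub (γ : Contour) {s : Multiset ℂ} (hs : ∀ q ∈ s, q ∉ γ.trace) :
    ContinuousOn (fun u => (s.map fun q => (u - q)⁻¹).prod) γ.trace := by
  induction s using Multiset.induction_on with
  | empty => simpa using continuousOn_const
  | cons a s ih =>
    simp only [Multiset.map_cons, Multiset.prod_cons]
    exact (γ.continuousOn_inv_sub (hs a (Multiset.mem_cons_self _ _))).mul
      (ih fun q hq => hs q (Multiset.mem_cons_of_mem hq))

theorem Regular.continuousOn {γ : Contour} {g : ℂ → ℂ} (hg : γ.Regular g) :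
    ContinuousOn g γ.trace := by
  obtain ⟨p, s, hs, hp⟩ := hg
  rw [show g = fun u => p.eval u * (s.map fun q => (u - q)⁻¹).prod from funext hp]
  exact p.continuous.continuousOn.fun_mul
    (γ.continuousOn_prod_inv_sub fun q hq => (hs q hq).1)

theorem integral_eval (γ : Contour) (p : Polynomial ℂ) : γ.integral (fun u => p.eval u) = 0 := by
  induction p using Polynomial.induction_on' with
  | add p q hp hq =>
    simp only [Polynomial.eval_add]
    rw [γ.integral_add p.continuous.continuousOn q.continuous.continuousOn, hp, hq, add_zero]
  | monomial n a =>
    simp only [Polynomial.eval_monomial]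
    rw [integral_const_mul, γ.integral_eq_zero_of_hasDerivAt
      (F := fun z => z ^ (n + 1) / (n + 1)) (by fun_prop), mul_zero]
    intro z _
    have : (n : ℂ) + 1 ≠ 0 := Nat.cast_add_one_ne_zero n
    have hd := (hasDerivAt_pow (n + 1) z).div_const ((n : ℂ) + 1)
    rwa [Nat.add_sub_cancel, Nat.cast_succ, mul_div_cancel_left₀ _ this] at hd

theorem integral_inv_pow (γ : Contour) {q : ℂ} (hq : γ.Excludes q) (n : ℕ) :
    γ.integral (fun u => (u - q)⁻¹ ^ (n + 1)) = 0 := by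
  have hne : ∀ z ∈ γ.trace, z - q ≠ 0 := fun z hz h => hq.1 (sub_eq_zero.1 h ▸ hz)
  rcases n with _ | n
  · have h := hq.2
    rw [winding_eq_integral] at h
    simpa [Real.pi_ne_zero] using h
  · refine γ.integral_eq_zero_of_hasDerivAt
      (F := fun z => -((z - q)⁻¹ ^ (n + 1)) / (n + 1)) ((γ.continuousOn_inv_sub hq.1).pow _) ?_
    intro z hz
    have h1 : HasDerivAt (fun z => (z - q)⁻¹) (-1 / (z - q) ^ 2) z :=
      ((hasDerivAt_id z).sub_const q).inv (hne z hz)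
    have hn : (n : ℂ) + 1 ≠ 0 := Nat.cast_add_one_ne_zero n
    have hd := (h1.fun_pow (n + 1)).fun_neg.div_const ((n : ℂ) + 1)
    have heq : (z - q)⁻¹ ^ (n + 1 + 1) =
        -(((n + 1 : ℕ) : ℂ) * (z - q)⁻¹ ^ (n + 1 - 1) * (-1 / (z - q) ^ 2)) / (n + 1) := by
      rw [Nat.add_sub_cancel, eq_div_iff hn, div_eq_mul_inv, ← inv_pow]
      push_cast
      ring
    rwa [heq]

/-- Induction on the number of factors by partial fractions. If all poles coincide, the integrand is
a single power; otherwise two distinct poles a, b allow (u - a)⁻¹(u - b)⁻¹ to be split into two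
terms with one factor fewer. -/
theorem integral_prod_inv (γ : Contour) (n : ℕ) : ∀ s : Multiset ℂ, s.card = n + 1 →
    (∀ q ∈ s, γ.Excludes q) → γ.integral (fun u => (s.map fun q => (u - q)⁻¹).prod) = 0 := by
  induction n with
  | zero =>
    intro s hs h
    obtain ⟨q, rfl⟩ := Multiset.card_eq_one.1 hs
    simpa using γ.integral_inv_pow (h q (Multiset.mem_singleton_self q)) 0
  | succ n ih =>
    intro s hs h
    obtain ⟨a, has⟩ := Multiset.card_pos_iff_exists_mem.1 (by omega : 0 < s.card)
    obtain ⟨t, rfl⟩ := Multiset.exists_cons_of_mem has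
    have ht : t.card = n + 1 := by simpa using hs
    have ha := h a (Multiset.mem_cons_self a t)
    by_cases hall : ∀ q ∈ t, q = a
    · rw [Multiset.eq_replicate.2 ⟨ht, hall⟩, ← Multiset.replicate_succ]
      simpa only [Multiset.map_replicate, Multiset.prod_replicate]
        using γ.integral_inv_pow ha (n + 1)
    · push Not at hall
      obtain ⟨b, hb, hba⟩ := hall
      obtain ⟨r, rfl⟩ := Multiset.exists_cons_of_mem hb
      have hbE := h b (by simp)
      have hr : r.card = n := by simpa using ht
      have hEa : ∀ q ∈ a ::ₘ r, γ.Excludes q := fun q hq => h q (by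
        simp only [Multiset.mem_cons] at hq ⊢; tauto)
      have hEb : ∀ q ∈ b ::ₘ r, γ.Excludes q := fun q hq => h q (by
        simp only [Multiset.mem_cons] at hq ⊢; tauto)
      have h1 := ih (a ::ₘ r) (by simp [hr]) hEa
      have h2 := ih (b ::ₘ r) (by simp [hr]) hEb
      have hc1 := γ.continuousOn_prod_inv_sub fun q hq => (hEa q hq).1
      have hc2 := γ.continuousOn_prod_inv_sub fun q hq => (hEb q hq).1
      have key : ∀ u ∈ γ.trace, ((a ::ₘ b ::ₘ r).map fun q => (u - q)⁻¹).prod =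
          (a - b)⁻¹ * ((a ::ₘ r).map fun q => (u - q)⁻¹).prod +
            (-(a - b)⁻¹) * ((b ::ₘ r).map fun q => (u - q)⁻¹).prod := by
        intro u hu
        simp only [Multiset.map_cons, Multiset.prod_cons]
        have hua : u - a ≠ 0 := fun h => ha.1 (sub_eq_zero.1 h ▸ hu)
        have hub : u - b ≠ 0 := fun h => hbE.1 (sub_eq_zero.1 h ▸ hu)
        have hab : a - b ≠ 0 := sub_ne_zero.2 hba.symm
        field_simp
        ring
      rw [γ.integral_congr key, γ.integral_add (continuousOn_const.fun_mul hc1)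
        (continuousOn_const.fun_mul hc2), integral_const_mul, integral_const_mul, h1, h2]
      simp

/-- Writing p = (X - a) r + p(a) cancels one pole at the cost of a constant multiple of a pure
product of inverses, so the poles can be removed one after another. -/
theorem Regular.integral_eq_zero {γ : Contour} {g : ℂ → ℂ} (hg : γ.Regular g) :
    γ.integral g = 0 := by
  obtain ⟨p, s, hs, hp⟩ := hg
  rw [γ.integral_congr fun u _ => hp u]
  clear hp
  induction s using Multiset.induction_on generalizing p with
  | empty => simpa using γ.integral_eval p
  | cons a s ih =>
    have hs' : ∀ q ∈ s, γ.Excludes q := fun q hq => hs q (Multiset.mem_cons_of_mem hq)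
    obtain ⟨r, hr⟩ := Polynomial.X_sub_C_dvd_sub_C_eval (a := a) (p := p)
    have hpe : ∀ u, p.eval u = (u - a) * r.eval u + p.eval a := fun u => by
      have := congrArg (Polynomial.eval u) hr
      simp only [Polynomial.eval_sub, Polynomial.eval_mul, Polynomial.eval_X,
        Polynomial.eval_C] at this
      linear_combination this
    have hc1 := γ.continuousOn_prod_inv_sub fun q hq => (hs' q hq).1
    have hc2 := γ.continuousOn_prod_inv_sub fun q hq => (hs q hq).1
    have key : ∀ u ∈ γ.trace, p.eval u * ((a ::ₘ s).map fun q => (u - q)⁻¹).prod =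
        r.eval u * (s.map fun q => (u - q)⁻¹).prod +
          p.eval a * ((a ::ₘ s).map fun q => (u - q)⁻¹).prod := by
      intro u hu
      have hua : u - a ≠ 0 := fun h =>
        (hs a (Multiset.mem_cons_self a s)).1 (sub_eq_zero.1 h ▸ hu)
      rw [hpe u, Multiset.map_cons, Multiset.prod_cons]
      field_simp
    rw [γ.integral_congr key, γ.integral_add (r.continuous.continuousOn.fun_mul hc1)
      (continuousOn_const.fun_mul hc2), integral_const_mul, ih r hs',
      γ.integral_prod_inv s.card _ (by simp) hs]
    simp

/-- With g = P / Q, the polynomial P - g(p) Q vanishes at p, so (g(u) - g(p)) / (u - p) is again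
regular and integrates to zero. What remains is g(p) times the winding number. -/
theorem Regular.integral_div_sub {γ : Contour} {g : ℂ → ℂ} (hg : γ.Regular g) {p : ℂ}
    (hp : γ.Encloses p) :
    γ.integral (fun u => g u * (u - p)⁻¹) = 2 * Real.pi * Complex.I * g p := by
  obtain ⟨P, s, hs, hg'⟩ := hg
  have hps : ∀ q ∈ s, p - q ≠ 0 := fun q hq h => by
    have h1 := (hs q hq).2
    rw [← sub_eq_zero.1 h, hp.2] at h1
    exact one_ne_zero h1
  set Q : Polynomial ℂ := (s.map fun q => Polynomial.X - Polynomial.C q).prod with hQ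
  have hQe : ∀ u, Q.eval u = (s.map fun q => u - q).prod := fun u => by
    rw [hQ, Polynomial.eval_multiset_prod, Multiset.map_map]
    simp
  have hinv : ∀ u, (s.map fun q => (u - q)⁻¹).prod = (Q.eval u)⁻¹ := fun u => by
    rw [hQe, Multiset.prod_map_inv]
  have hQp : Q.eval p ≠ 0 := by
    rw [hQe]
    refine Multiset.prod_ne_zero fun h => ?_
    obtain ⟨q, hq, h0⟩ := Multiset.mem_map.1 h
    exact hps q hq h0
  have hroot : (P - Polynomial.C (g p) * Q).IsRoot p := by
    rw [Polynomial.IsRoot.def, hg' p, hinv]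
    simp only [Polynomial.eval_sub, Polynomial.eval_mul, Polynomial.eval_C]
    field_simp
    ring
  obtain ⟨R, hR⟩ := Polynomial.dvd_iff_isRoot.2 hroot
  have hreg : γ.Regular fun u => R.eval u * (s.map fun q => (u - q)⁻¹).prod :=
    ⟨R, s, hs, fun _ => rfl⟩
  have key : ∀ u ∈ γ.trace, g u * (u - p)⁻¹ =
      R.eval u * (s.map fun q => (u - q)⁻¹).prod + g p * (u - p)⁻¹ := by
    intro u hu
    have hup : u - p ≠ 0 := fun h => hp.1 (sub_eq_zero.1 h ▸ hu)
    have hQu : Q.eval u ≠ 0 := by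
      rw [hQe]
      refine Multiset.prod_ne_zero fun h => ?_
      obtain ⟨q, hq, h0⟩ := Multiset.mem_map.1 h
      exact (hs q hq).1 (sub_eq_zero.1 h0 ▸ hu)
    have := congrArg (Polynomial.eval u) hR
    simp only [Polynomial.eval_sub, Polynomial.eval_mul, Polynomial.eval_X,
      Polynomial.eval_C] at this
    rw [hg' u, hinv]
    field_simp
    linear_combination this
  have hw := hp.2
  rw [winding_eq_integral] at hw
  rw [γ.integral_congr key, γ.integral_add hreg.continuousOn
    (continuousOn_const.fun_mul (γ.continuousOn_inv_sub hp.1)), hreg.integral_eq_zero,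
    integral_const_mul]
  have h2 : (2 * Real.pi * Complex.I : ℂ) ≠ 0 := by simp [Real.pi_ne_zero]
  rw [inv_mul_eq_one₀ h2] at hw
  rw [← hw]
  ring

/-- The residue theorem for a rational function whose poles inside of the contour are simple. -/
theorem Regular.integral_div_prod {γ : Contour} {g : ℂ → ℂ} (hg : γ.Regular g) {N : ℕ}
    {p : Fin N → ℂ} (hinj : Function.Injective p) (hp : ∀ i, γ.Encloses (p i)) :
    γ.integral (fun u => g u * ∏ i, (u - p i)⁻¹) =
      2 * Real.pi * Complex.I *
        ∑ j, g (p j) * ∏ i ∈ Finset.univ.erase j, (p j - p i)⁻¹ := by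
  rcases Nat.eq_zero_or_pos N with rfl | hN
  · simpa using hg.integral_eq_zero
  -- Partial fractions of ∏ (u - p_i)⁻¹, read off from Lagrange interpolation of the constant 1;
  -- this is where N > 0 is needed.
  have key : ∀ u ∈ γ.trace, g u * ∏ i, (u - p i)⁻¹ =
      ∑ j, (∏ i ∈ Finset.univ.erase j, (p j - p i)⁻¹) * (g u * (u - p j)⁻¹) := by
    intro u hu
    have hne : ∀ i ∈ Finset.univ, u ≠ p i := fun i _ h => (hp i).1 (h ▸ hu)
    have h1 := Lagrange.eval_interpolate_not_at_node (fun _ => (1 : ℂ)) hne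
    have h2 : Lagrange.interpolate Finset.univ p (fun _ => (1 : ℂ)) = 1 :=
      Lagrange.interpolate_one (hinj.injOn) ⟨⟨0, hN⟩, Finset.mem_univ _⟩
    rw [h2, Polynomial.eval_one, Lagrange.eval_nodal] at h1
    have h3 : (∏ i, (u - p i)⁻¹) = ∑ j, Lagrange.nodalWeight Finset.univ p j * (u - p j)⁻¹ := by
      simp only [mul_one] at h1
      rw [Finset.prod_inv_distrib]
      exact (eq_inv_of_mul_eq_one_right h1.symm).symm
    rw [h3, Finset.mul_sum]
    refine Finset.sum_congr rfl fun j _ => ?_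
    rw [Lagrange.nodalWeight]
    ring
  rw [γ.integral_congr key, γ.integral_sum _ fun j _ => continuousOn_const.fun_mul
    (hg.continuousOn.fun_mul (γ.continuousOn_inv_sub (hp j).1)), Finset.mul_sum]
  refine Finset.sum_congr rfl fun j _ => ?_
  rw [integral_const_mul, hg.integral_div_sub (hp j)]
  ring

end Contour

end JacobiProduct


/-! ### Multiple contour integrals and Fubini's theorem. -/

namespace JacobiProduct

open MeasureTheory

section MultiContour

theorem integrableOn_multiContour {m : ℕ} (U : Fin m → Contour) {F : (Fin m → ℂ) → ℂ}
    (hF : ContinuousOn F (Set.univ.pi fun i => (U i).trace)) :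
    IntegrableOn (fun t : Fin m → ℝ =>
      F (fun i => (U i).toFun (t i)) * ∏ i, deriv (U i).toFun (t i)) (Set.Icc 0 1) := by
  have hpi : Set.Icc (0 : Fin m → ℝ) 1 = Set.univ.pi fun _ => Set.Icc (0 : ℝ) 1 :=
    (Set.pi_univ_Icc _ _).symm
  refine IntegrableOn.continuousOn_mul (hF.comp ?_ ?_) ?_ isCompact_Icc
  · refine continuousOn_pi.2 fun i => (U i).continuousOn.comp (continuous_apply i).continuousOn ?_
    exact fun t ht => ⟨ht.1 i, ht.2 i⟩
  · exact fun t ht i _ => (U i).mem_trace ⟨ht.1 i, ht.2 i⟩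
  · rw [IntegrableOn, hpi, volume_pi, Measure.restrict_pi_pi]
    exact Integrable.fintype_prod (f := fun i => deriv (U i).toFun)
      fun i => (U i).integrableOn_deriv

theorem multiContourIntegral_congr {m : ℕ} (U : Fin m → Contour) {F G : (Fin m → ℂ) → ℂ}
    (h : ∀ u ∈ Set.univ.pi fun i => (U i).trace, F u = G u) :
    multiContourIntegral U F = multiContourIntegral U G := by
  refine setIntegral_congr_fun measurableSet_Icc fun t ht => ?_
  rw [h _ fun i _ => (U i).mem_trace ⟨ht.1 i, ht.2 i⟩]

theorem multiContourIntegral_sum {m : ℕ} (U : Fin m → Contour) {ι : Type*} (s : Finset ι)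
    (a : ι → ℂ) {F : ι → (Fin m → ℂ) → ℂ}
    (hF : ∀ k ∈ s, ContinuousOn (F k) (Set.univ.pi fun i => (U i).trace)) :
    multiContourIntegral U (fun u => ∑ k ∈ s, a k * F k u) =
      ∑ k ∈ s, a k * multiContourIntegral U (F k) := by
  simp only [multiContourIntegral, Finset.sum_mul, mul_assoc]
  rw [integral_finsetSum _ fun k hk => (integrableOn_multiContour U (hF k hk)).const_mul _]
  exact Finset.sum_congr rfl fun k _ => integral_const_mul _ _

theorem multiContourIntegral_succ {m : ℕ} (U : Fin (m + 1) → Contour)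
    {F : (Fin (m + 1) → ℂ) → ℂ} (hF : ContinuousOn F (Set.univ.pi fun i => (U i).trace)) :
    multiContourIntegral U F = multiContourIntegral (fun i => U i.succ)
      (fun u => (U 0).integral fun z => F (Fin.cons z u)) := by
  set G : (Fin (m + 1) → ℝ) → ℂ := fun t =>
    F (fun i => (U i).toFun (t i)) * ∏ i, deriv (U i).toFun (t i) with hG
  have hmp := (volume_preserving_piFinSuccAbove (fun _ : Fin (m + 1) => ℝ) 0).symm
  set e := (MeasurableEquiv.piFinSuccAbove (fun _ : Fin (m + 1) => ℝ) 0).symm with he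
  have happ : ∀ p : ℝ × (Fin m → ℝ), e p = Fin.cons p.1 p.2 := fun p => by
    simp [he, MeasurableEquiv.piFinSuccAbove, Fin.insertNthEquiv]
  have hpre : e ⁻¹' Set.Icc 0 1 = Set.Icc (0 : ℝ) 1 ×ˢ Set.Icc (0 : Fin m → ℝ) 1 := by
    ext p
    simp only [Set.mem_preimage, happ, Set.mem_prod, Set.mem_Icc, Pi.le_def,
      Fin.forall_fin_succ, Fin.cons_zero, Fin.cons_succ, Pi.zero_apply, Pi.one_apply]
    tauto
  have hint : IntegrableOn (G ∘ e) (Set.Icc (0 : ℝ) 1 ×ˢ Set.Icc (0 : Fin m → ℝ) 1)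
      (volume.prod volume) := by
    rw [← hpre]
    exact (hmp.integrableOn_comp_preimage e.measurableEmbedding).2
      (integrableOn_multiContour U hF)
  have h1 : multiContourIntegral U F =
      ∫ p in Set.Icc (0 : ℝ) 1 ×ˢ Set.Icc (0 : Fin m → ℝ) 1, G (e p) ∂(volume.prod volume) := by
    rw [← hpre]
    exact (hmp.setIntegral_preimage_emb e.measurableEmbedding G _).symm
  -- The order is exchanged so that the variable of index 0, on the innermost contour, is integrated
  -- first.
  rw [h1, ← Measure.prod_restrict, integral_prod_symm]
  · refine integral_congr_ae (Filter.Eventually.of_forall fun t => ?_)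
    simp only [Contour.integral]
    rw [intervalIntegral.integral_of_le zero_le_one, ← integral_Icc_eq_integral_Ioc,
      ← integral_mul_const]
    refine integral_congr_ae (Filter.Eventually.of_forall fun s => ?_)
    simp only [hG, happ, Fin.prod_univ_succ, Fin.cons_zero, Fin.cons_succ]
    have : (fun i => (U i).toFun ((Fin.cons s t : Fin (m + 1) → ℝ) i)) =
        Fin.cons ((U 0).toFun s) fun i => (U i.succ).toFun (t i) := by
      funext i
      refine Fin.cases ?_ (fun i => ?_) i <;> simp
    rw [this]
    ring
  · rw [Measure.prod_restrict]
    exact hint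

end MultiContour

/-! ### Iterated residues of the integrand. -/

section Residues

/-- The Vandermonde product `∏_{i < j} (x_j - x_i)`. -/
def vander {R : Type*} [CommRing R] {N : ℕ} (x : Fin N → R) : R :=
  ∏ i, ∏ j ∈ Finset.Ioi i, (x j - x i)

theorem vander_comp_perm {R : Type*} [CommRing R] {N : ℕ} (x : Fin N → R)
    (σ : Equiv.Perm (Fin N)) : vander (x ∘ σ) = Equiv.Perm.sign σ * vander x := by
  rw [vander, vander, ← Matrix.det_vandermonde, ← Matrix.det_vandermonde, ← Matrix.det_permute]
  rfl

theorem vander_ne_zero {R : Type*} [CommRing R] [IsDomain R] {N : ℕ} {x : Fin N → R} :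
    vander x ≠ 0 ↔ Function.Injective x := by
  rw [vander, ← Matrix.det_vandermonde, Matrix.det_vandermonde_ne_zero_iff]

/-- Only the pairs containing j change, each by the factor ρ_l whichever of the two indices is
larger. This is the quotient of Vandermonde products that the residue at -c - x_j produces. -/
theorem vander_add_single {K : Type*} [Field K] {N : ℕ} {x : Fin N → K}
    (hx : Function.Injective x) (j : Fin N) (c : K) :
    vander (x + Pi.single j c) =
      vander x * ∏ l ∈ Finset.univ.erase j, ((x l - x j - c) * (x l - x j)⁻¹) := by
  set ρ : Fin N → K := fun l => (x l - x j - c) * (x l - x j)⁻¹ with hρ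
  have hne : ∀ i k, i ≠ k → x i - x k ≠ 0 := fun i k h => sub_ne_zero.2 (hx.ne h)
  have key : ∀ i, ∏ k ∈ Finset.Ioi i, ((x + Pi.single j c : Fin N → K) k -
      (x + Pi.single j c : Fin N → K) i) = (∏ k ∈ Finset.Ioi i, (x k - x i)) *
        ((if i = j then ∏ k ∈ Finset.Ioi j, ρ k else 1) * (if i < j then ρ i else 1)) := by
    intro i
    rcases lt_trichotomy i j with h | rfl | h
    · rw [if_neg h.ne, if_pos h, one_mul,
        ← Finset.mul_prod_erase _ _ (Finset.mem_Ioi.2 h),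
        ← Finset.mul_prod_erase (a := j) _ (fun k => x k - x i) (Finset.mem_Ioi.2 h)]
      have h1 : ∏ k ∈ (Finset.Ioi i).erase j, ((x + Pi.single j c : Fin N → K) k -
          (x + Pi.single j c : Fin N → K) i) = ∏ k ∈ (Finset.Ioi i).erase j, (x k - x i) := by
        refine Finset.prod_congr rfl fun k hk => ?_
        simp [Pi.single_eq_of_ne (Finset.ne_of_mem_erase hk), Pi.single_eq_of_ne h.ne]
      rw [h1]
      have := hne _ _ h.ne
      have := hne _ _ h.ne'
      simp only [Pi.add_apply, Pi.single_eq_same, Pi.single_eq_of_ne h.ne, hρ]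
      field_simp
      ring
    · rw [if_pos rfl, if_neg (lt_irrefl _), mul_one, ← Finset.prod_mul_distrib]
      refine Finset.prod_congr rfl fun k hk => ?_
      have hk' := (Finset.mem_Ioi.1 hk).ne'
      have := hne _ _ hk'
      simp only [Pi.add_apply, Pi.single_eq_same, Pi.single_eq_of_ne hk', hρ]
      field_simp
      ring
    · rw [if_neg h.ne', if_neg h.not_gt, mul_one, mul_one]
      refine Finset.prod_congr rfl fun k hk => ?_
      simp [Pi.single_eq_of_ne (h.trans (Finset.mem_Ioi.1 hk)).ne', Pi.single_eq_of_ne h.ne']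
  rw [vander, Finset.prod_congr rfl fun i _ => key i, Finset.prod_mul_distrib,
    Finset.prod_mul_distrib, Finset.prod_ite_eq' Finset.univ j, if_pos (Finset.mem_univ _), vander,
    ← Finset.prod_filter]
  congr 1
  rw [mul_comm, ← Finset.prod_union]
  · refine Finset.prod_congr ?_ fun _ _ => rfl
    ext k
    simp [lt_or_lt_iff_ne]
  · refine Finset.disjoint_left.2 fun k hk hk' => ?_
    exact (Finset.mem_filter.1 hk).2.not_gt (Finset.mem_Ioi.1 hk')

/-- The sum of residues `∑_{j_1, …, j_m} Δ(x^{(m)}) ∏_i g_i(-c_i - x^{(i-1)}_{j_i})`, where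
`x^{(i)} = x^{(i-1)} + c_i e_{j_i}` and `x^{(0)} = x`. -/
noncomputable def residueSum {N : ℕ} : (m : ℕ) → (Fin m → ℂ) → (Fin m → ℂ → ℂ) →
    (Fin N → ℂ) → ℂ
  | 0, _, _, x => vander x
  | m + 1, c, g, x => ∑ j, g 0 (-c 0 - x j) *
      residueSum m (fun i => c i.succ) (fun i => g i.succ) (x + Pi.single j (c 0))

theorem residueSum_comp_perm {N m : ℕ} (c : Fin m → ℂ) (g : Fin m → ℂ → ℂ) (x : Fin N → ℂ)
    (σ : Equiv.Perm (Fin N)) :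
    residueSum m c g (x ∘ σ) = Equiv.Perm.sign σ * residueSum m c g x := by
  induction m generalizing x with
  | zero =>
    simp only [residueSum, vander_comp_perm]
  | succ m ih =>
    simp only [residueSum]
    rw [Finset.mul_sum]
    refine Eq.trans ?_ (Equiv.sum_comp σ _)
    refine Finset.sum_congr rfl fun j _ => ?_
    have : x ∘ σ + Pi.single j (c 0) = (x + Pi.single (σ j) (c 0)) ∘ σ := by
      funext k
      simp [Pi.single_apply]
    rw [this, ih, Function.comp_apply]
    ring

/-- Antisymmetry under the transposition of two equal coordinates. It covers the configurations x +
c e_j with coincidences, for which the poles are no longer simple. -/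
theorem residueSum_eq_zero {N m : ℕ} (c : Fin m → ℂ) (g : Fin m → ℂ → ℂ) {x : Fin N → ℂ}
    (hx : ¬ Function.Injective x) : residueSum m c g x = 0 := by
  rw [Function.Injective] at hx
  push Not at hx
  obtain ⟨i, j, hij, hne⟩ := hx
  have h1 : x ∘ Equiv.swap i j = x := by
    funext k
    simp only [Function.comp_apply, Equiv.swap_apply_def]
    split_ifs with h h
    · rw [h, hij]
    · rw [h, hij]
    · rfl
  have h2 := residueSum_comp_perm c g x (Equiv.swap i j)
  rw [h1, Equiv.Perm.sign_swap hne] at h2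
  push_cast at h2
  linear_combination h2 / 2

/-- The factor of the integrand which couples two of the integration variables. -/
noncomputable def crossFactor (u c u' c' : ℂ) : ℂ :=
  ((u' - u) * (u' + c' - u - c)) / ((u' - u - c) * (u' + c' - u))

/-- The integrand `∏_{i<j} crossFactor · ∏_i (∏_l (u_i + x_l) / (u_i + c_i + x_l)) g_i(u_i)`. -/
noncomputable def residueIntegrand {N m : ℕ} (c : Fin m → ℂ) (g : Fin m → ℂ → ℂ) (x : Fin N → ℂ)
    (u : Fin m → ℂ) : ℂ :=
  (∏ i, ∏ j ∈ Finset.Ioi i, crossFactor (u i) (c i) (u j) (c j)) *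
    ∏ i, ((∏ l, (u i + x l) / (u i + c i + x l)) * g i (u i))

theorem residueIntegrand_cons {N m : ℕ} (c : Fin (m + 1) → ℂ) (g : Fin (m + 1) → ℂ → ℂ)
    (x : Fin N → ℂ) (z : ℂ) (u : Fin m → ℂ) :
    residueIntegrand c g x (Fin.cons z u) =
      (∏ k, crossFactor z (c 0) (u k) (c k.succ)) * ((∏ l, (z + x l) / (z + c 0 + x l)) * g 0 z) *
        residueIntegrand (fun i => c i.succ) (fun i => g i.succ) x u := by
  simp only [residueIntegrand, Fin.prod_univ_succ, Fin.prod_Ioi_zero, Fin.prod_Ioi_succ,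
    Fin.cons_zero, Fin.cons_succ]
  ring

/-- The configuration of contours for which the multiple contour integral is a sum of residues. -/
structure Nested {N m : ℕ} (U : Fin m → Contour) (c : Fin m → ℂ) (g : Fin m → ℂ → ℂ)
    (x : Fin N → ℂ) : Prop where
  encloses : ∀ i l, (U i).Encloses (-c i - x l)
  regular : ∀ i, (U i).Regular (g i)
  nested_sub : ∀ i j, i < j → (U i).EnclosedBy ((U j).translate (-c i))
  nested_add : ∀ i j, i < j → (U i).EnclosedBy ((U j).translate (c j))

namespace Nested

variable {N m : ℕ}

theorem continuousOn {U : Fin m → Contour} {c : Fin m → ℂ} {g : Fin m → ℂ → ℂ} {x : Fin N → ℂ}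
    (h : Nested U c g x) :
    ContinuousOn (residueIntegrand c g x) (Set.univ.pi fun i => (U i).trace) := by
  have hproj : ∀ i, ContinuousOn (fun u : Fin m → ℂ => u i)
      (Set.univ.pi fun i => (U i).trace) := fun i => (continuous_apply i).continuousOn
  refine ContinuousOn.mul (continuousOn_finsetProd _ fun i _ => continuousOn_finsetProd _
    fun j hj => ?_) (continuousOn_finsetProd _ fun i _ => ContinuousOn.mul
      (continuousOn_finsetProd _ fun l _ => ?_) ?_)
  · refine ContinuousOn.div (by fun_prop) (by fun_prop) fun u hu => mul_ne_zero ?_ ?_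
    · intro h0
      refine (h.nested_sub i j (Finset.mem_Ioi.1 hj) (u i) (hu i trivial)).1 ?_
      rw [Contour.mem_trace_translate]
      convert hu j trivial using 1
      linear_combination -h0
    · intro h0
      refine (h.nested_add i j (Finset.mem_Ioi.1 hj) (u i) (hu i trivial)).1 ?_
      rw [Contour.mem_trace_translate]
      convert hu j trivial using 1
      linear_combination -h0
  · refine ContinuousOn.div (by fun_prop) (by fun_prop) fun u hu h0 => ?_
    refine (h.encloses i l).1 ?_
    convert hu i trivial using 1
    linear_combination -h0
  · exact (h.regular i).continuousOn.comp (hproj i) fun u hu => hu i trivial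

section Step

variable {U : Fin (m + 1) → Contour} {c : Fin (m + 1) → ℂ} {g : Fin (m + 1) → ℂ → ℂ}
  {x : Fin N → ℂ}

theorem excludes_sub (h : Nested U c g x) {k : Fin m} {b : ℂ} (hb : b ∈ (U k.succ).trace) :
    (U 0).Excludes (b - c 0) := by
  refine (h.nested_sub 0 k.succ (Fin.succ_pos k)).excludes ?_
  rw [Contour.mem_trace_translate]
  simpa using hb

theorem excludes_add (h : Nested U c g x) {k : Fin m} {b : ℂ} (hb : b ∈ (U k.succ).trace) :
    (U 0).Excludes (b + c k.succ) := by
  refine (h.nested_add 0 k.succ (Fin.succ_pos k)).excludes ?_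
  rw [Contour.mem_trace_translate]
  simpa using hb

/-- The new pole -c_i - c_0 - x_j is enclosed by U_i because U_0 encloses -c_0 - x_j and is itself
enclosed by U_i + c_i. The other poles are unchanged. -/
theorem tail (h : Nested U c g x) (j : Fin N) :
    Nested (fun i => U i.succ) (fun i => c i.succ) (fun i => g i.succ)
      (x + Pi.single j (c 0)) where
  encloses i l := by
    rcases eq_or_ne l j with rfl | hl
    · have := (h.nested_add 0 i.succ (Fin.succ_pos i)).encloses (h.encloses 0 l)
      rw [Contour.encloses_translate] at this
      convert this using 1
      simp
      ring
    · simpa [Pi.single_eq_of_ne hl] using h.encloses i.succ l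
  regular i := h.regular i.succ
  nested_sub i j hij := h.nested_sub i.succ j.succ (Fin.succ_lt_succ_iff.2 hij)
  nested_add i j hij := h.nested_add i.succ j.succ (Fin.succ_lt_succ_iff.2 hij)

/-- At z = -c_0 - x_j the cross factor with u_k is exactly the change of (u_k + x_j) / (u_k + c_k +
x_j) when x_j moves to x_j + c_0. The residue is therefore an integrand of the same shape. -/
theorem crossFactor_mul_residueIntegrand (h : Nested U c g x) (j : Fin N) {u : Fin m → ℂ}
    (hu : ∀ k, u k ∈ (U k.succ).trace) :
    (∏ k, crossFactor (-c 0 - x j) (c 0) (u k) (c k.succ)) *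
        residueIntegrand (fun i => c i.succ) (fun i => g i.succ) x u =
      residueIntegrand (fun i => c i.succ) (fun i => g i.succ) (x + Pi.single j (c 0)) u := by
  simp only [residueIntegrand]
  rw [mul_left_comm, ← Finset.prod_mul_distrib]
  congr 1
  refine Finset.prod_congr rfl fun k _ => ?_
  rw [← mul_assoc]
  congr 1
  set y : Fin N → ℂ := x + Pi.single j (c 0) with hy
  rw [← Finset.mul_prod_erase _ _ (Finset.mem_univ j),
    ← Finset.mul_prod_erase (a := j) _ (fun l => (u k + y l) / (u k + c k.succ + y l))
      (Finset.mem_univ j)]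
  have h1 : ∏ l ∈ Finset.univ.erase j, (u k + y l) / (u k + c k.succ + y l) =
      ∏ l ∈ Finset.univ.erase j, (u k + x l) / (u k + c k.succ + x l) := by
    refine Finset.prod_congr rfl fun l hl => ?_
    simp [hy, Pi.single_eq_of_ne (Finset.ne_of_mem_erase hl)]
  rw [h1, ← mul_assoc]
  congr 1
  -- The cancelled quantities vanish only if u_k - c_0 or u_k + c_k is the enclosed pole -c_0 - x_j,
  -- which the nesting excludes, or if u_k is an enclosed pole of its own contour.
  have hA : u k + x j ≠ 0 := by
    intro h0
    have := (h.excludes_sub (hu k)).2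
    rw [show u k - c 0 = -c 0 - x j by linear_combination h0, (h.encloses 0 j).2] at this
    exact one_ne_zero this
  have hB : u k + c k.succ + x j ≠ 0 := by
    intro h0
    refine (h.encloses k.succ j).1 ?_
    convert hu k using 1
    linear_combination -h0
  have hC : u k + c k.succ + x j + c 0 ≠ 0 := by
    intro h0
    have := (h.excludes_add (hu k)).2
    rw [show u k + c k.succ = -c 0 - x j by linear_combination h0, (h.encloses 0 j).2] at this
    exact one_ne_zero this
  simp only [crossFactor, hy, Pi.add_apply, Pi.single_eq_same]
  rw [show u k - (-c 0 - x j) - c 0 = u k + x j by ring,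
    show u k + c k.succ - (-c 0 - x j) = u k + c k.succ + x j + c 0 by ring,
    show u k - (-c 0 - x j) = u k + x j + c 0 by ring,
    show u k + c k.succ + x j + c 0 - c 0 = u k + c k.succ + x j by ring,
    show u k + (x j + c 0) = u k + x j + c 0 by ring,
    show u k + c k.succ + (x j + c 0) = u k + c k.succ + x j + c 0 by ring]
  field_simp

/-- Integrating out the variable on the innermost contour. -/
theorem integral_cons (h : Nested U c g x) (hx : Function.Injective x) {u : Fin m → ℂ}
    (hu : ∀ k, u k ∈ (U k.succ).trace) :
    (U 0).integral (fun z => residueIntegrand c g x (Fin.cons z u)) =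
      ∑ j, (2 * Real.pi * Complex.I * -c 0 *
        (g 0 (-c 0 - x j) *
          ∏ l ∈ Finset.univ.erase j, ((x l - x j - c 0) * (x l - x j)⁻¹))) *
        residueIntegrand (fun i => c i.succ) (fun i => g i.succ) (x + Pi.single j (c 0)) u := by
  -- K is the integrand without the enclosed poles. It is regular because its remaining poles in z,
  -- namely u_k - c_0, u_k + c_k and those of g_0, lie outside of U_0.
  set K : ℂ → ℂ := fun z => (∏ k, crossFactor z (c 0) (u k) (c k.succ)) *
    ((∏ l, (z + x l)) * g 0 z) *
      residueIntegrand (fun i => c i.succ) (fun i => g i.succ) x u with hK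
  have hreg : (U 0).Regular K := by
    refine (Contour.Regular.mul (Contour.Regular.prod _ fun k _ => ?_)
      ((Contour.Regular.prod _ fun l _ => Contour.Regular.add_const _ _).mul
        (h.regular 0))).mul (Contour.Regular.const _ _)
    have h1 := ((((Contour.Regular.add_const (U 0) (-u k)).mul
      (Contour.Regular.add_const (U 0) (c 0 - u k - c k.succ))).mul
      (Contour.Regular.inv_sub (h.excludes_sub (hu k)))).mul
      (Contour.Regular.inv_sub (h.excludes_add (hu k))))
    convert h1 using 2 with z
    rw [crossFactor, show (u k - z - c 0) * (u k + c k.succ - z) =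
      (z - (u k - c 0)) * (z - (u k + c k.succ)) by ring, div_eq_mul_inv, mul_inv]
    ring
  have hinj : Function.Injective fun l => -c 0 - x l := fun a b hab => hx (by simpa using hab)
  have key := hreg.integral_div_prod hinj (h.encloses 0)
  rw [(U 0).integral_congr (g := fun z => K z * ∏ i, (z - (-c 0 - x i))⁻¹), key, Finset.mul_sum]
  · refine Finset.sum_congr rfl fun j _ => ?_
    rw [← h.crossFactor_mul_residueIntegrand j hu, hK]
    simp only
    rw [← Finset.mul_prod_erase _ _ (Finset.mem_univ j), Finset.prod_mul_distrib,
      Finset.prod_congr rfl fun l _ => show (-c 0 - x j + x l) = x l - x j - c 0 by ring,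
      Finset.prod_congr rfl fun l _ =>
        show (-c 0 - x j - (-c 0 - x l))⁻¹ = (x l - x j)⁻¹ by congr 1; ring]
    ring
  · intro z _
    rw [residueIntegrand_cons, hK]
    simp only
    rw [Finset.prod_congr rfl fun l _ =>
      show (z + x l) / (z + c 0 + x l) = (z + x l) * (z - (-c 0 - x l))⁻¹ by
        rw [div_eq_mul_inv]; congr 2; ring, Finset.prod_mul_distrib]
    ring

end Step

/-- The multiple contour integral as a sum of residues. -/
theorem vander_mul_multiContourIntegral {m : ℕ} : ∀ {U : Fin m → Contour} {c : Fin m → ℂ}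
    {g : Fin m → ℂ → ℂ} {x : Fin N → ℂ}, Nested U c g x →
    vander x * multiContourIntegral U (residueIntegrand c g x) =
      (2 * Real.pi * Complex.I) ^ m * (∏ i, -c i) * residueSum m c g x := by
  induction m with
  | zero =>
    intro U c g x _
    have : (volume : Measure (Fin 0 → ℝ)).real (Set.Icc 0 1) = 1 := by
      rw [Measure.real, Real.volume_Icc_pi]
      simp
    simp [multiContourIntegral, residueIntegrand, residueSum, this, -Matrix.zero_empty]
  | succ m ih =>
    intro U c g x h
    -- The factor Δ(x) lets the induction pass through coincident coordinates, where both sides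
    -- vanish; no genericity of the c_i is needed.
    by_cases hx : Function.Injective x
    · rw [multiContourIntegral_succ U h.continuousOn,
        multiContourIntegral_congr _ fun u hu => h.integral_cons hx fun k => hu k trivial,
        multiContourIntegral_sum _ _ _ fun j _ => (h.tail j).continuousOn, residueSum,
        Finset.mul_sum, Finset.mul_sum]
      refine Finset.sum_congr rfl fun j _ => ?_
      have := ih (h.tail j)
      rw [vander_add_single hx] at this
      rw [Fin.prod_univ_succ, pow_succ]
      linear_combination (2 * Real.pi * Complex.I * -c 0 * g 0 (-c 0 - x j)) * this
    · rw [residueSum_eq_zero c g hx, mul_zero]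
      have : vander x = 0 := by
        by_contra h0
        exact hx (vander_ne_zero.1 h0)
      rw [this, zero_mul]

end Nested

end Residues

end JacobiProduct


/-! ### Blaschke factors and a Carlson theorem for polynomial growth. -/

namespace JacobiProduct

open MeasureTheory

section Carlson

/-- Dividing a bounded holomorphic function on the unit disc by the Blaschke factor of a zero. -/
theorem exists_blaschke_quotient {h : ℂ → ℂ} {C : ℝ} (hd : DifferentiableOn ℂ h (Metric.ball 0 1))
    (hC : ∀ w ∈ Metric.ball (0 : ℂ) 1, ‖h w‖ ≤ C) {a : ℝ} (ha0 : 0 ≤ a) (ha1 : a < 1)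
    (ha : h a = 0) :
    ∃ k : ℂ → ℂ, DifferentiableOn ℂ k (Metric.ball 0 1) ∧
      (∀ w ∈ Metric.ball (0 : ℂ) 1, ‖k w‖ ≤ C) ∧ ∀ w, h w * (1 - a * w) = k w * (w - a) := by
  have hC0 : 0 ≤ C := (norm_nonneg _).trans (hC 0 (by simp))
  have hab : (a : ℂ) ∈ Metric.ball (0 : ℂ) 1 := by simp [abs_of_nonneg ha0, ha1]
  set k : ℂ → ℂ := fun w => dslope h a w * (1 - a * w) with hk
  have hmul : ∀ w, h w * (1 - a * w) = k w * (w - a) := fun w => by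
    have := sub_smul_dslope h (a : ℂ) w
    rw [ha, sub_zero, smul_eq_mul] at this
    rw [← this, hk]
    ring
  have hkd : DifferentiableOn ℂ k (Metric.ball 0 1) :=
    ((Complex.differentiableOn_dslope (Metric.isOpen_ball.mem_nhds hab)).2 hd).mul (by fun_prop)
  refine ⟨k, hkd, fun w hw => ?_, hmul⟩
  have hw1 : ‖w‖ < 1 := by simpa using hw
  -- On |z| = r one has |1 - az|² = |z - a|² + (1 - a²)(1 - r²), so the Blaschke factor is nearly
  -- unimodular. The maximum principle gives a bound that tends to C as r → 1.
  have hbound : ∀ r : ℝ, max ‖w‖ a < r → r < 1 →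
      ‖k w‖ ≤ Real.sqrt (C ^ 2 * (1 + (1 - r ^ 2) / (r - a) ^ 2)) := by
    intro r hr hr1
    have hwr : ‖w‖ < r := (le_max_left _ _).trans_lt hr
    have har : a < r := (le_max_right _ _).trans_lt hr
    have hr0 : 0 < r := (norm_nonneg w).trans_lt hwr
    have hsub : Metric.closedBall (0 : ℂ) r ⊆ Metric.ball 0 1 := fun z hz => by
      simp only [Metric.mem_closedBall, dist_zero_right, Metric.mem_ball] at hz ⊢
      exact hz.trans_lt hr1
    have hcl : DiffContOnCl ℂ k (Metric.ball 0 r) := by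
      refine (hkd.mono ?_).diffContOnCl
      rwa [closure_ball _ hr0.ne']
    refine Complex.norm_le_of_forall_mem_frontier_norm_le Metric.isBounded_ball hcl ?_
      (subset_closure (by simpa using hwr))
    intro z hz
    rw [frontier_ball _ hr0.ne', mem_sphere_zero_iff_norm] at hz
    have hz1 : ‖h z‖ ≤ C := hC z (hsub (by simp [hz]))
    have hza : r - a ≤ ‖z - a‖ := by
      have := norm_sub_norm_le z (a : ℂ)
      rwa [hz, Complex.norm_real, Real.norm_of_nonneg ha0] at this
    have hra : 0 < r - a := sub_pos.2 har
    have hpos : 0 < ‖z - a‖ := hra.trans_le hza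
    have hid : ‖1 - a * z‖ ^ 2 = ‖z - a‖ ^ 2 + (1 - a ^ 2) * (1 - r ^ 2) := by
      have h1 := Complex.sq_norm z
      rw [hz, Complex.normSq_apply] at h1
      rw [Complex.sq_norm, Complex.sq_norm, Complex.normSq_apply, Complex.normSq_apply]
      simp only [Complex.sub_re, Complex.one_re, Complex.mul_re, Complex.ofReal_re,
        Complex.ofReal_im, Complex.sub_im, Complex.one_im, Complex.mul_im]
      linear_combination (1 - a ^ 2) * h1
    refine Real.le_sqrt_of_sq_le ?_
    have h2 : ‖h z‖ * ‖1 - a * z‖ = ‖k z‖ * ‖z - a‖ := by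
      rw [← norm_mul, hmul z, norm_mul]
    have h3 : ‖k z‖ ^ 2 * ‖z - a‖ ^ 2 = ‖h z‖ ^ 2 * (‖z - a‖ ^ 2 + (1 - a ^ 2) * (1 - r ^ 2)) := by
      rw [← hid, ← mul_pow, ← mul_pow, h2]
    have hr2 : 0 ≤ 1 - r ^ 2 := by nlinarith
    have h4 : (1 - a ^ 2) * (1 - r ^ 2) ≤ (1 - r ^ 2) / (r - a) ^ 2 * ‖z - a‖ ^ 2 := by
      have h5 : (r - a) ^ 2 ≤ ‖z - a‖ ^ 2 := by gcongr
      have h6 : 1 - r ^ 2 ≤ (1 - r ^ 2) / (r - a) ^ 2 * ‖z - a‖ ^ 2 := by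
        rw [div_mul_eq_mul_div, le_div_iff₀ (by positivity)]
        gcongr
      nlinarith [mul_nonneg (sq_nonneg a) hr2]
    have h7 : ‖h z‖ ^ 2 ≤ C ^ 2 := by gcongr
    have h8 : ‖k z‖ ^ 2 * ‖z - a‖ ^ 2 ≤
        C ^ 2 * (1 + (1 - r ^ 2) / (r - a) ^ 2) * ‖z - a‖ ^ 2 := by
      rw [h3]
      have : C ^ 2 * (1 + (1 - r ^ 2) / (r - a) ^ 2) * ‖z - a‖ ^ 2 =
        C ^ 2 * (‖z - a‖ ^ 2 + (1 - r ^ 2) / (r - a) ^ 2 * ‖z - a‖ ^ 2) := by ring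
      rw [this]
      refine mul_le_mul h7 (by linarith) ?_ (by positivity)
      rw [← hid]
      positivity
    exact le_of_mul_le_mul_right h8 (by positivity)
  have hlim : Filter.Tendsto (fun r : ℝ => Real.sqrt (C ^ 2 * (1 + (1 - r ^ 2) / (r - a) ^ 2)))
      (nhdsWithin 1 (Set.Iio 1)) (nhds C) := by
    have hc : ContinuousAt (fun r : ℝ => Real.sqrt (C ^ 2 * (1 + (1 - r ^ 2) / (r - a) ^ 2))) 1 := by
      have : (1 - a) ^ 2 ≠ 0 := pow_ne_zero _ (sub_pos.2 ha1).ne'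
      fun_prop (disch := assumption)
    have h1 := hc.tendsto
    simp only [one_pow, sub_self, zero_div, add_zero, mul_one, Real.sqrt_sq hC0] at h1
    exact h1.mono_left nhdsWithin_le_nhds
  refine ge_of_tendsto hlim ?_
  filter_upwards [Ioo_mem_nhdsLT (max_lt hw1 ha1)] with r hr using hbound r hr.1 hr.2

/-- Divide by one Blaschke factor after another. Since the zeros are distinct, the quotient still
vanishes at the next one, and the bound C never deteriorates. -/
theorem norm_mul_prod_le_of_zeros {h : ℂ → ℂ} {C : ℝ}
    (hd : DifferentiableOn ℂ h (Metric.ball 0 1))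
    (hC : ∀ w ∈ Metric.ball (0 : ℂ) 1, ‖h w‖ ≤ C) {a : ℕ → ℝ} (ha : Function.Injective a)
    (ha0 : ∀ n, 0 ≤ a n) (ha1 : ∀ n, a n < 1) (hz : ∀ n, h (a n) = 0) (n : ℕ) {w : ℂ}
    (hw : w ∈ Metric.ball (0 : ℂ) 1) :
    ‖h w‖ * ∏ k ∈ Finset.range n, ‖1 - a k * w‖ ≤ C * ∏ k ∈ Finset.range n, ‖w - a k‖ := by
  have key : ∃ k : ℂ → ℂ, DifferentiableOn ℂ k (Metric.ball 0 1) ∧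
      (∀ w ∈ Metric.ball (0 : ℂ) 1, ‖k w‖ ≤ C) ∧
      ∀ w, h w * ∏ i ∈ Finset.range n, (1 - a i * w) = k w * ∏ i ∈ Finset.range n, (w - a i) := by
    induction n with
    | zero => exact ⟨h, hd, hC, by simp⟩
    | succ n ih =>
      obtain ⟨k, hkd, hkC, hk⟩ := ih
      have hka : k (a n) = 0 := by
        have := hk (a n)
        rw [hz, zero_mul, eq_comm, mul_eq_zero] at this
        refine this.resolve_right (Finset.prod_ne_zero_iff.2 fun i hi => ?_)
        rw [sub_ne_zero, Ne, Complex.ofReal_inj]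
        exact ha.ne (Finset.mem_range.1 hi).ne'
      obtain ⟨l, hld, hlC, hl⟩ := exists_blaschke_quotient hkd hkC (ha0 n) (ha1 n) hka
      refine ⟨l, hld, hlC, fun w => ?_⟩
      rw [Finset.prod_range_succ, Finset.prod_range_succ]
      linear_combination (1 - a n * w) * hk w + (∏ i ∈ Finset.range n, (w - a i)) * hl w
  obtain ⟨k, -, hkC, hk⟩ := key
  have := congrArg norm (hk w)
  rw [norm_mul, norm_mul, norm_prod, norm_prod] at this
  rw [this]
  gcongr
  exact hkC w hw

theorem tendsto_prod_abs_sub_div_add {x : ℝ} (hx : 0 < x) :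
    Filter.Tendsto (fun n : ℕ => ∏ k ∈ Finset.range n, (|x - (k + 1)| / (x + (k + 1))))
      Filter.atTop (nhds 0) := by
  -- With n = k + 1, |x - n| = x + n - 2 min(x, n) and x + n ≤ (x + 1) n, so each factor is at most
  -- 1 - b / n. Divergence of the harmonic series then sends the product to 0.
  set b : ℝ := 2 * min x 1 / (x + 1) with hb
  have hb0 : 0 < b := by
    have : 0 < min x 1 := lt_min hx one_pos
    positivity
  have hle : ∀ k : ℕ, |x - (k + 1)| / (x + (k + 1)) ≤ Real.exp (-(b * (1 / ((k : ℝ) + 1)))) := by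
    intro k
    have hk : (1 : ℝ) ≤ k + 1 := by
      have : (0 : ℝ) ≤ k := Nat.cast_nonneg k
      linarith
    refine le_trans ?_ (Real.add_one_le_exp _)
    rw [div_le_iff₀ (by linarith)]
    have h1 : b * (1 / ((k : ℝ) + 1)) * (x + (k + 1)) ≤ 2 * min x 1 := by
      rw [hb, div_mul_div_comm, mul_one, div_mul_eq_mul_div, div_le_iff₀ (by positivity)]
      have h4 : 0 < min x 1 := lt_min hx one_pos
      have h5 : x + ((k : ℝ) + 1) ≤ (x + 1) * (k + 1) := by nlinarith
      gcongr
    have h2 : min x 1 ≤ x := min_le_left _ _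
    have h3 : min x 1 ≤ 1 := min_le_right _ _
    rcases abs_cases (x - (k + 1)) with h | h <;> rw [h.1] <;> linarith
  refine squeeze_zero (fun n => Finset.prod_nonneg fun k _ => by positivity)
    (fun n => Finset.prod_le_prod (fun k _ => by positivity) fun k _ => hle k) ?_
  simp only [← Real.exp_sum, Finset.sum_neg_distrib, ← Finset.mul_sum]
  exact Real.tendsto_exp_neg_atTop_nhds_zero.comp
    (Real.tendsto_sum_range_one_div_nat_succ_atTop.const_mul_atTop hb0)

/-- Holomorphic functions of polynomial growth on the right half-plane. -/
def PolyGrowth (f : ℂ → ℂ) : Prop :=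
  DifferentiableOn ℂ f {z | 0 < z.re} ∧
    ∃ (C : ℝ) (K : ℕ), ∀ z : ℂ, 0 < z.re → ‖f z‖ ≤ C * (1 + ‖z‖) ^ K

/-- A case of Carlson's theorem. -/
theorem PolyGrowth.eq_zero {f : ℂ → ℂ} (hf : PolyGrowth f) (hz : ∀ n : ℕ, 0 < n → f n = 0) {x : ℝ}
    (hx : 0 < x) : f x = 0 := by
  obtain ⟨hd, C, K, hC⟩ := hf
  have hC0 : 0 ≤ C := by
    have := (norm_nonneg _).trans (hC 1 (by simp))
    exact nonneg_of_mul_nonneg_left this (by positivity)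
  -- The Cayley map carries the disc to the right half-plane. The power of (1 - w) / 2 absorbs the
  -- growth, since (1 + |φ(w)|) |1 - w| / 2 ≤ 2.
  set φ : ℂ → ℂ := fun w => (1 + w) / (1 - w) with hφ
  set h : ℂ → ℂ := fun w => f (φ w) * ((1 - w) / 2) ^ K with hh
  have hne : ∀ w ∈ Metric.ball (0 : ℂ) 1, 1 - w ≠ 0 := fun w hw h0 => by
    rw [← sub_eq_zero.1 h0] at hw
    simp at hw
  have hre : ∀ w ∈ Metric.ball (0 : ℂ) 1, 0 < (φ w).re := fun w hw => by
    have h1 : ‖w‖ < 1 := by simpa using hw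
    have h2 : ‖w‖ ^ 2 < 1 := by nlinarith [norm_nonneg w]
    rw [Complex.sq_norm, Complex.normSq_apply] at h2
    have h3 : 0 < Complex.normSq (1 - w) := Complex.normSq_pos.2 (hne w hw)
    rw [hφ]
    simp only [Complex.div_re, Complex.add_re, Complex.one_re, Complex.sub_re, Complex.add_im,
      Complex.one_im, Complex.sub_im]
    rw [← add_div]
    refine div_pos ?_ h3
    linarith
  have hhd : DifferentiableOn ℂ h (Metric.ball 0 1) := by
    refine DifferentiableOn.mul (hd.comp ?_ fun w hw => hre w hw) (by fun_prop)
    exact DifferentiableOn.div (by fun_prop) (by fun_prop) hne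
  have hhC : ∀ w ∈ Metric.ball (0 : ℂ) 1, ‖h w‖ ≤ C * 2 ^ K := by
    intro w hw
    have hw1 : ‖w‖ < 1 := by simpa using hw
    have h0 : 0 < ‖1 - w‖ := norm_pos_iff.2 (hne w hw)
    rw [hh]
    simp only [norm_mul, norm_pow]
    calc ‖f (φ w)‖ * ‖(1 - w) / 2‖ ^ K ≤ C * (1 + ‖φ w‖) ^ K * ‖(1 - w) / 2‖ ^ K := by
          gcongr
          exact hC _ (hre w hw)
      _ = C * ((1 + ‖φ w‖) * ‖(1 - w) / 2‖) ^ K := by rw [mul_pow, mul_assoc]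
      _ ≤ C * 2 ^ K := by
          gcongr
          have h1 : (1 + ‖φ w‖) * ‖(1 - w) / 2‖ = (‖1 - w‖ + ‖1 + w‖) / 2 := by
            rw [hφ]
            simp only [norm_div, Complex.norm_ofNat]
            field_simp
          have h2 : ‖1 - w‖ ≤ 1 + ‖w‖ := by simpa using norm_sub_le 1 w
          have h3 : ‖1 + w‖ ≤ 1 + ‖w‖ := by simpa using norm_add_le 1 w
          rw [h1]
          linarith
  -- The preimage of n + 1 under φ.
  set a : ℕ → ℝ := fun n => n / (n + 2) with ha
  have hφa : ∀ y : ℝ, 0 < y → φ (((y - 1) / (y + 1) : ℝ) : ℂ) = y := by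
    intro y hy
    have h1 : (y + 1 : ℂ) ≠ 0 := by exact_mod_cast (by linarith : y + 1 ≠ 0)
    rw [hφ]
    push_cast
    rw [show (1 : ℂ) + (y - 1) / (y + 1) = 2 * y / (y + 1) by field_simp; ring,
      show (1 : ℂ) - (y - 1) / (y + 1) = 2 / (y + 1) by field_simp; ring]
    field_simp
  have hza : ∀ n, h (a n) = 0 := by
    intro n
    have h1 : a n = ((((n + 1 : ℕ) : ℝ) - 1) / (((n + 1 : ℕ) : ℝ) + 1) : ℝ) := by
      rw [ha]
      push_cast
      ring
    rw [hh]
    simp only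
    rw [h1, hφa _ (by positivity), Complex.ofReal_natCast, hz _ n.succ_pos, zero_mul]
  have hinj : Function.Injective a := by
    intro i j hij
    have h2 : (i : ℝ) + 2 ≠ 0 := by positivity
    have h3 : (j : ℝ) + 2 ≠ 0 := by positivity
    simp only [ha] at hij
    rw [div_eq_div_iff h2 h3] at hij
    have : (i : ℝ) = j := by linarith
    exact_mod_cast this
  set w : ℂ := (((x - 1) / (x + 1) : ℝ) : ℂ) with hw
  have hx1 : 0 < x + 1 := by linarith
  have hwb : w ∈ Metric.ball (0 : ℂ) 1 := by
    rw [mem_ball_zero_iff, hw, Complex.norm_real, Real.norm_eq_abs, abs_lt, lt_div_iff₀ hx1,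
      div_lt_iff₀ hx1]
    constructor <;> linarith
  -- Back in the half-plane, the Blaschke factor at the zero k + 1 has modulus |x - (k + 1)| / (x +
  -- (k + 1)).
  have hquot : ∀ n : ℕ,
      ‖h w‖ ≤ C * 2 ^ K * ∏ k ∈ Finset.range n, (|x - (k + 1)| / (x + (k + 1))) := by
    intro n
    have h1 := norm_mul_prod_le_of_zeros hhd hhC hinj (fun n => by positivity)
      (fun n => (div_lt_one (by positivity)).2 (by simp)) hza n hwb
    have h2 : ∀ k : ℕ, ‖w - a k‖ = ‖1 - a k * w‖ * (|x - (k + 1)| / (x + (k + 1))) := by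
      intro k
      have hk : (0 : ℝ) < k + 2 := by positivity
      have hxk : 0 < x + (k + 1) := by positivity
      have e1 : w - a k = ((2 / ((x + 1) * (k + 2)) * (x - (k + 1)) : ℝ) : ℂ) := by
        rw [hw, ha, ← Complex.ofReal_sub]
        congr 1
        field_simp
        ring
      have e2 : 1 - a k * w = ((2 / ((x + 1) * (k + 2)) * (x + (k + 1)) : ℝ) : ℂ) := by
        rw [hw, ha, ← Complex.ofReal_mul, ← Complex.ofReal_one, ← Complex.ofReal_sub]
        congr 1
        field_simp
        ring
      rw [e1, e2, Complex.norm_real, Complex.norm_real, norm_mul, norm_mul, Real.norm_eq_abs,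
        Real.norm_eq_abs, Real.norm_of_nonneg hxk.le]
      field_simp
    have h3 : 0 < ∏ k ∈ Finset.range n, ‖1 - a k * w‖ := by
      refine Finset.prod_pos fun k _ => norm_pos_iff.2 fun h0 => ?_
      have : ‖(a k : ℂ) * w‖ < 1 := by
        rw [norm_mul, Complex.norm_real, Real.norm_of_nonneg (by positivity)]
        have h4 : a k < 1 := (div_lt_one (by positivity)).2 (by simp)
        have h5 : ‖w‖ < 1 := by simpa using hwb
        have h6 : 0 ≤ a k := by positivity
        nlinarith [norm_nonneg w]
      rw [← sub_eq_zero.1 h0] at this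
      simp at this
    rw [Finset.prod_congr rfl fun k _ => h2 k, Finset.prod_mul_distrib] at h1
    refine le_of_mul_le_mul_right (h1.trans (le_of_eq ?_)) h3
    ring
  have hlim := (tendsto_prod_abs_sub_div_add hx).const_mul (C * 2 ^ K)
  rw [mul_zero] at hlim
  have h0 : h w = 0 := norm_le_zero_iff.1 (ge_of_tendsto' hlim hquot)
  rw [hh] at h0
  simp only [mul_eq_zero] at h0
  rcases h0 with h0 | h0
  · rwa [hw, hφa x hx] at h0
  · exact absurd h0 (pow_ne_zero _ (div_ne_zero (hne w hwb) two_ne_zero))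

end Carlson

end JacobiProduct


/-! ### Functions of polynomial growth, and the sum of residues as one of them. -/

namespace JacobiProduct

namespace PolyGrowth

theorem const (a : ℂ) : PolyGrowth fun _ => a :=
  ⟨differentiableOn_const a, ‖a‖, 0, by simp⟩

theorem id : PolyGrowth fun z => z :=
  ⟨differentiableOn_id, 1, 1, fun z _ => by simp⟩

theorem mul {f g : ℂ → ℂ} (hf : PolyGrowth f) (hg : PolyGrowth g) :
    PolyGrowth fun z => f z * g z := by
  obtain ⟨hfd, C, K, hC⟩ := hf
  obtain ⟨hgd, D, L, hD⟩ := hg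
  refine ⟨hfd.mul hgd, C * D, K + L, fun z hz => ?_⟩
  rw [norm_mul, pow_add, show C * D * ((1 + ‖z‖) ^ K * (1 + ‖z‖) ^ L) =
    C * (1 + ‖z‖) ^ K * (D * (1 + ‖z‖) ^ L) by ring]
  exact mul_le_mul (hC z hz) (hD z hz) (norm_nonneg _) ((norm_nonneg _).trans (hC z hz))

theorem add {f g : ℂ → ℂ} (hf : PolyGrowth f) (hg : PolyGrowth g) :
    PolyGrowth fun z => f z + g z := by
  obtain ⟨hfd, C, K, hC⟩ := hf
  obtain ⟨hgd, D, L, hD⟩ := hg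
  refine ⟨hfd.add hgd, |C| + |D|, K + L, fun z hz => ?_⟩
  have h1 : (1 : ℝ) ≤ 1 + ‖z‖ := by simp
  calc ‖f z + g z‖ ≤ ‖f z‖ + ‖g z‖ := norm_add_le _ _
    _ ≤ C * (1 + ‖z‖) ^ K + D * (1 + ‖z‖) ^ L := add_le_add (hC z hz) (hD z hz)
    _ ≤ |C| * (1 + ‖z‖) ^ (K + L) + |D| * (1 + ‖z‖) ^ (K + L) := by
        gcongr
        · exact le_abs_self C
        · exact Nat.le_add_right K L
        · exact le_abs_self D
        · exact Nat.le_add_left L K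
    _ = (|C| + |D|) * (1 + ‖z‖) ^ (K + L) := by ring

theorem neg {f : ℂ → ℂ} (hf : PolyGrowth f) : PolyGrowth fun z => -f z := by
  simpa using (const (-1)).mul hf

theorem sub {f g : ℂ → ℂ} (hf : PolyGrowth f) (hg : PolyGrowth g) :
    PolyGrowth fun z => f z - g z := by
  simpa only [sub_eq_add_neg] using hf.add hg.neg

theorem sum {ι : Type*} (s : Finset ι) {f : ι → ℂ → ℂ} (h : ∀ i ∈ s, PolyGrowth (f i)) :
    PolyGrowth fun z => ∑ i ∈ s, f i z := by
  classical
  induction s using Finset.induction_on with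
  | empty => simpa using const 0
  | insert a s ha ih =>
    simp only [Finset.sum_insert ha]
    exact (h a (Finset.mem_insert_self _ _)).add
      (ih fun i hi => h i (Finset.mem_insert_of_mem hi))

theorem prod {ι : Type*} (s : Finset ι) {f : ι → ℂ → ℂ} (h : ∀ i ∈ s, PolyGrowth (f i)) :
    PolyGrowth fun z => ∏ i ∈ s, f i z := by
  classical
  induction s using Finset.induction_on with
  | empty => simpa using const 1
  | insert a s ha ih =>
    simp only [Finset.prod_insert ha]
    exact (h a (Finset.mem_insert_self _ _)).mul
      (ih fun i hi => h i (Finset.mem_insert_of_mem hi))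

theorem inv {f : ℂ → ℂ} (hf : PolyGrowth f) {ε : ℝ} (hε : 0 < ε)
    (h : ∀ z : ℂ, 0 < z.re → ε ≤ (f z).re) : PolyGrowth fun z => (f z)⁻¹ := by
  have hpos : ∀ z : ℂ, 0 < z.re → ε ≤ ‖f z‖ := fun z hz =>
    (h z hz).trans (Complex.re_le_norm _)
  refine ⟨hf.1.inv fun z hz h0 => ?_, ε⁻¹, 0, fun z hz => ?_⟩
  · have := hpos z hz
    rw [h0, norm_zero] at this
    linarith
  · rw [pow_zero, mul_one, norm_inv]
    exact inv_anti₀ hε (hpos z hz)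

end PolyGrowth

/-- The factor `∏_τ ∏_l (u + c - α_τ - l + 1) / (u - α_τ - l + 1)` of the integrand. -/
noncomputable def jacobiFactor (α : ℕ → ℝ) (M : ℕ → ℕ) (T : ℕ) (c u : ℂ) : ℂ :=
  ∏ τ ∈ Finset.Icc 1 T, ∏ l ∈ Finset.Icc 1 (M τ),
    (u + c - (α τ : ℂ) - (l : ℂ) + 1) / (u - (α τ : ℂ) - (l : ℂ) + 1)

/-- At u = -c_0 - x_j the denominators are -(c_0 + x_j + α_τ + l - 1), of real part at most -α_τ, so
their inverses are bounded. Replacing x_j by x_j + c_0 keeps real parts nonnegative, which lets the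
induction run. -/
theorem polyGrowth_residueSum {N : ℕ} {α : ℕ → ℝ} (hα : ∀ τ, 1 ≤ τ → 0 < α τ) (M : ℕ → ℕ) {m : ℕ}
    (T : Fin m → ℕ) {c : Fin m → ℂ → ℂ} {x : Fin N → ℂ → ℂ}
    (hc : ∀ i, PolyGrowth (c i)) (hc0 : ∀ i, ∀ z : ℂ, 0 < z.re → 0 ≤ (c i z).re)
    (hx : ∀ l, PolyGrowth (x l)) (hx0 : ∀ l, ∀ z : ℂ, 0 < z.re → 0 ≤ (x l z).re) :
    PolyGrowth fun z => residueSum m (fun i => c i z)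
      (fun i => jacobiFactor α M (T i) (c i z)) (fun l => x l z) := by
  induction m generalizing x with
  | zero =>
    simp only [residueSum, vander]
    exact PolyGrowth.prod _ fun i _ => PolyGrowth.prod _ fun j _ => (hx j).sub (hx i)
  | succ m ih =>
    simp only [residueSum]
    refine PolyGrowth.sum _ fun j _ => PolyGrowth.mul ?_ ?_
    · refine PolyGrowth.prod _ fun τ hτ => PolyGrowth.prod _ fun l hl => ?_
      simp only [div_eq_mul_inv]
      have h1 : PolyGrowth fun z => -c 0 z - x j z := (hc 0).neg.sub (hx j)
      refine ((((h1.add (hc 0)).sub (.const _)).sub (.const _)).add (.const _)).mul ?_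
      have h2 := PolyGrowth.inv ((((hc 0).add (hx j)).add (.const (α τ : ℂ))).add
        (.const ((l : ℂ) - 1))) (hα τ (Finset.mem_Icc.1 hτ).1) fun z hz => ?_
      · convert h2.neg using 2 with z
        rw [← inv_neg]
        congr 1
        ring
      · have h3 : (1 : ℝ) ≤ l := by exact_mod_cast (Finset.mem_Icc.1 hl).1
        have h4 := hc0 0 z hz
        have h5 := hx0 j z hz
        simp only [Complex.add_re, Complex.ofReal_re, Complex.sub_re, Complex.natCast_re,
          Complex.one_re]
        linarith
    · have := ih (fun i => T i.succ) (c := fun i => c i.succ)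
        (x := fun l z => x l z + if l = j then c 0 z else 0) (fun i => hc i.succ)
        (fun i => hc0 i.succ) (fun l => (hx l).add ?_) (fun l z hz => ?_)
      · convert this using 3 with z
        funext l
        simp [Pi.single_apply]
      · split_ifs
        exacts [hc 0, .const 0]
      · rw [Complex.add_re]
        refine add_nonneg (hx0 l z hz) ?_
        split_ifs
        exacts [hc0 0 z hz, le_rfl]

end JacobiProduct


/-! ### Schur polynomials with arbitrary indices: power sums and straightening. -/

namespace JacobiProduct

open MvPolynomial

section SchurAlgebra

/-- The exponents `κ_j + N - j` of the alternant. -/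
def expo {N : ℕ} (κ : Fin N → ℕ) (j : Fin N) : ℕ := κ j + (N - 1 - (j : ℕ))

theorem expo_add_single {N : ℕ} (κ : Fin N → ℕ) (j : Fin N) (c : ℕ) :
    expo (κ + Pi.single j c) = expo κ + Pi.single j c := by
  funext k
  simp only [expo, Pi.add_apply]
  ring

theorem vandermondeProd_ne_zero (N : ℕ) : vandermondeProd N ≠ 0 :=
  Finset.prod_ne_zero_iff.2 fun _ _ => Finset.prod_ne_zero_iff.2 fun _ hj =>
    (irreducible_X_sub_X (Finset.mem_Ioi.1 hj).ne).ne_zero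

theorem eq_schur {N : ℕ} {κ : Fin N → ℕ} {p : MvPolynomial (Fin N) ℝ}
    (h : vandermondeProd N * p = alternant κ) : schur κ = p :=
  mul_left_cancel₀ (vandermondeProd_ne_zero N) ((vandermondeProd_mul_schur κ).trans h.symm)

theorem alternant_eq_sum {N : ℕ} (κ : Fin N → ℕ) :
    alternant κ = ∑ σ : Equiv.Perm (Fin N), ((Equiv.Perm.sign σ : ℤ) : MvPolynomial (Fin N) ℝ) *
      ∏ i, X (σ i) ^ expo κ i := by
  rw [alternant, Matrix.det_apply']
  rfl

/-- The Pieri-type rule for multiplication by a power sum. -/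
theorem psum_mul_schur {N : ℕ} (κ : Fin N → ℕ) (c : ℕ) :
    (∑ i : Fin N, X i ^ c) * schur κ = ∑ j, schur (κ + Pi.single j c) := by
  -- After multiplication by the Vandermonde product both sides are sums over permutations σ. In the
  -- term of σ, the factor X_{σ j}^c raises the exponent with index j by c.
  refine mul_left_cancel₀ (vandermondeProd_ne_zero N) ?_
  rw [mul_left_comm, vandermondeProd_mul_schur, Finset.mul_sum]
  simp only [vandermondeProd_mul_schur, alternant_eq_sum]
  rw [Finset.sum_comm, Finset.mul_sum]
  refine Finset.sum_congr rfl fun σ _ => ?_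
  rw [← Equiv.sum_comp σ, Finset.sum_mul]
  refine Finset.sum_congr rfl fun j _ => ?_
  rw [mul_left_comm]
  congr 1
  simp only [expo_add_single, Pi.add_apply, pow_add, Finset.prod_mul_distrib]
  rw [mul_comm]
  congr 1
  rw [Finset.prod_eq_single j (fun i _ hi => by simp [Pi.single_eq_of_ne hi]) (by simp)]
  simp

theorem schur_zero (N : ℕ) : schur (0 : Fin N → ℕ) = 1 := by
  refine eq_schur ?_
  have := Matrix.det_projVandermonde (fun _ : Fin N => (1 : MvPolynomial (Fin N) ℝ)) X
  rw [mul_one, vandermondeProd, alternant]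
  simp only [one_mul] at this
  rw [← this]
  congr 1
  ext1 i j
  simp [Matrix.projVandermonde_apply, Fin.val_rev, Nat.sub_sub, add_comm]

theorem schur_eq_zero {N : ℕ} {κ : Fin N → ℕ} (h : ¬ Function.Injective (expo κ)) :
    schur κ = 0 := by
  refine eq_schur ?_
  rw [Function.Injective] at h
  push Not at h
  obtain ⟨i, j, hij, hne⟩ := h
  rw [mul_zero, alternant, eq_comm]
  refine Matrix.det_zero_of_column_eq hne fun k => ?_
  simp only [Matrix.of_apply]
  exact congrArg _ hij

theorem schur_eq_sign_mul {N : ℕ} {κ μ : Fin N → ℕ} {σ : Equiv.Perm (Fin N)}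
    (h : expo κ = expo μ ∘ σ) :
    schur κ = ((Equiv.Perm.sign σ : ℤ) : MvPolynomial (Fin N) ℝ) * schur μ := by
  refine eq_schur ?_
  rw [mul_left_comm, vandermondeProd_mul_schur, alternant, alternant, ← Matrix.det_permute']
  congr 1
  ext1 i j
  simp only [Matrix.of_apply, Matrix.submatrix_apply, id]
  congr 1
  exact (congrFun h j).symm

theorem StrictAnti.add_sub_le {N : ℕ} {g : Fin N → ℕ} (hg : StrictAnti g) {i j : Fin N}
    (hij : i ≤ j) : g j + ((j : ℕ) - i) ≤ g i := by
  obtain ⟨d, hd⟩ : ∃ d, (j : ℕ) = i + d := ⟨j - i, by have : (i : ℕ) ≤ j := hij; omega⟩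
  induction d generalizing j with
  | zero =>
    have : j = i := Fin.ext (by simpa using hd)
    simp [this]
  | succ d ih =>
    have hj : (i : ℕ) + d < N := by omega
    have h1 := ih (j := ⟨i + d, hj⟩) (Fin.le_def.2 (by simp)) rfl
    have h2 : g j < g ⟨i + d, hj⟩ := hg (Fin.lt_def.2 (by simp [hd]))
    simp only at h1
    omega

/-- Every Schur polynomial with distinct exponents is, up to sign, one of a partition. -/
theorem exists_partition {N : ℕ} {κ : Fin N → ℕ} (h : Function.Injective (expo κ)) :
    ∃ (μ : Fin N → ℕ) (σ : Equiv.Perm (Fin N)), Antitone μ ∧ expo κ = expo μ ∘ σ := by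
  -- Sort the exponents decreasingly. Being distinct naturals they dominate the staircase N - 1 - j,
  -- and subtracting it leaves a partition.
  set σ : Equiv.Perm (Fin N) := Fin.revPerm.trans (Tuple.sort (expo κ)) with hσ
  set g : Fin N → ℕ := expo κ ∘ σ with hg
  have hinj : Function.Injective g := h.comp σ.injective
  have hanti : StrictAnti g := by
    refine Antitone.strictAnti_of_injective (fun i j hij => ?_) hinj
    simpa [hg, hσ] using Tuple.monotone_sort (expo κ) (Fin.rev_le_rev.2 hij)
  have hge : ∀ j : Fin N, N - 1 - (j : ℕ) ≤ g j := fun j => by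
    have hj := j.2
    have := StrictAnti.add_sub_le hanti (i := j) (j := ⟨N - 1, by omega⟩)
      (Fin.le_def.2 (by simp only; omega))
    simp only at this
    omega
  refine ⟨fun j => g j - (N - 1 - (j : ℕ)), σ.symm, fun i j hij => ?_, ?_⟩
  · have h1 := StrictAnti.add_sub_le hanti hij
    have h2 := hge i
    have h3 : (i : ℕ) ≤ j := hij
    have h4 := j.2
    simp only
    omega
  · funext j
    simp only [Function.comp_apply, expo]
    rw [Nat.sub_add_cancel (hge _), hg]
    simp [expo]

end SchurAlgebra

/-! ### Schur polynomials at points with coordinates equal to 1. -/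

section Confluent

/-- The product `∏_{i < j} (x_i - x_j)` of real numbers. -/
def diffProd {n : ℕ} (x : Fin n → ℝ) : ℝ := ∏ i, ∏ j ∈ Finset.Ioi i, (x i - x j)

theorem eval_vandermondeProd {N : ℕ} (x : Fin N → ℝ) :
    eval x (vandermondeProd N) = diffProd x := by
  simp [vandermondeProd, diffProd]

theorem diffProd_append {K n : ℕ} (a : Fin K → ℝ) (x : Fin n → ℝ) :
    diffProd (Fin.append a x) = diffProd a * (∏ i, ∏ j, (a i - x j)) * diffProd x := by
  have h : ∀ {m : ℕ} (i : Fin m) (f : Fin m → ℝ),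
      ∏ j ∈ Finset.Ioi i, f j = ∏ j, if i < j then f j else 1 := fun i f => by
    rw [← Finset.prod_filter]
    congr 1
    ext
    simp
  simp only [diffProd, h, Fin.prod_univ_add, Fin.append_left, Fin.append_right]
  have h1 : ∀ (i : Fin K) (j : Fin n), Fin.castAdd n i < Fin.natAdd K j := fun i j =>
    Fin.lt_def.2 (by simp only [Fin.val_castAdd, Fin.val_natAdd]; omega)
  have h2 : ∀ (i : Fin K) (j : Fin n), ¬ Fin.natAdd K j < Fin.castAdd n i := fun i j =>
    (h1 i j).not_gt
  have h3 : ∀ i j : Fin K, Fin.castAdd n i < Fin.castAdd n j ↔ i < j := fun i j => Iff.rfl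
  have h4 : ∀ i j : Fin n, Fin.natAdd K i < Fin.natAdd K j ↔ i < j := fun i j => by
    rw [Fin.lt_def, Fin.lt_def, Fin.val_natAdd, Fin.val_natAdd, Nat.add_lt_add_iff_left]
  simp only [h1, h2, h3, h4, if_true, if_false, Finset.prod_const_one, one_mul,
    Finset.prod_mul_distrib]

/-- The block matrix with rows `A_i` for the first indices and `B_i` for the last ones. -/
def stackRows {K n : ℕ} {R : Type*} (A : Fin K → Fin (K + n) → R) (B : Fin n → Fin (K + n) → R) :
    Matrix (Fin (K + n)) (Fin (K + n)) R :=
  Matrix.of fun i l => Fin.addCases (fun i => A i l) (fun i => B i l) i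

/-- Expanding y^i = ((y - 1) + 1)^i is a unitriangular row operation. It exposes the powers of q - 1
to be cancelled in the confluent limit. -/
theorem det_stackRows_pow {K n : ℕ} (y : Fin (K + n) → ℝ) (B : Fin n → Fin (K + n) → ℝ) :
    (stackRows (fun (i : Fin K) l => y l ^ (i : ℕ)) B).det =
      (stackRows (fun (i : Fin K) l => (y l - 1) ^ (i : ℕ)) B).det := by
  have hne : ∀ (i : Fin n) (k : Fin K), Fin.natAdd K i ≠ Fin.castAdd n k := fun i k h => by
    have h1 := congrArg Fin.val h
    rw [Fin.val_natAdd, Fin.val_castAdd] at h1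
    omega
  set L : Matrix (Fin (K + n)) (Fin (K + n)) ℝ := Matrix.of fun i k =>
    Fin.addCases (fun i : Fin K => Fin.addCases (fun k : Fin K => ((i : ℕ).choose k : ℝ))
      (fun _ => 0) k) (fun i : Fin n => if Fin.natAdd K i = k then 1 else 0) i with hL
  have hmul : stackRows (fun (i : Fin K) l => y l ^ (i : ℕ)) B =
      L * stackRows (fun (i : Fin K) l => (y l - 1) ^ (i : ℕ)) B := by
    ext i l
    rw [Matrix.mul_apply, Fin.sum_univ_add]
    refine Fin.addCases (fun i => ?_) (fun i => ?_) i
    · simp only [stackRows, hL, Matrix.of_apply, Fin.addCases_left, Fin.addCases_right, zero_mul,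
        Finset.sum_const_zero, add_zero]
      rw [Fin.sum_univ_eq_sum_range
        (fun k => ((i : ℕ).choose k : ℝ) * (y l - 1) ^ k) K]
      have hsub : Finset.range ((i : ℕ) + 1) ⊆ Finset.range K :=
        Finset.range_subset_range.2 i.2
      rw [← Finset.sum_subset hsub]
      · conv_lhs => rw [← sub_add_cancel (y l) 1, add_pow]
        exact Finset.sum_congr rfl fun k _ => by rw [one_pow]; ring
      · intro k _ hk
        rw [Nat.choose_eq_zero_of_lt (by simpa using hk)]
        simp
    · simp [stackRows, hL, hne]
  have hdet : L.det = 1 := by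
    rw [Matrix.det_of_isLowerTriangular L]
    · rw [Fin.prod_univ_add]
      simp [hL]
    · intro i k hik
      rw [OrderDual.toDual_lt_toDual] at hik
      revert hik
      refine Fin.addCases (fun i => ?_) (fun i => ?_) i <;>
        refine Fin.addCases (fun k => ?_) (fun k => ?_) k <;> intro hik
      · simp only [hL, Matrix.of_apply, Fin.addCases_left]
        rw [Nat.choose_eq_zero_of_lt (show (i : ℕ) < k from hik), Nat.cast_zero]
      · simp [hL]
      · simp only [hL, Matrix.of_apply, Fin.addCases_right]
        rw [if_neg hik.ne]
      · simp only [hL, Matrix.of_apply, Fin.addCases_right]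
        rw [if_neg hik.ne]
  rw [hmul, Matrix.det_mul, hdet, one_mul]

theorem det_stackRows_mul {K n : ℕ} (s : Fin K → ℝ) (r : Fin n → ℝ)
    (A : Fin K → Fin (K + n) → ℝ) (B : Fin n → Fin (K + n) → ℝ) :
    (stackRows (fun i l => s i * A i l) (fun i l => r i * B i l)).det =
      (∏ i, s i) * (∏ i, r i) * (stackRows A B).det := by
  have := Matrix.det_mul_column (Fin.addCases s r) (stackRows A B)
  rw [Fin.prod_univ_add] at this
  simp only [Fin.addCases_left, Fin.addCases_right] at this
  rw [← this]
  congr 1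
  ext i l
  refine Fin.addCases (fun i => ?_) (fun i => ?_) i <;> simp [stackRows]

/-- The Schur polynomial at a point whose first `K` coordinates are `1`. -/
theorem eval_schur_append {K n : ℕ} (κ : Fin (K + n) → ℕ) (x : Fin n → ℝ) :
    eval (Fin.append 1 x) (schur κ) *
        (diffProd (fun i : Fin K => (i : ℝ)) * (∏ j, (1 - x j) ^ K) * diffProd x) =
      (stackRows (fun (i : Fin K) l => (expo κ l : ℝ) ^ (i : ℕ))
        (fun i l => x i ^ expo κ l)).det := by
  -- The first K coordinates are taken to be 1, q, …, q^{K-1}. Both sides then carry the factor (q -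
  -- 1)^p with p = 0 + 1 + ⋯ + (K - 1); `gs k q` is (q^k - 1) / (q - 1), with value k at q = 1.
  set gs : ℕ → ℝ → ℝ := fun k q => ∑ i ∈ Finset.range k, q ^ i with hgs
  have hgs1 : ∀ k q, (q - 1) * gs k q = q ^ k - 1 := fun k q => mul_geom_sum q k
  have hgsc : ∀ k, Continuous (gs k) := fun k => by
    rw [hgs]
    fun_prop
  set b : ℝ → ℝ := fun q => ∏ i : Fin K, ∏ j ∈ Finset.Ioi i,
    (-(q ^ (i : ℕ) * gs ((j : ℕ) - i) q)) with hb
  set p : ℕ := ∑ i : Fin K, (i : ℕ) with hp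
  have hbp : ∀ q : ℝ, diffProd (fun i : Fin K => q ^ (i : ℕ)) = (q - 1) ^ p * b q := by
    intro q
    have h1 : ∀ i : Fin K, ∀ j ∈ Finset.Ioi i, q ^ (i : ℕ) - q ^ (j : ℕ) =
        (q - 1) * (-(q ^ (i : ℕ) * gs ((j : ℕ) - i) q)) := by
      intro i j hj
      have h2 : (j : ℕ) = i + ((j : ℕ) - i) := by
        have := Fin.lt_def.1 (Finset.mem_Ioi.1 hj)
        omega
      have h3 := hgs1 ((j : ℕ) - i) q
      conv_lhs => rw [h2, pow_add]
      linear_combination q ^ (i : ℕ) * h3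
    have h4 : ∏ i : Fin K, ∏ _j ∈ Finset.Ioi i, (q - 1) = (q - 1) ^ p := by
      simp only [Finset.prod_const, Fin.card_Ioi]
      rw [Finset.prod_pow_eq_pow_sum, hp, ← Equiv.sum_comp Fin.revPerm]
      congr 1
      refine Finset.sum_congr rfl fun i _ => ?_
      simp only [Fin.revPerm_apply, Fin.val_rev]
      have := i.2
      omega
    rw [diffProd, Finset.prod_congr rfl fun i _ => Finset.prod_congr rfl (h1 i)]
    simp only [Finset.prod_mul_distrib]
    rw [h4, hb]
  set lhs : ℝ → ℝ := fun q => eval (Fin.append (fun i : Fin K => q ^ (i : ℕ)) x) (schur κ) *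
    (b q * (∏ i : Fin K, ∏ j, (q ^ (i : ℕ) - x j)) * diffProd x) with hlhs
  set rhs : ℝ → ℝ := fun q => (stackRows (fun (i : Fin K) l => gs (expo κ l) q ^ (i : ℕ))
    (fun i l => x i ^ expo κ l)).det with hrhs
  have hlc : Continuous lhs := by
    refine Continuous.mul ?_ (((?_ : Continuous b).mul (by fun_prop)).mul continuous_const)
    · refine (MvPolynomial.continuous_eval _).comp (continuous_pi fun i => ?_)
      refine Fin.addCases (fun i => ?_) (fun i => ?_) i
      · simp only [Fin.append_left]
        fun_prop
      · simp only [Fin.append_right]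
        fun_prop
    · exact continuous_finsetProd _ fun i _ => continuous_finsetProd _ fun j _ =>
        ((continuous_pow _).mul (hgsc _)).neg
  have hrc : Continuous rhs := by
    refine Continuous.matrix_det (continuous_matrix fun i l => ?_)
    refine Fin.addCases (fun i => ?_) (fun i => ?_) i
    · simp only [stackRows, Matrix.of_apply, Fin.addCases_left]
      exact (hgsc _).pow _
    · simp only [stackRows, Matrix.of_apply, Fin.addCases_right]
      exact continuous_const
  have heq : lhs = rhs := by
    -- The identity is proved for q ≠ 1, where (q - 1)^p cancels, and extends to q = 1 by
    -- continuity.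
    refine hlc.ext_on (dense_compl_singleton 1) hrc fun q hq => ?_
    have hq1 : (q - 1) ^ p ≠ 0 := pow_ne_zero _ (sub_ne_zero.2 hq)
    refine mul_left_cancel₀ hq1 ?_
    have h1 : (q - 1) ^ p * lhs q =
        eval (Fin.append (fun i : Fin K => q ^ (i : ℕ)) x) (alternant κ) := by
      rw [← vandermondeProd_mul_schur, map_mul, eval_vandermondeProd, diffProd_append, hbp, hlhs]
      ring
    have h2 : eval (Fin.append (fun i : Fin K => q ^ (i : ℕ)) x) (alternant κ) =
        (stackRows (fun (i : Fin K) l => (q ^ expo κ l) ^ (i : ℕ))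
          (fun i l => x i ^ expo κ l)).det := by
      rw [alternant, RingHom.map_det]
      congr 1
      ext i l
      refine Fin.addCases (fun i => ?_) (fun i => ?_) i
      · simp [stackRows, expo, ← pow_mul, mul_comm]
      · simp [stackRows, expo]
    have h3 := det_stackRows_mul (fun i : Fin K => (q - 1) ^ (i : ℕ)) (fun _ : Fin n => 1)
      (fun (i : Fin K) l => gs (expo κ l) q ^ (i : ℕ)) (fun i l => x i ^ expo κ l)
    rw [Finset.prod_pow_eq_pow_sum, Finset.prod_const_one, mul_one, ← hp] at h3
    rw [h1, h2, det_stackRows_pow, ← h3]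
    simp only [← mul_pow, hgs1, one_mul]
  have hgs_one : ∀ k, gs k 1 = k := fun k => by simp [hgs]
  have := congrFun heq 1
  simp only [hlhs, hrhs, hgs_one, one_pow] at this
  rw [← this]
  have hb1 : b 1 = diffProd fun i : Fin K => (i : ℝ) := by
    rw [hb, diffProd]
    refine Finset.prod_congr rfl fun i _ => Finset.prod_congr rfl fun j hj => ?_
    have : (i : ℕ) ≤ j := (Fin.lt_def.1 (Finset.mem_Ioi.1 hj)).le
    rw [hgs_one, Nat.cast_sub this]
    simp
  rw [hb1, Finset.prod_const, Finset.prod_pow]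
  simp only [Finset.card_univ, Fintype.card_fin]
  rfl

theorem diffProd_natCast_ne_zero (K : ℕ) : diffProd (fun i : Fin K => (i : ℝ)) ≠ 0 :=
  Finset.prod_ne_zero_iff.2 fun i _ => Finset.prod_ne_zero_iff.2 fun j hj => by
    rw [sub_ne_zero, Ne, Nat.cast_inj]
    exact (Fin.lt_def.1 (Finset.mem_Ioi.1 hj)).ne

/-- Weyl's dimension formula. -/
theorem eval_one_schur {N : ℕ} (κ : Fin N → ℕ) :
    eval 1 (schur κ) * vander (fun j => (expo (0 : Fin N → ℕ) j : ℝ)) =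
      vander fun j => (expo κ j : ℝ) := by
  have key : ∀ κ : Fin N → ℕ, eval 1 (schur κ) * diffProd (fun i : Fin N => (i : ℝ)) =
      vander fun j => (expo κ j : ℝ) := by
    intro κ
    have h := eval_schur_append (K := N) (n := 0) κ Fin.elim0
    rw [Finset.univ_eq_empty, Finset.prod_empty, mul_one,
      show diffProd (Fin.elim0 : Fin 0 → ℝ) = 1 from rfl, mul_one] at h
    have h1 : (Fin.append 1 Fin.elim0 : Fin (N + 0) → ℝ) = 1 := by
      funext i
      exact Fin.addCases (fun i => by rw [Fin.append_left]; rfl) (fun i => i.elim0) i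
    rw [h1] at h
    refine h.trans ?_
    rw [vander, ← Matrix.det_vandermonde, ← Matrix.det_transpose]
    congr 1
    ext i l
    refine Fin.addCases (fun l => ?_) (fun l => l.elim0) l
    simp only [Matrix.transpose_apply, stackRows, Matrix.of_apply, Matrix.vandermonde_apply]
    exact Fin.addCases_left (m := N) (n := 0) l
  rw [← key κ, ← key (0 : Fin N → ℕ), schur_zero, map_one, one_mul]

end Confluent

end JacobiProduct


/-! ### From the ordered cube to the full cube. -/

namespace JacobiProduct

open MeasureTheory

section Symmetrization

theorem diffProd_eq_vander {n : ℕ} (x : Fin n → ℝ) : diffProd x = vander fun i => -x i := by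
  simp only [diffProd, vander, neg_sub_neg]

theorem diffProd_comp_perm {n : ℕ} (x : Fin n → ℝ) (σ : Equiv.Perm (Fin n)) :
    diffProd (x ∘ σ) = Equiv.Perm.sign σ * diffProd x := by
  rw [diffProd_eq_vander, diffProd_eq_vander, ← vander_comp_perm]
  rfl

theorem diffProd_eq_zero {n : ℕ} {x : Fin n → ℝ} (hx : ¬ Function.Injective x) :
    diffProd x = 0 := by
  by_contra h
  rw [diffProd_eq_vander] at h
  exact hx fun i j hij => vander_ne_zero.1 h (by simp [hij])

theorem diffProd_eq_sum {n : ℕ} (x : Fin n → ℝ) :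
    diffProd x = ∑ σ : Equiv.Perm (Fin n), ((Equiv.Perm.sign σ : ℤ) : ℝ) *
      ∏ i, (-x i) ^ (σ i : ℕ) := by
  rw [diffProd_eq_vander, vander, ← Matrix.det_vandermonde, ← Matrix.det_transpose,
    Matrix.det_apply']
  rfl

theorem det_stackRows_eq_sum {K n : ℕ} (A : Fin K → Fin (K + n) → ℝ)
    (B : Fin n → Fin (K + n) → ℝ) :
    (stackRows A B).det = ∑ σ : Equiv.Perm (Fin (K + n)), ((Equiv.Perm.sign σ : ℤ) : ℝ) *
      (∏ i, A i (σ (Fin.castAdd n i))) * ∏ i, B i (σ (Fin.natAdd K i)) := by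
  rw [← Matrix.det_transpose, Matrix.det_apply']
  simp [stackRows, Fin.prod_univ_add, mul_assoc]

theorem det_stackRows_comp_perm {K n : ℕ} (A : Fin K → Fin (K + n) → ℝ)
    (B : Fin n → Fin (K + n) → ℝ) (σ : Equiv.Perm (Fin n)) :
    (stackRows A fun i => B (σ i)).det = Equiv.Perm.sign σ * (stackRows A B).det := by
  set ρ : Equiv.Perm (Fin (K + n)) :=
    finSumFinEquiv.permCongr (Equiv.Perm.sumCongr 1 σ) with hρ
  have hs : Equiv.Perm.sign ρ = Equiv.Perm.sign σ := by
    rw [hρ, Equiv.Perm.sign_permCongr, Equiv.Perm.sign_sumCongr, map_one, one_mul]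
  rw [← hs, ← Matrix.det_permute]
  congr 1
  ext i l
  refine Fin.addCases (fun i => ?_) (fun i => ?_) i <;> simp [stackRows, hρ, Equiv.permCongr_apply]

theorem measurableSet_orderedCube (n : ℕ) : MeasurableSet (orderedCube n) := by
  refine IsClosed.measurableSet ?_
  simp only [orderedCube, Antitone, Set.ofPred_and, Set.ofPred_forall]
  refine IsClosed.inter ?_ (isClosed_iInter fun i => IsClosed.inter ?_ ?_)
  · exact isClosed_iInter fun i => isClosed_iInter fun j => isClosed_iInter fun _ =>
      isClosed_le (continuous_apply j) (continuous_apply i)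
  · exact isClosed_le continuous_const (continuous_apply i)
  · exact isClosed_le (continuous_apply i) continuous_const

theorem exists_unique_antitone_comp {n : ℕ} {x : Fin n → ℝ} (hx : Function.Injective x) :
    ∃ σ : Equiv.Perm (Fin n), Antitone (x ∘ σ) ∧
      ∀ τ : Equiv.Perm (Fin n), Antitone (x ∘ τ) → τ = σ := by
  have hrev : ∀ τ : Equiv.Perm (Fin n), Antitone (x ∘ τ) →
      Monotone (x ∘ (Fin.revPerm.trans τ)) := fun τ hτ i j hij => hτ (Fin.rev_le_rev.2 hij)
  have hσ : Antitone (x ∘ (Fin.revPerm.trans (Tuple.sort x))) := fun i j hij =>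
    Tuple.monotone_sort x (Fin.rev_le_rev.2 hij)
  refine ⟨Fin.revPerm.trans (Tuple.sort x), hσ, fun τ hτ => ?_⟩
  have h := Tuple.unique_monotone (hrev τ hτ) (hrev _ hσ)
  ext i
  have h1 := congrFun h (Fin.rev i)
  simp only [Function.comp_apply, Equiv.trans_apply, Fin.revPerm_apply, Fin.rev_rev] at h1
  exact congrArg Fin.val (hx h1)

theorem measurePreserving_comp_perm {n : ℕ} (σ : Equiv.Perm (Fin n)) :
    MeasurePreserving (fun x : Fin n → ℝ => x ∘ σ) volume volume :=
  volume_preserving_arrowCongr' σ.symm (MeasurableEquiv.refl ℝ) (MeasurePreserving.id _)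

theorem measurableEmbedding_comp_perm {n : ℕ} (σ : Equiv.Perm (Fin n)) :
    MeasurableEmbedding (fun x : Fin n → ℝ => x ∘ σ) :=
  (MeasurableEquiv.arrowCongr' σ.symm (MeasurableEquiv.refl ℝ)).measurableEmbedding

/-- A point with distinct coordinates has exactly one decreasing rearrangement. Since G vanishes at
all other points, the decomposition into n! copies holds pointwise and no null sets need to be
discarded. -/
theorem integral_orderedCube {n : ℕ} {G : (Fin n → ℝ) → ℝ}
    (hsymm : ∀ (σ : Equiv.Perm (Fin n)) x, G (x ∘ σ) = G x)
    (hzero : ∀ x, ¬ Function.Injective x → G x = 0) (hint : IntegrableOn G (Set.Icc 0 1)) :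
    (n.factorial : ℝ) * ∫ x in orderedCube n, G x = ∫ x in Set.Icc 0 1, G x := by
  have hsub : orderedCube n ⊆ Set.Icc 0 1 := fun x hx => ⟨fun i => (hx.2 i).1, fun i => (hx.2 i).2⟩
  have hpt : ∀ x, (Set.Icc 0 1).indicator G x =
      ∑ σ : Equiv.Perm (Fin n), (orderedCube n).indicator G (x ∘ σ) := by
    intro x
    by_cases hx : Function.Injective x
    · by_cases hc : x ∈ Set.Icc (0 : Fin n → ℝ) 1
      · obtain ⟨σ, hσ, huniq⟩ := exists_unique_antitone_comp hx
        rw [Finset.sum_eq_single σ, Set.indicator_of_mem hc, Set.indicator_of_mem, hsymm]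
        · exact ⟨hσ, fun i => ⟨hc.1 _, hc.2 _⟩⟩
        · intro τ _ hτ
          exact Set.indicator_of_notMem (fun h => hτ (huniq τ h.1)) _
        · simp
      · rw [Set.indicator_of_notMem hc, Finset.sum_eq_zero]
        intro σ _
        refine Set.indicator_of_notMem (fun h => hc ?_) _
        constructor <;> intro i
        · simpa using (h.2 (σ.symm i)).1
        · simpa using (h.2 (σ.symm i)).2
    · have h1 : ∀ (s : Set (Fin n → ℝ)) (σ : Equiv.Perm (Fin n)),
          s.indicator G (x ∘ σ) = 0 := fun s σ => by
        rw [Set.indicator_apply_eq_zero]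
        intro _
        rw [hsymm, hzero x hx]
      rw [Finset.sum_eq_zero fun σ _ => h1 _ σ]
      exact h1 _ 1
  have hord : Integrable ((orderedCube n).indicator G) :=
    (integrable_indicator_iff (measurableSet_orderedCube n)).2 (hint.mono_set hsub)
  rw [← integral_indicator measurableSet_Icc, integral_congr_ae (Filter.Eventually.of_forall hpt),
    integral_finsetSum]
  · have : ∀ σ : Equiv.Perm (Fin n), ∫ x : Fin n → ℝ, (orderedCube n).indicator G (x ∘ σ) =
        ∫ x in orderedCube n, G x := fun σ => by
      rw [(measurePreserving_comp_perm σ).integral_comp (measurableEmbedding_comp_perm σ)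
        ((orderedCube n).indicator G), integral_indicator (measurableSet_orderedCube n)]
    rw [Finset.sum_congr rfl fun σ _ => this σ, Finset.sum_const, Finset.card_univ,
      Fintype.card_perm, Fintype.card_fin, nsmul_eq_mul]
  · exact fun σ _ => (measurePreserving_comp_perm σ).integrable_comp_of_integrable hord

end Symmetrization

/-! ### Integrals of determinants and determinants of polynomials. -/

section Determinants

theorem restrict_Icc_pi (n : ℕ) : (volume : Measure (Fin n → ℝ)).restrict (Set.Icc 0 1) =
    Measure.pi fun _ => (volume : Measure ℝ).restrict (Set.Icc 0 1) := by
  rw [← Measure.restrict_pi_pi, ← volume_pi]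
  congr 1
  exact (Set.pi_univ_Icc _ _).symm

/-- Integration of a determinant whose last rows depend on separate variables. -/
theorem integral_det_stackRows {K n : ℕ} (A : Fin K → Fin (K + n) → ℝ)
    {φ : Fin n → Fin (K + n) → ℝ → ℝ} (hφ : ∀ i l, IntegrableOn (φ i l) (Set.Icc 0 1)) :
    IntegrableOn (fun x : Fin n → ℝ => (stackRows A fun i l => φ i l (x i)).det) (Set.Icc 0 1) ∧
    ∫ x in Set.Icc (0 : Fin n → ℝ) 1, (stackRows A fun i l => φ i l (x i)).det =
      (stackRows A fun i l => ∫ t in Set.Icc (0 : ℝ) 1, φ i l t).det := by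
  have hint : ∀ σ : Equiv.Perm (Fin (K + n)), IntegrableOn (fun x : Fin n → ℝ =>
      ((Equiv.Perm.sign σ : ℤ) : ℝ) * (∏ i, A i (σ (Fin.castAdd n i))) *
        ∏ i, φ i (σ (Fin.natAdd K i)) (x i)) (Set.Icc 0 1) := fun σ => by
    rw [IntegrableOn, restrict_Icc_pi]
    exact (Integrable.fintype_prod (f := fun i => φ i (σ (Fin.natAdd K i)))
      fun i => hφ i _).const_mul _
  simp only [det_stackRows_eq_sum]
  refine ⟨integrable_finsetSum _ fun σ _ => hint σ, ?_⟩
  rw [integral_finsetSum _ fun σ _ => hint σ]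
  refine Finset.sum_congr rfl fun σ _ => ?_
  rw [integral_const_mul, restrict_Icc_pi,
    integral_fintype_prod_eq_prod (fun i => φ i (σ (Fin.natAdd K i)))]

/-- The matrix is the coefficient matrix times a transposed Vandermonde matrix. What matters later
is that the constant does not depend on x. -/
theorem exists_det_eval_eq_mul_vander {N : ℕ} (P : Fin N → Polynomial ℝ)
    (hP : ∀ i, (P i).natDegree < N) :
    ∃ C : ℝ, ∀ x : Fin N → ℝ,
      (Matrix.of fun i l => (P i).eval (x l)).det = C * vander x := by
  refine ⟨(Matrix.of fun i k : Fin N => (P i).coeff k).det, fun x => ?_⟩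
  rw [vander, ← Matrix.det_vandermonde, ← Matrix.det_transpose (Matrix.vandermonde x),
    ← Matrix.det_mul]
  congr 1
  ext i l
  rw [Matrix.mul_apply, Matrix.of_apply, Polynomial.eval_eq_sum_range' (hP i),
    ← Fin.sum_univ_eq_sum_range (fun k => (P i).coeff k * x l ^ k)]
  rfl

end Determinants

/-! ### Beta integrals as rational functions of the exponent. -/

section Beta

theorem integrableOn_rpow_mul_pow {α : ℝ} (hα : 0 < α) (e : ℕ) :
    IntegrableOn (fun t : ℝ => t ^ (α - 1) * (1 - t) ^ e) (Set.Icc 0 1) := by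
  have h1 : IntervalIntegrable (fun t : ℝ => t ^ (α - 1)) volume 0 1 :=
    intervalIntegral.intervalIntegrable_rpow' (by linarith)
  rw [intervalIntegrable_iff_integrableOn_Icc_of_le zero_le_one] at h1
  have := IntegrableOn.continuousOn_mul (g := fun t : ℝ => (1 - t) ^ e) (by fun_prop) h1
    isCompact_Icc
  simpa only [mul_comm] using this

theorem integral_pow_mul_rpow_mul_pow {α : ℝ} (hα : 0 < α) (s e : ℕ) :
    ∫ t in Set.Icc (0 : ℝ) 1, t ^ s * (t ^ (α - 1) * (1 - t) ^ e) =
      e.factorial / ∏ j ∈ Finset.range (e + 1), (α + s + j) := by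
  have hu : 0 < ((α + s : ℝ) : ℂ).re := by
    rw [Complex.ofReal_re]
    positivity
  have h1 := Complex.betaIntegral_eval_nat_add_one_right hu e
  have h2 : Complex.betaIntegral ((α + s : ℝ) : ℂ) (e + 1) =
      ((∫ t in Set.Icc (0 : ℝ) 1, t ^ s * (t ^ (α - 1) * (1 - t) ^ e) : ℝ) : ℂ) := by
    rw [Complex.betaIntegral, integral_Icc_eq_integral_Ioc,
      ← intervalIntegral.integral_of_le zero_le_one, ← intervalIntegral.integral_ofReal]
    refine intervalIntegral.integral_congr_ae (Filter.Eventually.of_forall fun t ht => ?_)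
    rw [Set.uIoc_of_le zero_le_one] at ht
    have h3 : ((α + s : ℝ) : ℂ) - 1 = ((s + (α - 1) : ℝ) : ℂ) := by push_cast; ring
    rw [h3, ← Complex.ofReal_cpow ht.1.le, add_sub_cancel_right, Complex.cpow_natCast,
      Real.rpow_add ht.1, Real.rpow_natCast]
    push_cast
    ring
  rw [h2] at h1
  have h4 : ((∫ t in Set.Icc (0 : ℝ) 1, t ^ s * (t ^ (α - 1) * (1 - t) ^ e) : ℝ) : ℂ) =
      ((e.factorial / ∏ j ∈ Finset.range (e + 1), (α + s + j) : ℝ) : ℂ) := by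
    rw [h1]
    push_cast
    rfl
  exact_mod_cast h4

/-- The product of the factors `α + s + l`, `0 ≤ l < M`. -/
def risingProd (α : ℝ) (M : ℕ) (s : ℝ) : ℝ := ∏ l ∈ Finset.range M, (α + s + l)

theorem risingProd_pos {α : ℝ} (hα : 0 < α) (M : ℕ) (s : ℕ) : 0 < risingProd α M s :=
  Finset.prod_pos fun l _ => by positivity

theorem natDegree_prod_X_add_C_le (s : Finset ℕ) (f : ℕ → ℝ) :
    (∏ l ∈ s, (Polynomial.X + Polynomial.C (f l))).natDegree ≤ s.card := by
  refine (Polynomial.natDegree_prod_le _ _).trans ?_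
  simp

/-- The integral is (-1)^τ e! divided by the factors α + s + l, τ ≤ l ≤ τ + e, all of which occur in
`risingProd α M s`. The M - e - 1 < N linear factors left over form P. -/
theorem exists_poly_beta {α : ℝ} (hα : 0 < α) {M e τ N : ℕ} (hτ : τ + e < M) (hN : M ≤ N + e) :
    ∃ P : Polynomial ℝ, P.natDegree < N ∧ ∀ s : ℕ, P.eval (s : ℝ) = risingProd α M s *
      ∫ t in Set.Icc (0 : ℝ) 1, t ^ s * ((-t) ^ τ * (t ^ (α - 1) * (1 - t) ^ e)) := by
  set I : Finset ℕ := Finset.Ico τ (τ + (e + 1)) with hI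
  have hIM : I ⊆ Finset.range M := fun l hl => by
    rw [hI, Finset.mem_Ico] at hl
    rw [Finset.mem_range]
    omega
  refine ⟨Polynomial.C ((-1 : ℝ) ^ τ * e.factorial) *
    ∏ l ∈ Finset.range M \ I, (Polynomial.X + Polynomial.C (α + l)), ?_, fun s => ?_⟩
  · refine (Polynomial.natDegree_C_mul_le _ _).trans_lt
      ((natDegree_prod_X_add_C_le _ fun l => α + l).trans_lt ?_)
    rw [Finset.card_sdiff_of_subset hIM, Finset.card_range, hI, Nat.card_Ico]
    omega
  · have h1 : ∀ t : ℝ, t ^ s * ((-t) ^ τ * (t ^ (α - 1) * (1 - t) ^ e)) =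
        (-1) ^ τ * (t ^ (s + τ) * (t ^ (α - 1) * (1 - t) ^ e)) := fun t => by
      rw [neg_pow, pow_add]
      ring
    simp only [h1]
    rw [integral_const_mul, integral_pow_mul_rpow_mul_pow hα, risingProd,
      ← Finset.prod_sdiff hIM, Polynomial.eval_mul, Polynomial.eval_C, Polynomial.eval_prod]
    have h2 : ∏ l ∈ I, (α + s + l) = ∏ j ∈ Finset.range (e + 1), (α + ((s + τ : ℕ) : ℝ) + j) := by
      rw [hI, Finset.prod_Ico_eq_prod_range]
      refine Finset.prod_congr (by congr 1; omega) fun j _ => ?_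
      push_cast
      ring
    have h3 : ∏ j ∈ Finset.range (e + 1), (α + ((s + τ : ℕ) : ℝ) + j) ≠ 0 :=
      Finset.prod_ne_zero_iff.2 fun j _ => by positivity
    have h4 : ∏ l ∈ Finset.range M \ I,
        Polynomial.eval (s : ℝ) (Polynomial.X + Polynomial.C (α + l)) =
        ∏ l ∈ Finset.range M \ I, (α + s + l) :=
      Finset.prod_congr rfl fun l _ => by
        simp only [Polynomial.eval_add, Polynomial.eval_X, Polynomial.eval_C]
        ring
    rw [h4, h2]
    field_simp

end Beta

end JacobiProduct


/-! ### The Jacobi average of a Schur polynomial. -/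

namespace JacobiProduct

open MeasureTheory MvPolynomial

section JacobiIntegral

variable {K n : ℕ}

/-- The determinant which represents a Schur polynomial at a point with `K` coordinates `1`. -/
noncomputable def schurDet (κ : Fin (K + n) → ℕ) (x : Fin n → ℝ) : ℝ :=
  (stackRows (fun (i : Fin K) l => (expo κ l : ℝ) ^ (i : ℕ)) (fun i l => x i ^ expo κ l)).det

/-- Scaling column l by `risingProd` makes all its entries polynomials in the exponent of degree
below K + n, so the determinant is a constant times the Vandermonde product. In the upper rows the
degree is less than K + M, which is why M ≤ n is required unless there are no such rows. -/
theorem exists_integral_det_eq {α : ℝ} (hα : 0 < α) {M e : ℕ} (hτ : ∀ τ < n, τ + e < M)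
    (hN : M ≤ K + n + e) (hK : K = 0 ∨ M ≤ n) (τ : Fin n → Fin n) :
    ∃ C : ℝ, ∀ κ : Fin (K + n) → ℕ, (∏ l, risingProd α M (expo κ l)) *
      (stackRows (fun (i : Fin K) l => (expo κ l : ℝ) ^ (i : ℕ)) fun i l =>
        ∫ t in Set.Icc (0 : ℝ) 1, t ^ expo κ l *
          ((-t) ^ (τ i : ℕ) * (t ^ (α - 1) * (1 - t) ^ e))).det =
      C * vander fun l => (expo κ l : ℝ) := by
  choose Q hQdeg hQ using fun i : Fin n => exists_poly_beta hα (hτ _ (τ i).2) hN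
  set P : Fin (K + n) → Polynomial ℝ := fun i => Fin.addCases
    (fun i : Fin K => Polynomial.X ^ (i : ℕ) *
      ∏ l ∈ Finset.range M, (Polynomial.X + Polynomial.C (α + l))) Q i with hP
  have hdeg : ∀ i, (P i).natDegree < K + n := by
    intro i
    refine Fin.addCases (fun i => ?_) (fun i => ?_) i
    · simp only [hP, Fin.addCases_left]
      refine Polynomial.natDegree_mul_le.trans_lt ?_
      have h1 := natDegree_prod_X_add_C_le (Finset.range M) fun l => α + l
      rw [Finset.card_range] at h1
      rw [Polynomial.natDegree_X_pow]
      have h2 := i.2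
      rcases hK with rfl | hK
      · omega
      · omega
    · simpa [hP] using hQdeg i
  obtain ⟨C, hC⟩ := exists_det_eval_eq_mul_vander P hdeg
  refine ⟨C, fun κ => ?_⟩
  rw [← hC, ← Matrix.det_mul_row]
  congr 1
  ext i l
  refine Fin.addCases (fun i => ?_) (fun i => ?_) i
  · simp only [stackRows, Matrix.of_apply, Fin.addCases_left, hP, Polynomial.eval_mul,
      Polynomial.eval_pow, Polynomial.eval_X, Polynomial.eval_prod, Polynomial.eval_add,
      Polynomial.eval_C]
    rw [mul_comm, risingProd]
    congr 1
    exact Finset.prod_congr rfl fun l _ => by ring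
  · simp only [stackRows, Matrix.of_apply, Fin.addCases_right, hP, hQ]

/-- The Vandermonde factor is expanded over permutations and each monomial is absorbed into the
rows, which makes the integrand a sum of determinants with separated variables. -/
theorem exists_integral_cube_eq {α : ℝ} (hα : 0 < α) {M e : ℕ} (hτ : ∀ τ < n, τ + e < M)
    (hN : M ≤ K + n + e) (hK : K = 0 ∨ M ≤ n) :
    ∃ C : ℝ, ∀ κ : Fin (K + n) → ℕ,
      IntegrableOn (fun x => schurDet κ x * diffProd x *
        ∏ i, (x i ^ (α - 1) * (1 - x i) ^ e)) (Set.Icc 0 1) ∧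
      (∏ l, risingProd α M (expo κ l)) * ∫ x in Set.Icc (0 : Fin n → ℝ) 1, schurDet κ x *
        diffProd x * ∏ i, (x i ^ (α - 1) * (1 - x i) ^ e) =
      C * vander fun l => (expo κ l : ℝ) := by
  choose C hC using fun τ : Equiv.Perm (Fin n) => exists_integral_det_eq (K := K) hα hτ hN hK τ
  refine ⟨∑ τ : Equiv.Perm (Fin n), ((Equiv.Perm.sign τ : ℤ) : ℝ) * C τ, fun κ => ?_⟩
  have hexp : ∀ x : Fin n → ℝ,
      schurDet κ x * diffProd x * ∏ i, (x i ^ (α - 1) * (1 - x i) ^ e) =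
      ∑ τ : Equiv.Perm (Fin n), ((Equiv.Perm.sign τ : ℤ) : ℝ) *
        (stackRows (fun (i : Fin K) l => (expo κ l : ℝ) ^ (i : ℕ)) fun i l => x i ^ expo κ l *
          ((-x i) ^ (τ i : ℕ) * (x i ^ (α - 1) * (1 - x i) ^ e))).det := by
    intro x
    rw [diffProd_eq_sum, Finset.mul_sum, Finset.sum_mul]
    refine Finset.sum_congr rfl fun τ _ => ?_
    have h1 := det_stackRows_mul (fun _ => 1)
      (fun i => (-x i) ^ (τ i : ℕ) * (x i ^ (α - 1) * (1 - x i) ^ e))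
      (fun (i : Fin K) l => (expo κ l : ℝ) ^ (i : ℕ)) fun i l => x i ^ expo κ l
    simp only [one_mul, Finset.prod_const_one] at h1
    simp only [mul_comm (x _ ^ expo κ _), h1]
    simp only [Finset.prod_mul_distrib, schurDet]
    ring
  have hint : ∀ (τ : Equiv.Perm (Fin n)) (i : Fin n) (l : Fin (K + n)),
      IntegrableOn (fun t : ℝ => t ^ expo κ l *
        ((-t) ^ (τ i : ℕ) * (t ^ (α - 1) * (1 - t) ^ e))) (Set.Icc 0 1) := fun τ i l => by
    have := IntegrableOn.continuousOn_mul (g := fun t : ℝ => t ^ expo κ l * (-t) ^ (τ i : ℕ))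
      (by fun_prop) (integrableOn_rpow_mul_pow hα e) isCompact_Icc
    simpa only [mul_assoc] using this
  simp only [hexp]
  refine ⟨integrable_finsetSum _ fun τ _ =>
    (integral_det_stackRows _ (hint τ)).1.const_mul _, ?_⟩
  rw [integral_finsetSum _ fun τ _ => (integral_det_stackRows _ (hint τ)).1.const_mul _,
    Finset.mul_sum, Finset.sum_mul]
  refine Finset.sum_congr rfl fun τ _ => ?_
  rw [integral_const_mul, (integral_det_stackRows _ (hint τ)).2, mul_left_comm, hC τ κ]
  ring

/-- One of the two Vandermonde factors of the weight and the K-th power of 1 - x_i turn the Schur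
polynomial into `schurDet`. The other factor and the power e remain in the integrand. -/
theorem exists_integral_ordered_eq {α : ℝ} (hα : 0 < α) {M e : ℕ} (hτ : ∀ τ < n, τ + e < M)
    (hN : M ≤ K + n + e) (hK : K = 0 ∨ M ≤ n) :
    ∃ C : ℝ, ∀ κ : Fin (K + n) → ℕ, (∏ l, risingProd α M (expo κ l)) *
      ∫ x in orderedCube n, ((∏ i, ∏ j ∈ Finset.Ioi i, |x i - x j| ^ 2) *
        ∏ i, (x i ^ (α - 1) * (1 - x i) ^ (K + e))) * eval (Fin.append 1 x) (schur κ) =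
      C * vander fun l => (expo κ l : ℝ) := by
  obtain ⟨C, hC⟩ := exists_integral_cube_eq hα hτ hN hK
  set d : ℝ := diffProd fun i : Fin K => (i : ℝ) with hd
  have hd0 : d ≠ 0 := diffProd_natCast_ne_zero K
  refine ⟨C / (n.factorial * d), fun κ => ?_⟩
  set G : (Fin n → ℝ) → ℝ := fun x => schurDet κ x * diffProd x *
    ∏ i, (x i ^ (α - 1) * (1 - x i) ^ e) with hG
  have hpt : ∀ x : Fin n → ℝ, ((∏ i, ∏ j ∈ Finset.Ioi i, |x i - x j| ^ 2) *
      ∏ i, (x i ^ (α - 1) * (1 - x i) ^ (K + e))) * eval (Fin.append 1 x) (schur κ) =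
      d⁻¹ * G x := by
    intro x
    have h1 := eval_schur_append κ x
    have h2 : ∏ i, ∏ j ∈ Finset.Ioi i, |x i - x j| ^ 2 = diffProd x ^ 2 := by
      simp only [sq_abs, diffProd, ← Finset.prod_pow]
    rw [eq_inv_mul_iff_mul_eq₀ hd0, h2]
    simp only [hG]
    rw [schurDet, ← h1, ← hd]
    simp only [pow_add, Finset.prod_mul_distrib]
    ring
  have hsymm : ∀ (σ : Equiv.Perm (Fin n)) x, G (x ∘ σ) = G x := by
    intro σ x
    have h1 : schurDet κ (x ∘ σ) = Equiv.Perm.sign σ * schurDet κ x :=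
      det_stackRows_comp_perm _ (fun i l => x i ^ expo κ l) σ
    have h2 : ∏ i, ((x ∘ σ) i ^ (α - 1) * (1 - (x ∘ σ) i) ^ e) =
        ∏ i, (x i ^ (α - 1) * (1 - x i) ^ e) :=
      Equiv.prod_comp σ fun i => x i ^ (α - 1) * (1 - x i) ^ e
    have h3 : (((Equiv.Perm.sign σ : ℤ) : ℝ)) * ((Equiv.Perm.sign σ : ℤ) : ℝ) = 1 := by
      rw [← Int.cast_mul, ← Units.val_mul, Int.units_mul_self]
      simp
    simp only [hG]
    rw [h1, h2, diffProd_comp_perm]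
    linear_combination (schurDet κ x * diffProd x * ∏ i, (x i ^ (α - 1) * (1 - x i) ^ e)) * h3
  have hzero : ∀ x, ¬ Function.Injective x → G x = 0 := fun x hx => by
    simp only [hG, diffProd_eq_zero hx, mul_zero, zero_mul]
  have hord := integral_orderedCube hsymm hzero (hC κ).1
  have hfac : (n.factorial : ℝ) ≠ 0 := by positivity
  simp only [hpt]
  rw [integral_const_mul, div_mul_eq_mul_div, ← (hC κ).2, ← hord]
  field_simp

/-- `∏_l (α + λ_l)_M`, where `λ_l = κ_l + N - l`. -/
noncomputable def risingExpo (α : ℝ) (M : ℕ) {N : ℕ} (κ : Fin N → ℕ) : ℝ :=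
  ∏ l, risingProd α M (expo κ l)

theorem risingExpo_pos {α : ℝ} (hα : 0 < α) (M : ℕ) {N : ℕ} (κ : Fin N → ℕ) :
    0 < risingExpo α M κ :=
  Finset.prod_pos fun _ _ => risingProd_pos hα M _

theorem measurable_padOnes (M N : ℕ) : Measurable (padOnes M N) := by
  refine measurable_pi_iff.2 fun i => ?_
  unfold padOnes
  split_ifs
  · exact measurable_pi_apply _
  · exact measurable_const

theorem measurable_jacobiWeight (α : ℝ) (M N : ℕ) : Measurable (jacobiWeight α M N) := by
  unfold jacobiWeight
  fun_prop

theorem jacobiWeight_nonneg (α : ℝ) {M N : ℕ} {x : Fin (min M N) → ℝ}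
    (hx : x ∈ orderedCube (min M N)) : 0 ≤ jacobiWeight α M N x := by
  refine mul_nonneg (Finset.prod_nonneg fun i _ => Finset.prod_nonneg fun j _ => by positivity)
    (Finset.prod_nonneg fun i _ => mul_nonneg (Real.rpow_nonneg (hx.2 i).1 _) ?_)
  exact pow_nonneg (sub_nonneg.2 (hx.2 i).2) _

theorem integral_jacobiEnsemble (α : ℝ) (M N : ℕ) {f : (Fin N → ℝ) → ℝ} (hf : Measurable f) :
    ∫ w, f w ∂(jacobiEnsemble α M N) = ((jacobiMass α M N Set.univ)⁻¹).toReal *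
      ∫ x in orderedCube (min M N), jacobiWeight α M N x * f (padOnes M N x) := by
  rw [jacobiEnsemble, integral_map (measurable_padOnes M N).aemeasurable
    hf.aestronglyMeasurable, integral_smul_measure, jacobiMass,
    integral_withDensity_eq_integral_toReal_smul
      (measurable_jacobiWeight α M N).ennreal_ofReal (by simp)]
  rw [smul_eq_mul]
  congr 1
  refine setIntegral_congr_fun (measurableSet_orderedCube _) fun x hx => ?_
  simp only [smul_eq_mul]
  rw [ENNReal.toReal_ofReal (jacobiWeight_nonneg α hx)]

theorem measurable_eval_schur {N : ℕ} (κ : Fin N → ℕ) :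
    Measurable fun w : Fin N → ℝ => eval w (schur κ) :=
  (MvPolynomial.continuous_eval _).measurable

theorem exists_integral_eval_schur {α : ℝ} (hα : 0 < α) (M : ℕ) (N : ℕ) :
    ∃ C : ℝ, ∀ κ : Fin N → ℕ, risingExpo α M κ * ∫ w, eval w (schur κ) ∂(jacobiEnsemble α M N) =
      C * vander fun l => (expo κ l : ℝ) := by
  -- It is applied with n = min(M, N), K = N - n and e = M - N truncated at 0, so that K + e = |M -
  -- N|. The equation N = K + n is a hypothesis so that it can be substituted.
  have hgen : ∀ (n K N : ℕ) (h : N = K + n) (e : ℕ) (pad : (Fin n → ℝ) → Fin N → ℝ),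
      (∀ x, pad x ∘ Fin.cast h.symm = Fin.append 1 x) → (∀ τ < n, τ + e < M) →
      M ≤ K + n + e → (K = 0 ∨ M ≤ n) →
      ∃ C : ℝ, ∀ κ : Fin N → ℕ, risingExpo α M κ *
        ∫ x in orderedCube n, ((∏ i, ∏ j ∈ Finset.Ioi i, |x i - x j| ^ 2) *
          ∏ i, (x i ^ (α - 1) * (1 - x i) ^ (K + e))) * eval (pad x) (schur κ) =
        C * vander fun l => (expo κ l : ℝ) := by
    rintro n K N rfl e pad hpad h1 h2 h3
    obtain ⟨C, hC⟩ := exists_integral_ordered_eq hα h1 h2 h3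
    refine ⟨C, fun κ => ?_⟩
    rw [← hC κ, risingExpo]
    simp only [← hpad]
    rfl
  obtain ⟨C, hC⟩ := hgen (min M N) (N - min M N) N (by omega) (M - N) (padOnes M N) (fun x => by
    funext i
    refine Fin.addCases (fun i => ?_) (fun i => ?_) i
    · have hi : ¬ N - min M N ≤ (i : ℕ) := not_le.2 i.2
      simp only [Function.comp_apply, padOnes, Fin.val_cast, Fin.val_castAdd, hi, dite_false,
        Fin.append_left, Pi.one_apply]
    · simp [padOnes]) (fun τ hτ => by omega) (by omega) (by omega)
  refine ⟨((jacobiMass α M N Set.univ)⁻¹).toReal * C, fun κ => ?_⟩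
  rw [integral_jacobiEnsemble α M N (measurable_eval_schur κ), mul_left_comm, mul_assoc, ← hC κ]
  congr 2
  have hexp : ((M : ℤ) - (N : ℤ)).natAbs = N - min M N + (M - N) := by omega
  simp only [jacobiWeight, hexp]

/-- The expectation of a Schur polynomial with respect to the Jacobi ensemble. -/
theorem integral_eval_schur_jacobiEnsemble {α : ℝ} (hα : 0 < α) (M : ℕ) {N : ℕ}
    (h : (jacobiEnsemble α M N).real Set.univ = 1) (κ : Fin N → ℕ) :
    ∫ w, eval w (schur κ) ∂(jacobiEnsemble α M N) =
      risingExpo α M (0 : Fin N → ℕ) / risingExpo α M κ * eval 1 (schur κ) := by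
  obtain ⟨C, hC⟩ := exists_integral_eval_schur hα M N
  -- The case κ = 0, where the Schur polynomial is 1, determines the constant without evaluating a
  -- Selberg integral.
  have h0 := hC 0
  simp only [schur_zero, map_one, integral_const, h, smul_eq_mul, mul_one] at h0
  have h1 := hC κ
  rw [← eval_one_schur κ] at h1
  have hpos := (risingExpo_pos hα M κ).ne'
  field_simp
  rw [mul_comm, h1, h0]
  ring

end JacobiIntegral

end JacobiProduct


/-! ### Schur moments of the law of v ⊠ w. -/

namespace JacobiProduct

open MeasureTheory MvPolynomial

section BoxLaw

variable {N : ℕ}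

theorem eval_one_schur_ne_zero {κ : Fin N → ℕ} (hκ : Function.Injective (expo κ)) :
    eval 1 (schur κ) ≠ 0 := by
  intro h
  have h1 := eval_one_schur κ
  rw [h, zero_mul, eq_comm] at h1
  exact vander_ne_zero.2 (Nat.cast_injective.comp hκ) h1

theorem expo_injective_of_antitone {κ : Fin N → ℕ} (hκ : Antitone κ) :
    Function.Injective (expo κ) := by
  refine StrictAnti.injective fun i j hij => ?_
  have h1 := hκ hij.le
  have h2 : (i : ℕ) < j := hij
  have h3 := j.2
  simp only [expo]
  omega

theorem risingExpo_comp_perm (α : ℝ) (M : ℕ) {κ μ : Fin N → ℕ} {σ : Equiv.Perm (Fin N)}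
    (h : expo κ = expo μ ∘ σ) : risingExpo α M κ = risingExpo α M μ := by
  rw [risingExpo, risingExpo, h]
  exact Equiv.prod_comp σ fun l => risingProd α M (expo μ l)

/-- The expectation of a Schur polynomial with respect to the law of `v ⊠ w`. -/
theorem IsBoxLaw.integral_eval_schur {α : ℝ} (hα : 0 < α) {M : ℕ} {v : Fin N → ℝ}
    {ν : Measure (Fin N → ℝ)} (h : IsBoxLaw α M v ν) (κ : Fin N → ℕ) :
    ∫ u, eval u (schur κ) ∂ν =
      risingExpo α M (0 : Fin N → ℕ) / risingExpo α M κ * eval v (schur κ) := by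
  have := h.isProb
  -- The moment identity for κ = 0 already forces the Jacobi ensemble to have total mass 1.
  have htot : (jacobiEnsemble α M N).real Set.univ = 1 := by
    have h0 := h.moments 0 antitone_const
    simpa [normSchur, schur_zero] using h0.symm
  have hpart : ∀ μ : Fin N → ℕ, Antitone μ → ∫ u, eval u (schur μ) ∂ν =
      risingExpo α M (0 : Fin N → ℕ) / risingExpo α M μ * eval v (schur μ) := by
    intro μ hμ
    have h1 := h.moments μ hμ
    have h2 := eval_one_schur_ne_zero (expo_injective_of_antitone hμ)
    simp only [normSchur] at h1
    rw [integral_div, integral_div, integral_eval_schur_jacobiEnsemble hα M htot μ] at h1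
    field_simp at h1 ⊢
    exact h1
  -- Distinct exponents reduce to a partition up to sign, and `risingExpo` is symmetric in the
  -- exponents; for repeated exponents both sides vanish.
  by_cases hκ : Function.Injective (expo κ)
  · obtain ⟨μ, σ, hμ, hσ⟩ := exists_partition hκ
    rw [schur_eq_sign_mul hσ, risingExpo_comp_perm α M hσ]
    simp only [map_mul, map_intCast]
    rw [integral_const_mul, hpart μ hμ]
    ring
  · simp [schur_eq_zero hκ]

end BoxLaw

/-! ### Conditional expectations from conditional probabilities. -/

section ConditionalExpectation

/-- If the conditional probabilities of `Y` are given by a family of measures, then so are the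
conditional expectations. -/
theorem condExp_ae_eq_integral {Ω E : Type*} {m mΩ : MeasurableSpace Ω} {P : Measure Ω}
    [IsProbabilityMeasure P] [MeasurableSpace E] [StandardBorelSpace E] [Nonempty E] (hm : m ≤ mΩ)
    {Y : Ω → E} (hY : Measurable Y) {ν : Ω → Measure E}
    (hν : ∀ᵐ ω ∂P, IsProbabilityMeasure (ν ω))
    (h : ∀ B, MeasurableSet B → P⟦Y ⁻¹' B | m⟧ =ᵐ[P] fun ω => (ν ω).real B) {f : E → ℝ}
    (hf : StronglyMeasurable f) (hint : Integrable (fun ω => f (Y ω)) P) :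
    P[fun ω => f (Y ω) | m] =ᵐ[P] fun ω => ∫ x, f x ∂(ν ω) := by
  have hid : @Measurable Ω Ω mΩ m (fun ω => ω) := measurable_id'' hm
  have hcomap : MeasurableSpace.comap (fun ω : Ω => ω) m = m := MeasurableSpace.comap_id
  have h1 := ProbabilityTheory.condExp_ae_eq_integral_condDistrib (mβ := m) hid hY.aemeasurable
    hf hint
  rw [hcomap] at h1
  -- No measurability of ν in ω is assumed. A countable algebra generating the σ-algebra lets ν be
  -- identified with the regular conditional distribution outside of a single null set.
  set C := generateSetAlgebra (MeasurableSpace.countableGeneratingSet E) with hC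
  have hCc : C.Countable :=
    countable_generateSetAlgebra MeasurableSpace.countable_countableGeneratingSet
  have hgen : ‹MeasurableSpace E› = MeasurableSpace.generateFrom C := by
    rw [hC, generateFrom_generateSetAlgebra_eq]
    exact MeasurableSpace.generateFrom_countableGeneratingSet.symm
  have halg : IsSetAlgebra C := isSetAlgebra_generateSetAlgebra
  have hall : ∀ᵐ ω ∂P, ∀ B ∈ C,
      (@ProbabilityTheory.condDistrib Ω Ω E _ _ _ mΩ m Y (fun ω => ω) P _ ω).real B =
        (ν ω).real B := by
    rw [ae_ball_iff hCc]
    intro B hB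
    have hBm : MeasurableSet B := by
      rw [hgen]
      exact MeasurableSpace.measurableSet_generateFrom hB
    have h2 := ProbabilityTheory.condDistrib_ae_eq_condExp (mβ := m) (μ := P) hid hY hBm
    rw [hcomap] at h2
    exact h2.trans (h B hBm)
  filter_upwards [h1, hall, hν] with ω hω1 hω2 hω3
  rw [hω1]
  congr 1
  refine ext_of_generate_finite C hgen (fun s hs t ht _ => halg.inter_mem hs ht)
    (fun B hB => ?_) (by simp)
  exact (measureReal_eq_measureReal_iff).1 (hω2 B hB)

end ConditionalExpectation

section PowerSums

variable {Ω : Type*} {N : ℕ}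

/-- The product of the power sums of the process. -/
noncomputable def powerSums (y : ℕ → Ω → Fin N → ℝ) {m : ℕ} (T : Fin m → ℕ) (c : Fin m → ℝ)
    (ω : Ω) : ℝ := ∏ i, ∑ k, (y (T i) ω k) ^ (c i)

theorem measurable_powerSums {mΩ : MeasurableSpace Ω} {y : ℕ → Ω → Fin N → ℝ} {m : ℕ}
    {T : Fin m → ℕ} (h : ∀ i, Measurable (y (T i))) (c : Fin m → ℝ) :
    Measurable (powerSums y T c) :=
  Finset.measurable_fun_prod _ fun i _ => Finset.measurable_fun_sum _ fun k _ =>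
    (measurable_pi_iff.1 (h i) k).pow_const (c i)

theorem measurable_history (y : ℕ → Ω → Fin N → ℝ) {s T : ℕ} (hs : 1 ≤ s) (hsT : s ≤ T) :
    Measurable[history y T] (y s) :=
  (comap_measurable (y s)).mono
    (le_iSup₂_of_le s (Finset.mem_Icc.2 ⟨hs, hsT⟩) le_rfl) le_rfl

end PowerSums

/-! ### The normalizing factors along the chain. -/

section RisingRatio

variable {N : ℕ} {α : ℕ → ℝ}

/-- `∏_{τ ≤ T} ∏_l (α_τ + λ_l)_{M_τ} / (α_τ + N - l)_{M_τ}`, where `λ_l = κ_l + N - l`. -/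
noncomputable def risingRatio (α : ℕ → ℝ) (M : ℕ → ℕ) (T : ℕ) {N : ℕ} (κ : Fin N → ℕ) : ℝ :=
  ∏ τ ∈ Finset.Icc 1 T, (risingExpo (α τ) (M τ) κ / risingExpo (α τ) (M τ) (0 : Fin N → ℕ))

theorem risingRatio_pos (hα : ∀ τ, 1 ≤ τ → 0 < α τ) (M : ℕ → ℕ) (T : ℕ) (κ : Fin N → ℕ) :
    0 < risingRatio α M T κ :=
  Finset.prod_pos fun τ hτ => div_pos (risingExpo_pos (hα τ (Finset.mem_Icc.1 hτ).1) _ _)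
    (risingExpo_pos (hα τ (Finset.mem_Icc.1 hτ).1) _ _)

theorem prod_Icc_one_eq_prod_range (f : ℕ → ℂ) (M : ℕ) :
    ∏ l ∈ Finset.Icc 1 M, f l = ∏ l ∈ Finset.range M, f (l + 1) := by
  rw [Finset.range_eq_Ico, Finset.prod_Ico_add' f 0 M 1]
  refine Finset.prod_congr ?_ fun _ _ => rfl
  ext l
  simp only [Finset.mem_Icc, Finset.mem_Ico]
  omega

/-- Only the factor with index j changes between κ and κ + c e_j. At u = -c - λ_j the numerators and
denominators of the integrand are its linear factors up to a common sign. -/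
theorem jacobiFactor_eq (hα : ∀ τ, 1 ≤ τ → 0 < α τ) (M : ℕ → ℕ) (T : ℕ) (κ : Fin N → ℕ) (j : Fin N)
    (c : ℕ) : jacobiFactor α M T c (-(c : ℂ) - (expo κ j : ℂ)) =
      ((risingRatio α M T κ / risingRatio α M T (κ + Pi.single j c) : ℝ) : ℂ) := by
  rw [risingRatio, risingRatio, ← Finset.prod_div_distrib, jacobiFactor, Complex.ofReal_prod]
  refine Finset.prod_congr rfl fun τ hτ => ?_
  have hατ := hα τ (Finset.mem_Icc.1 hτ).1
  have h1 : risingExpo (α τ) (M τ) κ = risingProd (α τ) (M τ) (expo κ j) *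
      ∏ l ∈ Finset.univ.erase j, risingProd (α τ) (M τ) (expo κ l) :=
    (Finset.mul_prod_erase _ _ (Finset.mem_univ j)).symm
  have h2 : risingExpo (α τ) (M τ) (κ + Pi.single j c) =
      risingProd (α τ) (M τ) (expo κ j + c) *
        ∏ l ∈ Finset.univ.erase j, risingProd (α τ) (M τ) (expo κ l) := by
    rw [risingExpo, ← Finset.mul_prod_erase _ _ (Finset.mem_univ j), expo_add_single]
    congr 1
    · simp
    · refine Finset.prod_congr rfl fun l hl => ?_
      simp [Pi.single_eq_of_ne (Finset.ne_of_mem_erase hl)]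
  have h3 : (∏ l ∈ Finset.univ.erase j, risingProd (α τ) (M τ) (expo κ l)) ≠ 0 :=
    Finset.prod_ne_zero_iff.2 fun l _ => (risingProd_pos hατ _ _).ne'
  have h4 := (risingExpo_pos hατ (M τ) (0 : Fin N → ℕ)).ne'
  have h5 : risingProd (α τ) (M τ) (expo κ j + c) ≠ 0 := by
    have := (risingProd_pos hατ (M τ) (expo κ j + c)).ne'
    push_cast at this
    exact this
  have h6 : risingExpo (α τ) (M τ) κ / risingExpo (α τ) (M τ) (0 : Fin N → ℕ) /
      (risingExpo (α τ) (M τ) (κ + Pi.single j c) / risingExpo (α τ) (M τ) (0 : Fin N → ℕ)) =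
      risingProd (α τ) (M τ) (expo κ j) / risingProd (α τ) (M τ) (expo κ j + c) := by
    rw [h1, h2]
    field_simp
  rw [h6, risingProd, risingProd, ← Finset.prod_div_distrib, Complex.ofReal_prod,
    prod_Icc_one_eq_prod_range]
  refine Finset.prod_congr rfl fun l _ => ?_
  push_cast
  rw [← neg_div_neg_eq]
  congr 1 <;> ring

end RisingRatio

/-! ### Integer moments of the process. -/

namespace IsJacobiProductProcess

variable {Ω : Type*} [mΩ : MeasurableSpace Ω] {P : Measure Ω} {N : ℕ}
  {α : ℕ → ℝ} {M : ℕ → ℕ} {y : ℕ → Ω → Fin N → ℝ}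

theorem history_le (hy : IsJacobiProductProcess P α M y) (T : ℕ) : history y T ≤ mΩ :=
  iSup₂_le fun s hs => (hy.measurable s (Finset.mem_Icc.1 hs).1).comap_le

theorem exists_bound_eval (hy : IsJacobiProductProcess P α M y) {T : ℕ} (hT : 1 ≤ T)
    (p : MvPolynomial (Fin N) ℝ) : ∃ C, ∀ᵐ ω ∂P, |eval (y T ω) p| ≤ C := by
  obtain ⟨C, hC⟩ := (isCompact_Icc (a := (0 : Fin N → ℝ)) (b := 1)).exists_bound_of_continuousOn
    (MvPolynomial.continuous_eval p).continuousOn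
  refine ⟨C, ?_⟩
  filter_upwards [hy.mem_cube T hT] with ω hω
  exact hC _ ⟨fun i => (hω.2 i).1, fun i => (hω.2 i).2⟩

theorem measurable_eval (hy : IsJacobiProductProcess P α M y) {T : ℕ} (hT : 1 ≤ T)
    (p : MvPolynomial (Fin N) ℝ) : Measurable fun ω => eval (y T ω) p :=
  (MvPolynomial.continuous_eval p).measurable.comp (hy.measurable T hT)

theorem ae_abs_powerSums_le (hy : IsJacobiProductProcess P α M y) {m : ℕ} {T : Fin m → ℕ}
    (hT : ∀ i, 1 ≤ T i) {c : Fin m → ℝ} (hc : ∀ i, 0 < c i) :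
    ∀ᵐ ω ∂P, |powerSums y T c ω| ≤ (N : ℝ) ^ m := by
  filter_upwards [ae_all_iff.2 fun i => hy.mem_cube (T i) (hT i)] with ω hω
  rw [powerSums, Finset.abs_prod]
  refine (Finset.prod_le_prod (fun _ _ => abs_nonneg _) (g := fun _ => (N : ℝ)) fun i _ => ?_).trans
    (by simp)
  refine (Finset.abs_sum_le_sum_abs _ _).trans ((Finset.sum_le_sum (g := fun _ => (1 : ℝ))
    fun k _ => ?_).trans (by simp))
  have h := (hω i).2 k
  rw [abs_of_nonneg (Real.rpow_nonneg h.1 _)]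
  exact Real.rpow_le_one h.1 h.2 (hc i).le

variable [IsProbabilityMeasure P]

/-- The kernel is the zero measure when no box law exists. The transition identity for the whole
space gives it mass 1 almost surely, so that default almost surely does not occur. -/
theorem ae_isBoxLaw (hy : IsJacobiProductProcess P α M y) {T : ℕ} (hT : 1 ≤ T) :
    ∀ᵐ ω ∂P, IsBoxLaw (α (T + 1)) (M (T + 1)) (y T ω)
      (jacobiKernel (α (T + 1)) (M (T + 1)) (y T ω)) := by
  have h := hy.transition T hT Set.univ MeasurableSet.univ
  have h1 : P⟦y (T + 1) ⁻¹' Set.univ | history y T⟧ = fun _ => 1 := by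
    rw [Set.preimage_univ, Set.indicator_univ]
    exact condExp_const (hy.history_le T) 1
  rw [h1] at h
  filter_upwards [h] with ω hω
  by_cases hex : ∃ ν, IsBoxLaw (α (T + 1)) (M (T + 1)) (y T ω) ν
  · rw [jacobiKernel, dif_pos hex]
    exact hex.choose_spec
  · rw [jacobiKernel, dif_neg hex] at hω
    simp at hω

theorem integrable_of_bound {f : Ω → ℝ} (hf : Measurable f) {C : ℝ}
    (h : ∀ᵐ ω ∂P, |f ω| ≤ C) : Integrable f P :=
  Integrable.of_bound hf.aestronglyMeasurable C h

theorem integrable_eval_mul (hy : IsJacobiProductProcess P α M y) {T : ℕ} (hT : 1 ≤ T)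
    (p : MvPolynomial (Fin N) ℝ) {H : Ω → ℝ} (hH : Measurable H) {C : ℝ}
    (hC : ∀ᵐ ω ∂P, |H ω| ≤ C) : Integrable (fun ω => eval (y T ω) p * H ω) P := by
  obtain ⟨D, hD⟩ := hy.exists_bound_eval hT p
  refine integrable_of_bound ((hy.measurable_eval hT p).mul hH) (C := D * C) ?_
  filter_upwards [hC, hD] with ω h1 h2
  rw [abs_mul]
  exact mul_le_mul h2 h1 (abs_nonneg _) ((abs_nonneg _).trans h2)

/-- One step of the chain, tested against Schur polynomials. -/
theorem integral_eval_schur_succ (hα : ∀ τ, 1 ≤ τ → 0 < α τ)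
    (hy : IsJacobiProductProcess P α M y) {T : ℕ} (hT : 1 ≤ T) (κ : Fin N → ℕ) {H : Ω → ℝ}
    (hH : Measurable[history y T] H) {C : ℝ} (hC : ∀ᵐ ω ∂P, |H ω| ≤ C) :
    ∫ ω, eval (y (T + 1) ω) (schur κ) * H ω ∂P =
      risingExpo (α (T + 1)) (M (T + 1)) (0 : Fin N → ℕ) / risingExpo (α (T + 1)) (M (T + 1)) κ *
        ∫ ω, eval (y T ω) (schur κ) * H ω ∂P := by
  have hm := hy.history_le T
  have hT1 : 1 ≤ T + 1 := Nat.le_add_left 1 T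
  obtain ⟨D, hD⟩ := hy.exists_bound_eval hT1 (schur κ)
  have hint : Integrable (fun ω => eval (y (T + 1) ω) (schur κ)) P :=
    integrable_of_bound (hy.measurable_eval hT1 _) hD
  have hbox := hy.ae_isBoxLaw hT
  have hce := condExp_ae_eq_integral hm (hy.measurable _ hT1)
    (hbox.mono fun ω h => h.isProb) (hy.transition T hT)
    (MvPolynomial.continuous_eval (schur κ)).stronglyMeasurable hint
  have hmul := condExp_mul_of_stronglyMeasurable_right (f := fun ω => eval (y (T + 1) ω) (schur κ))
    hH.stronglyMeasurable (hy.integrable_eval_mul hT1 _ (hH.mono hm le_rfl) hC) hint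
  rw [← integral_condExp hm, ← integral_const_mul]
  refine integral_congr_ae ?_
  filter_upwards [hmul, hce, hbox] with ω h1 h2 h3
  refine h1.trans ?_
  rw [Pi.mul_apply, h2, h3.integral_eval_schur (hα _ hT1)]
  ring

/-- In effect, `risingRatio α M T κ` times s_κ(y^(T)) is a martingale in T. -/
theorem risingRatio_mul_integral (hα : ∀ τ, 1 ≤ τ → 0 < α τ)
    (hy : IsJacobiProductProcess P α M y) {S : ℕ} (hS : 1 ≤ S) {T : ℕ} (hST : S ≤ T)
    (κ : Fin N → ℕ) {H : Ω → ℝ} (hH : Measurable[history y S] H) {C : ℝ}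
    (hC : ∀ᵐ ω ∂P, |H ω| ≤ C) :
    risingRatio α M T κ * ∫ ω, eval (y T ω) (schur κ) * H ω ∂P =
      risingRatio α M S κ * ∫ ω, eval (y S ω) (schur κ) * H ω ∂P := by
  induction T, hST using Nat.le_induction with
  | base => rfl
  | succ T hST ih =>
    have hmono : history y S ≤ history y T :=
      biSup_mono fun s hs => by
        rw [Finset.mem_Icc] at hs ⊢
        exact ⟨hs.1, hs.2.trans hST⟩
    have h1 := (risingExpo_pos (hα (T + 1) (by omega)) (M (T + 1)) κ).ne'
    have h2 := (risingExpo_pos (hα (T + 1) (by omega)) (M (T + 1)) (0 : Fin N → ℕ)).ne'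
    rw [← ih, hy.integral_eval_schur_succ hα (hS.trans hST) κ (hH.mono hmono le_rfl) hC,
      risingRatio, Finset.prod_Icc_succ_top (by omega), ← risingRatio]
    field_simp

theorem risingRatio_mul_integral_eval_schur (hα : ∀ τ, 1 ≤ τ → 0 < α τ)
    (hy : IsJacobiProductProcess P α M y) {T : ℕ} (hT : 1 ≤ T) (κ : Fin N → ℕ) :
    risingRatio α M T κ * ∫ ω, eval (y T ω) (schur κ) ∂P = eval 1 (schur κ) := by
  have h1 := hy.risingRatio_mul_integral hα le_rfl hT κ (H := fun _ => 1) measurable_const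
    (C := 1) (by simp)
  simp only [mul_one] at h1
  have h2 : ∫ ω, eval (y 1 ω) (schur κ) ∂P =
      ∫ w, eval w (schur κ) ∂(jacobiEnsemble (α 1) (M 1) N) := by
    rw [← hy.initial, integral_map (hy.measurable 1 le_rfl).aemeasurable
      (MvPolynomial.continuous_eval _).aestronglyMeasurable]
  have h3 : (jacobiEnsemble (α 1) (M 1) N).real Set.univ = 1 := by
    rw [← hy.initial]
    have := Measure.isProbabilityMeasure_map (μ := P) (hy.measurable 1 le_rfl).aemeasurable
    simp
  have h4 := (risingExpo_pos (hα 1 le_rfl) (M 1) κ).ne'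
  have h5 := (risingExpo_pos (hα 1 le_rfl) (M 1) (0 : Fin N → ℕ)).ne'
  rw [h1, h2, integral_eval_schur_jacobiEnsemble (hα 1 le_rfl) _ h3, risingRatio,
    Finset.Icc_self, Finset.prod_singleton]
  field_simp

/-- The joint moments of the power sums for integer exponents. -/
theorem risingRatio_mul_integral_powerSums (hα : ∀ τ, 1 ≤ τ → 0 < α τ)
    (hy : IsJacobiProductProcess P α M y) {m : ℕ} {T : Fin m → ℕ} (hT : Antitone T)
    (hT1 : ∀ i, 1 ≤ T i) {c : Fin m → ℕ} (hc : ∀ i, 0 < c i) {S : ℕ} (hS : 1 ≤ S)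
    (hTS : ∀ i, T i ≤ S) (κ : Fin N → ℕ) :
    ((risingRatio α M S κ * ∫ ω, eval (y S ω) (schur κ) *
        powerSums y T (fun i => (c i : ℝ)) ω ∂P : ℝ) : ℂ) *
        vander (fun l => (expo (0 : Fin N → ℕ) l : ℂ)) =
      residueSum m (fun i => (c i : ℂ)) (fun i => jacobiFactor α M (T i) (c i))
        fun l => (expo κ l : ℂ) := by
  induction m generalizing S κ with
  | zero =>
    simp only [powerSums, Finset.univ_eq_empty, Finset.prod_empty, mul_one, residueSum]
    rw [hy.risingRatio_mul_integral_eval_schur hα hS]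
    have := congrArg (fun r : ℝ => (r : ℂ)) (eval_one_schur κ)
    simp only [vander, Complex.ofReal_mul, Complex.ofReal_prod, Complex.ofReal_sub,
      Complex.ofReal_natCast] at this ⊢
    exact this
  | succ m ih =>
    have hc' : ∀ i, 0 < (c i : ℝ) := fun i => Nat.cast_pos.2 (hc i)
    -- At the latest time T_0 the first power sum is absorbed into the Schur polynomial.
    have hsplit : ∀ ω, eval (y (T 0) ω) (schur κ) * powerSums y T (fun i => (c i : ℝ)) ω =
        ∑ j, eval (y (T 0) ω) (schur (κ + Pi.single j (c 0))) *
          powerSums y (fun i => T i.succ) (fun i => (c i.succ : ℝ)) ω := by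
      intro ω
      have h1 := congrArg (eval (y (T 0) ω)) (psum_mul_schur κ (c 0))
      simp only [map_mul, map_sum, map_pow, eval_X] at h1
      rw [← Finset.sum_mul, ← h1]
      simp only [powerSums, Fin.prod_univ_succ, Real.rpow_natCast]
      ring
    have hmeas : Measurable (powerSums y (fun i => T i.succ) fun i => (c i.succ : ℝ)) :=
      measurable_powerSums (fun i => hy.measurable _ (hT1 i.succ)) _
    have hbd := hy.ae_abs_powerSums_le (fun i => hT1 i.succ) fun i => hc' i.succ
    -- Move from time S back to T_0. As T is decreasing, the whole product of power sums is known at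
    -- time T_0.
    rw [hy.risingRatio_mul_integral hα (hT1 0) (hTS 0) κ
      (measurable_powerSums (fun i => measurable_history y (hT1 i) (hT (Fin.zero_le i))) _) (hy.ae_abs_powerSums_le hT1 hc')]
    simp only [hsplit]
    rw [integral_finsetSum _ fun j _ => hy.integrable_eval_mul (hT1 0) _ hmeas hbd, residueSum,
      Finset.mul_sum, Complex.ofReal_sum, Finset.sum_mul]
    refine Finset.sum_congr rfl fun j _ => ?_
    have h2 := ih (T := fun i => T i.succ) (fun i k hik => hT (Fin.succ_le_succ_iff.2 hik))
      (fun i => hT1 i.succ) (c := fun i => c i.succ) (fun i => hc i.succ) (hT1 0)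
      (fun i => hT (Fin.zero_le _)) (κ + Pi.single j (c 0))
    have h3 : (fun l => (expo (κ + Pi.single j (c 0)) l : ℂ)) =
        (fun l => (expo κ l : ℂ)) + Pi.single j (c 0 : ℂ) := by
      funext l
      rw [expo_add_single]
      rcases eq_or_ne l j with rfl | hl
      · simp
      · simp [Pi.single_eq_of_ne hl]
    rw [h3] at h2
    -- The induction hypothesis is taken with S = T_0 and carries the normalization of κ + c_0 e_j;
    -- the value of `jacobiFactor` converts it into that of κ.
    rw [← h2, jacobiFactor_eq hα]
    have h4 : ((risingRatio α M (T 0) (κ + Pi.single j (c 0)) : ℝ) : ℂ) ≠ 0 :=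
      Complex.ofReal_ne_zero.2 (risingRatio_pos hα M (T 0) _).ne'
    push_cast
    field_simp

end IsJacobiProductProcess

end JacobiProduct


/-! ### From integer to real exponents. -/

namespace JacobiProduct

open MeasureTheory MvPolynomial

section RealExponents

theorem norm_ofReal_cpow_le_one {x : ℝ} (hx : 0 ≤ x ∧ x ≤ 1) {z : ℂ} (hz : 0 < z.re) :
    ‖(x : ℂ) ^ z‖ ≤ 1 := by
  rw [Complex.norm_cpow_eq_rpow_re_of_nonneg hx.1 hz.ne']
  exact Real.rpow_le_one hx.1 hx.2 hz.le

theorem norm_ofReal_cpow_mul_log_le {x : ℝ} (hx : 0 ≤ x ∧ x ≤ 1) {ε : ℝ} (hε : 0 < ε) {z : ℂ}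
    (hz : ε ≤ z.re) : ‖(x : ℂ) ^ z * Complex.log x‖ ≤ 1 / ε := by
  rcases hx.1.eq_or_lt with rfl | h0
  · simp [hε.le]
  · rw [norm_mul, Complex.norm_cpow_eq_rpow_re_of_pos h0, ← Complex.ofReal_log hx.1,
      Complex.norm_real, Real.norm_eq_abs]
    have h1 := (Real.abs_log_mul_self_rpow_lt x ε h0 hx.2 hε).le
    rw [abs_mul, abs_of_pos (Real.rpow_pos_of_pos h0 ε), mul_comm] at h1
    refine le_trans ?_ h1
    exact mul_le_mul_of_nonneg_right (Real.rpow_le_rpow_of_exponent_ge h0 hx.2 hz) (abs_nonneg _)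

/-- For 0 ≤ x ≤ 1 and Re z ≥ ε > 0, |x^z| ≤ 1 and |x^z log x| ≤ 1 / ε. This permits differentiation
under the integral and bounds the result by a constant. -/
theorem polyGrowth_integral_cpow {Ω : Type*} [MeasurableSpace Ω] {P : Measure Ω}
    [IsFiniteMeasure P] {h : Ω → ℝ} (hh : Measurable h) {C : ℝ} (hC : ∀ᵐ ω ∂P, |h ω| ≤ C)
    {Y : Ω → ℝ} (hY : Measurable Y) (hY01 : ∀ᵐ ω ∂P, 0 ≤ Y ω ∧ Y ω ≤ 1) :
    PolyGrowth fun z => ∫ ω, (h ω : ℂ) * (Y ω : ℂ) ^ z ∂P := by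
  have hmeas : ∀ z : ℂ, AEStronglyMeasurable (fun ω => (h ω : ℂ) * (Y ω : ℂ) ^ z) P := fun z =>
    ((Complex.measurable_ofReal.comp hh).mul
      ((Complex.measurable_ofReal.comp hY).pow_const z)).aestronglyMeasurable
  have hbound : ∀ z : ℂ, 0 < z.re → ∀ᵐ ω ∂P, ‖(h ω : ℂ) * (Y ω : ℂ) ^ z‖ ≤ C := fun z hz => by
    filter_upwards [hC, hY01] with ω h1 h2
    rw [norm_mul, Complex.norm_real, Real.norm_eq_abs]
    exact (mul_le_of_le_one_right (abs_nonneg _) (norm_ofReal_cpow_le_one h2 hz)).trans h1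
  refine ⟨fun z₀ hz₀ => DifferentiableAt.differentiableWithinAt ?_, C * P.real Set.univ, 0,
    fun z hz => ?_⟩
  · have hz₀' : 0 < z₀.re := hz₀
    have hs : {z : ℂ | z₀.re / 2 < z.re} ∈ nhds z₀ :=
      (isOpen_lt continuous_const Complex.continuous_re).mem_nhds
        (show z₀.re / 2 < z₀.re by linarith)
    have key := hasDerivAt_integral_of_dominated_loc_of_deriv_le (μ := P) (x₀ := z₀)
      (F := fun z ω => (h ω : ℂ) * (Y ω : ℂ) ^ z)
      (F' := fun z ω => (h ω : ℂ) * ((Y ω : ℂ) ^ z * Complex.log (Y ω)))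
      (bound := fun _ => C * (1 / (z₀.re / 2))) hs (Filter.Eventually.of_forall hmeas)
      (Integrable.of_bound (hmeas z₀) C (hbound z₀ hz₀)) ?_ ?_ (integrable_const _) ?_
    · exact key.2.differentiableAt
    · exact ((Complex.measurable_ofReal.comp hh).mul
        (((Complex.measurable_ofReal.comp hY).pow_const z₀).mul
          (Complex.measurable_log.comp (Complex.measurable_ofReal.comp hY)))).aestronglyMeasurable
    · filter_upwards [hC, hY01] with ω h1 h2 z hz
      rw [norm_mul, Complex.norm_real, Real.norm_eq_abs]
      exact mul_le_mul h1 (norm_ofReal_cpow_mul_log_le h2 (half_pos hz₀') (le_of_lt hz))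
        (norm_nonneg _) ((abs_nonneg _).trans h1)
    · refine Filter.Eventually.of_forall fun ω z hz => HasDerivAt.const_mul _ ?_
      have hz0 : z ≠ 0 := by
        rintro rfl
        have : z₀.re / 2 < 0 := hz
        linarith
      simpa using (hasDerivAt_id z).const_cpow (c := (Y ω : ℂ)) (Or.inr hz0)
  · rw [pow_zero, mul_one]
    exact norm_integral_le_of_norm_le_const (hbound z hz)

namespace IsJacobiProductProcess

variable {Ω : Type*} [mΩ : MeasurableSpace Ω] {P : Measure Ω} [IsProbabilityMeasure P] {N : ℕ}
  {α : ℕ → ℝ} {M : ℕ → ℕ} {y : ℕ → Ω → Fin N → ℝ}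

/-- The joint moments of the power sums for real exponents. -/
theorem integral_powerSums_eq_residueSum (hα : ∀ τ, 1 ≤ τ → 0 < α τ)
    (hy : IsJacobiProductProcess P α M y) {m : ℕ} {T : Fin m → ℕ} (hT : Antitone T)
    (hT1 : ∀ i, 1 ≤ T i) {c : Fin m → ℝ} (hc : ∀ i, 0 < c i) :
    ((∫ ω, powerSums y T c ω ∂P : ℝ) : ℂ) * vander (fun l => (expo (0 : Fin N → ℕ) l : ℂ)) =
      residueSum m (fun i => (c i : ℂ)) (fun i => jacobiFactor α M (T i) (c i))
        fun l => (expo (0 : Fin N → ℕ) l : ℂ) := by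
  -- Induction on the set s of indices whose exponents may be arbitrary positive reals; the others
  -- are integers.
  suffices hsuff : ∀ s : Finset (Fin m), ∀ c : Fin m → ℝ, (∀ i, 0 < c i) →
      (∀ i ∉ s, ∃ n : ℕ, c i = n) →
      ((∫ ω, powerSums y T c ω ∂P : ℝ) : ℂ) * vander (fun l => (expo (0 : Fin N → ℕ) l : ℂ)) =
        residueSum m (fun i => (c i : ℂ)) (fun i => jacobiFactor α M (T i) (c i))
          fun l => (expo (0 : Fin N → ℕ) l : ℂ) from
    hsuff Finset.univ c hc fun i hi => absurd (Finset.mem_univ i) hi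
  intro s
  induction s using Finset.induction_on with
  | empty =>
    intro c hc hint
    choose n hn using fun i => hint i (Finset.notMem_empty i)
    obtain rfl : c = fun i => (n i : ℝ) := funext hn
    have hn0 : ∀ i, 0 < n i := fun i => Nat.cast_pos.1 (hc i)
    obtain ⟨S, hS1, hS⟩ : ∃ S, 1 ≤ S ∧ ∀ i, T i ≤ S :=
      ⟨∑ i, T i + 1, by omega, fun i =>
        (Finset.single_le_sum (fun _ _ => Nat.zero_le _) (Finset.mem_univ i)).trans
          (Nat.le_succ _)⟩
    have h1 := hy.risingRatio_mul_integral_powerSums hα hT hT1 hn0 hS1 hS 0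
    have h2 : risingRatio α M S (0 : Fin N → ℕ) = 1 :=
      Finset.prod_eq_one fun τ hτ =>
        div_self (risingExpo_pos (hα τ (Finset.mem_Icc.1 hτ).1) _ _).ne'
    simp only [schur_zero, map_one, one_mul, h2] at h1
    simpa using h1
  | insert a s ha ih =>
    intro c hc hint
    set c' : Fin m → ℂ → ℂ := fun i z => if i = a then z else (c i : ℂ) with hc'
    have hcast : ∀ x : ℝ, (fun i => c' i x) = fun i => ((Function.update c a x i : ℝ) : ℂ) := by
      intro x
      funext i
      rcases eq_or_ne i a with rfl | hi
      · simp [hc']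
      · simp [hc', hi]
    set h : Ω → ℝ := fun ω => ∏ i ∈ Finset.univ.erase a, ∑ k, (y (T i) ω k) ^ (c i) with hh
    have hhm : Measurable h := Finset.measurable_fun_prod _ fun i _ =>
      Finset.measurable_fun_sum _ fun k _ =>
        (measurable_pi_iff.1 (hy.measurable _ (hT1 i)) k).pow_const (c i)
    have hsplit : ∀ (x : ℝ) ω, powerSums y T (Function.update c a x) ω =
        ∑ k, h ω * (y (T a) ω k) ^ x := by
      intro x ω
      rw [powerSums, ← Finset.mul_prod_erase _ _ (Finset.mem_univ a), ← Finset.mul_sum, mul_comm]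
      congr 1
      · exact Finset.prod_congr rfl fun i hi => by
          rw [Function.update_of_ne (Finset.ne_of_mem_erase hi)]
      · rw [Function.update_self]
    have hcube : ∀ k, ∀ᵐ ω ∂P, 0 ≤ y (T a) ω k ∧ y (T a) ω k ≤ 1 := fun k => by
      filter_upwards [hy.mem_cube (T a) (hT1 a)] with ω hω using hω.2 k
    have hhb : ∀ᵐ ω ∂P, |h ω| ≤ (N : ℝ) ^ (Finset.univ.erase a).card := by
      filter_upwards [ae_all_iff.2 fun i => hy.mem_cube (T i) (hT1 i)] with ω hω
      rw [hh, Finset.abs_prod, ← Finset.prod_const]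
      refine Finset.prod_le_prod (fun _ _ => abs_nonneg _) fun i _ => ?_
      refine (Finset.abs_sum_le_sum_abs _ _).trans ((Finset.sum_le_sum (g := fun _ => (1 : ℝ))
        fun k _ => ?_).trans (by simp))
      have h1 := (hω i).2 k
      rw [abs_of_nonneg (Real.rpow_nonneg h1.1 _)]
      exact Real.rpow_le_one h1.1 h1.2 (hc i).le
    have hYm : ∀ k, Measurable fun ω => y (T a) ω k := fun k =>
      measurable_pi_iff.1 (hy.measurable _ (hT1 a)) k
    -- The difference of the two sides as a function of the exponent with index a. It vanishes at
    -- the positive integers by the induction hypothesis.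
    set f : ℂ → ℂ := fun z => (∑ k, ∫ ω, (h ω : ℂ) * (y (T a) ω k : ℂ) ^ z ∂P) *
        vander (fun l => (expo (0 : Fin N → ℕ) l : ℂ)) -
      residueSum m (fun i => c' i z) (fun i => jacobiFactor α M (T i) (c' i z))
        (fun l => (expo (0 : Fin N → ℕ) l : ℂ)) with hf
    have hpoly : PolyGrowth f := by
      refine PolyGrowth.sub (PolyGrowth.mul (PolyGrowth.sum _ fun k _ =>
        polyGrowth_integral_cpow hhm hhb (hYm k) (hcube k)) (.const _)) ?_
      refine polyGrowth_residueSum hα M T (x := fun l _ => (expo (0 : Fin N → ℕ) l : ℂ))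
        (fun i => ?_) (fun i z hz => ?_) (fun l => .const _) (fun l z _ => by simp)
      · simp only [hc']
        split_ifs
        exacts [.id, .const _]
      · simp only [hc']
        split_ifs
        exacts [hz.le, (hc i).le]
    have hfx : ∀ x : ℝ, 0 < x → f x =
        ((∫ ω, powerSums y T (Function.update c a x) ω ∂P : ℝ) : ℂ) *
          vander (fun l => (expo (0 : Fin N → ℕ) l : ℂ)) -
        residueSum m (fun i => ((Function.update c a x i : ℝ) : ℂ))
          (fun i => jacobiFactor α M (T i) ((Function.update c a x i : ℝ) : ℂ))
          fun l => (expo (0 : Fin N → ℕ) l : ℂ) := by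
      intro x hx
      have h1 : ∀ k, ∀ᵐ ω ∂P, (h ω : ℂ) * (y (T a) ω k : ℂ) ^ (x : ℂ) =
          ((h ω * (y (T a) ω k) ^ x : ℝ) : ℂ) := fun k => by
        filter_upwards [hcube k] with ω hω
        rw [Complex.ofReal_mul, Complex.ofReal_cpow hω.1]
      have h2 : ∀ k, Integrable (fun ω => h ω * (y (T a) ω k) ^ x) P := fun k => by
        refine integrable_of_bound (hhm.mul ((hYm k).pow_const x))
          (C := (N : ℝ) ^ (Finset.univ.erase a).card) ?_
        filter_upwards [hhb, hcube k] with ω h3 h4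
        rw [abs_mul, abs_of_nonneg (Real.rpow_nonneg h4.1 _)]
        exact (mul_le_of_le_one_right (abs_nonneg _) (Real.rpow_le_one h4.1 h4.2 hx.le)).trans h3
      simp only [hf, hsplit]
      rw [integral_finsetSum _ fun k _ => h2 k, Complex.ofReal_sum]
      congr 2
      · refine Finset.sum_congr rfl fun k _ => ?_
        rw [integral_congr_ae (h1 k)]
        exact integral_ofReal
      · exact hcast x
      · funext i
        rw [← congrFun (hcast x) i]
    have hzero : ∀ n : ℕ, 0 < n → f n = 0 := by
      intro n hn
      have h1 := hfx n (Nat.cast_pos.2 hn)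
      rw [Complex.ofReal_natCast] at h1
      rw [h1, sub_eq_zero]
      refine ih _ (fun i => ?_) fun i hi => ?_
      · rcases eq_or_ne i a with rfl | hia
        · rw [Function.update_self]
          exact Nat.cast_pos.2 hn
        · rw [Function.update_of_ne hia]
          exact hc i
      · rcases eq_or_ne i a with rfl | hia
        · exact ⟨n, Function.update_self _ _ _⟩
        · rw [Function.update_of_ne hia]
          exact hint i fun h => hi ((Finset.mem_insert.1 h).resolve_left hia)
    have hfin := hpoly.eq_zero hzero (hc a)
    rwa [hfx _ (hc a), Function.update_eq_self, sub_eq_zero] at hfin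

end IsJacobiProductProcess

theorem regular_jacobiFactor {α : ℕ → ℝ} {M : ℕ → ℕ} {T : ℕ} {γ : Contour} (c : ℂ)
    (h : ∀ τ ∈ Finset.Icc 1 T, ∀ l ∈ Finset.Icc 1 (M τ),
      γ.Excludes ((α τ : ℂ) + (l : ℂ) - 1)) : γ.Regular (jacobiFactor α M T c) := by
  refine Contour.Regular.prod _ fun τ hτ => Contour.Regular.prod _ fun l hl => ?_
  convert (Contour.Regular.add_const γ (c - α τ - l + 1)).mul
    (Contour.Regular.inv_sub (h τ hτ l hl)) using 2 with u
  rw [div_eq_mul_inv]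
  congr 1
  · ring
  · congr 1
    ring

theorem prod_expo_zero {N : ℕ} (f : ℂ → ℂ) :
    ∏ l, f (expo (0 : Fin N → ℕ) l) = ∏ l ∈ Finset.Icc 1 N, f ((l : ℂ) - 1) := by
  rw [prod_Icc_one_eq_prod_range, ← Finset.prod_range_reflect,
    ← Fin.prod_univ_eq_prod_range (fun l => f (((N - 1 - l + 1 : ℕ) : ℂ) - 1))]
  refine Finset.prod_congr rfl fun l _ => ?_
  simp [expo]

end RealExponents

end JacobiProduct


/-! ### The contour integral formula. -/

open JacobiProduct in
theorem theorem4p2 {Ω : Type*} [MeasurableSpace Ω] (P : MeasureTheory.Measure Ω)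
    [MeasureTheory.IsProbabilityMeasure P] (N : ℕ) (hN : 0 < N)
    (α : ℕ → ℝ) (hα : ∀ τ, 1 ≤ τ → 0 < α τ) (M : ℕ → ℕ) (hM : ∀ τ, 1 ≤ τ → 0 < M τ)
    (y : ℕ → Ω → Fin N → ℝ) (hy : IsJacobiProductProcess P α M y)
    (m : ℕ) (T : Fin m → ℕ) (hT : Antitone T) (hT0 : ∀ i, 0 < T i)
    (c : Fin m → ℝ) (hc : ∀ i, 0 < c i)
    (U : Fin m → Contour)
    (hU_in : ∀ i, ∀ ℓ ∈ Finset.Icc 1 N, (U i).Encloses (-(c i : ℂ) - (ℓ : ℂ) + 1))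
    (hU_out : ∀ i, ∀ τ ∈ Finset.Icc 1 (T i), ∀ ℓ ∈ Finset.Icc 1 (M τ),
      (U i).Excludes ((α τ : ℂ) + (ℓ : ℂ) - 1))
    (hU_nested : ∀ i j, i < j →
      (U i).EnclosedBy ((U j).translate (-(c i : ℂ))) ∧
      (U i).EnclosedBy ((U j).translate (c j : ℂ))) :
    ((∫ ω, ∏ i, ∑ k, (y (T i) ω k) ^ (c i) ∂P : ℝ) : ℂ) =
      (∏ i, (-(c i : ℂ))⁻¹) / (2 * Real.pi * Complex.I) ^ m *
        multiContourIntegral U (fun u =>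
          (∏ i, ∏ j ∈ Finset.Ioi i,
            ((u j - u i) * (u j + c j - u i - c i)) /
              ((u j - u i - c i) * (u j + c j - u i))) *
          ∏ i, ((∏ ℓ ∈ Finset.Icc 1 N, (u i + (ℓ : ℂ) - 1) / (u i + c i + (ℓ : ℂ) - 1)) *
            ∏ τ ∈ Finset.Icc 1 (T i), ∏ ℓ ∈ Finset.Icc 1 (M τ),
              (u i + c i - (α τ : ℂ) - (ℓ : ℂ) + 1) / (u i - (α τ : ℂ) - (ℓ : ℂ) + 1))) := by
  have hnest : Nested U (fun i => (c i : ℂ)) (fun i => jacobiFactor α M (T i) (c i))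
      fun l => (expo (0 : Fin N → ℕ) l : ℂ) := by
    refine ⟨fun i l => ?_, fun i => regular_jacobiFactor _ (hU_out i),
      fun i j hij => (hU_nested i j hij).1, fun i j hij => (hU_nested i j hij).2⟩
    have hl := l.2
    have h1 := hU_in i (expo (0 : Fin N → ℕ) l + 1)
      (Finset.mem_Icc.2 ⟨Nat.le_add_left _ _, by simp only [expo, Pi.zero_apply]; omega⟩)
    convert h1 using 1
    push_cast
    ring
  have hV : vander (fun l => (expo (0 : Fin N → ℕ) l : ℂ)) ≠ 0 :=
    vander_ne_zero.2 (Nat.cast_injective.comp (expo_injective_of_antitone antitone_const))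
  have hmom := hy.integral_powerSums_eq_residueSum hα hT hT0 hc
  have hc0 : (∏ i, (-(c i : ℂ))) ≠ 0 := Finset.prod_ne_zero_iff.2 fun i _ =>
    neg_ne_zero.2 (Complex.ofReal_ne_zero.2 (hc i).ne')
  have hpi : (2 * Real.pi * Complex.I : ℂ) ^ m ≠ 0 := pow_ne_zero _ (by simp [Real.pi_ne_zero])
  have hF : (residueIntegrand (fun i => (c i : ℂ)) (fun i => jacobiFactor α M (T i) (c i))
      fun l => (expo (0 : Fin N → ℕ) l : ℂ)) = fun u : Fin m → ℂ =>
          (∏ i, ∏ j ∈ Finset.Ioi i,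
            ((u j - u i) * (u j + (c j : ℂ) - u i - (c i : ℂ))) /
              ((u j - u i - (c i : ℂ)) * (u j + (c j : ℂ) - u i))) *
          ∏ i, ((∏ ℓ ∈ Finset.Icc 1 N, (u i + (ℓ : ℂ) - 1) / (u i + c i + (ℓ : ℂ) - 1)) *
            ∏ τ ∈ Finset.Icc 1 (T i), ∏ ℓ ∈ Finset.Icc 1 (M τ),
              (u i + c i - (α τ : ℂ) - (ℓ : ℂ) + 1) / (u i - (α τ : ℂ) - (ℓ : ℂ) + 1)) := by
    funext u
    simp only [residueIntegrand, crossFactor, jacobiFactor]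
    congr 1
    refine Finset.prod_congr rfl fun i _ => ?_
    rw [prod_expo_zero fun x => (u i + x) / (u i + c i + x)]
    simp only [add_sub_assoc]
  have hI : multiContourIntegral U (residueIntegrand (fun i => (c i : ℂ))
      (fun i => jacobiFactor α M (T i) (c i)) fun l => (expo (0 : Fin N → ℕ) l : ℂ)) =
      (2 * Real.pi * Complex.I) ^ m * (∏ i, (-(c i : ℂ))) *
        ((∫ ω, powerSums y T c ω ∂P : ℝ) : ℂ) := by
    -- Both the moment and the contour integral were computed only after multiplication by Δ(λ). For
    -- κ = 0 the exponents N - 1, …, 0 are distinct, so this factor can be cancelled.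
    refine mul_left_cancel₀ hV ?_
    rw [hnest.vander_mul_multiContourIntegral, ← hmom]
    ring
  rw [← hF, hI, Finset.prod_inv_distrib]
  change ((∫ ω, powerSums y T c ω ∂P : ℝ) : ℂ) = _
  field_simp
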